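/- \textbf{Setting.} Let $d\ge 1$, $L>0$, $\bold{j}_*\in\mathbb{Z}^d\setminus\{\bold 0\}$, $\phi>0$ (the Fourier component $\phi_{\bold j_*}=\phi_{-\bold j_*}$ of the pair potential) and let $N>0$ be even. Put $k_{\bold j}=\frac{2\pi}{L}\bold j$, $\Delta_0=\min_{\bold j\ne \bold 0}k_{\bold j}^2$, $\epsilon=k_{\bold j_*}^2/\phi$, $E^{Bog}=-[k_{\bold j_*}^2+\phi-\sqrt{(k_{\bold j_*}^2)^2+2\phi k_{\bold j_*}^2}]$ and $w=\sqrt{\epsilon}\,\phi\sqrt{\epsilon^2+2\epsilon}$. Let $\mathcal F^N$ be the $N$-particle subspace of the bosonic Fock space over $L^2$ of the periodic box of side $L$, with creation and annihilation operators $a^*_{\bold j},a_{\bold j}$ of the modes $k_{\bold j}$, and on $\mathcal F^N$ let $$W=\tfrac{\phi}{N}a_{\bold 0}^*a_{\bold 0}^*a_{\bold j_*}a_{-\bold j_*},\quad W^*=\tfrac{\phi}{N}a_{\bold 0}a_{\bold 0}a^*_{\bold j_*}a^*_{-\bold j_*},$$ $$H=\sum_{\bold j\ne\pm\bold j_*}k_{\bold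 j}^2a_{\bold j}^*a_{\bold j}+\big(k_{\bold j_*}^2+\tfrac{\phi}{N}a_{\bold 0}^*a_{\bold 0}\big)\big(a^*_{\bold j_*}a_{\bold j_*}+a^*_{-\bold j_*}a_{-\bold j_*}\big)+W+W^*$$ on the domain of the kinetic energy (this is $H^{Bog}_{\bold j_*}$). For even $i$ let $Q^{(i,i+1)}$ and $Q^{(>i+1)}$ be the projections onto the span of the product states with $N-i$ or $N-i-1$, respectively with fewer than $N-i-1$, particles in the modes $\pm\bold j_*$. For real $z$ put $\mathscr K^{(-2)}(z)=H-z$ and, for $i=0,2,\dots,N-2$, $$\mathscr K^{(i)}=Q^{(>i+1)}\mathscr K^{(i-2)}Q^{(>i+1)}-Q^{(>i+1)}\mathscr K^{(i-2)}Q^{(i,i+1)}\frac{1}{Q^{(i,i+1)}\mathscr K^{(i-2)}Q^{(i,i+1)}}Q^{(i,i+1)}\mathscr K^{(i-2)}Q^{(>i+1)}.$$ Write $R_r(z)$ for the inverse of $Q^{(N-2r,N-2r+1)}\mathscr K^{(N-2r-2)}(z)Q^{(N-2r,N-2r+1)}$ on $Q^{(N-2r,N-2r+1)}\mathcal F^N$,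 $W^*_{i,i'}=Q^{(i,i+1)}W^*Q^{(i',i'+1)}$, let $\eta$ be the normalized state with all $N$ particles in the zero mode, and $f(z)=-z-\langle\eta,W R_1(z)W^*\eta\rangle$. We say that \emph{$z_*$ is the ground state energy given by the flow} if (i) for all $z\le E^{Bog}+w$ the inverses $R_r(z)$, $1\le r\le N/2$, exist as bounded operators, and $z_*$ is the only zero of $f$ in $(-\infty,E^{Bog}+w]$; (ii) the spectrum of $H$ is contained in $[z_*,\infty)$; (iii) $z_*$ is an eigenvalue of $H$ whose eigenspace is one-dimensional and spanned by $$\psi=\eta-u_1-\sum_{l=2}^{N/2}u_l,\qquad u_1=R_1(z_*)Q^{(N-2,N-1)}W^*\eta,\quad u_l=\Big\{\prod_{r=l}^{2}\big[-R_r(z_*)W^*_{N-2r,N-2r+2}\big]\Big\}u_1$$ (the factor with $r=l$ stands leftmost). We say that \emph{the gap above $z_*$ is at least $g$} if the spectrum of $H$ without $z_*$ is contained in $[z_*+g,\infty)$. Put $g_0=\min\{\frac{\Delta_0}{2},\frac{3-2\sqrt2}{6}\,w\}$. Consider the conditions $$(\mathrm A)_{\gamma,k}:\ \epsilon^2+\tfrac{\epsilon}{N^\gamma}+\tfrac1N\le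 k\,\epsilon\sqrt\epsilon,\quad \tfrac{1}{N^{1-\gamma}}\le k\,\epsilon;\qquad (\mathrm B)_{\mu,\theta,C}:\ \tfrac{\phi}{\Delta_0}\tfrac{N^\mu}{N(N-N^\mu)}<\tfrac12,\quad \tfrac1{N^\mu}\le C(\sqrt\epsilon)^{1+\theta}.$$ \textbf{Theorem.} (1) For every $\gamma\in(0,1)$ there is $k>0$ such that for all $\mu\in(0,1)$, $\theta,C>0$ there is $\epsilon_0>0$ such that for every $\epsilon\in(0,\epsilon_0]$ there is a summable sequence $(c_l)_{l\ge1}$ with the following property. For all $d,L,\phi,\bold j_*,N$ as above with $k_{\bold j_*}^2/\phi=\epsilon$ that satisfy $(\mathrm A)_{\gamma,k}$ and $(\mathrm B)_{\mu,\theta,C}$ there is a ground state energy $z_*$ given by the flow, the gap above $z_*$ is at least $g_0$, and $\|u_l\|\le c_l$ for $1\le l\le N/2$. (2) The conditions hold in the mean field regime: for all $\gamma,\mu\in(0,1)$, $k,\theta,C>0$ there is $\epsilon_0>0$ such that for all $d,L,\phi,\bold j_*$ with $\epsilon\le\epsilon_0$, $(\mathrm A)_{\gamma,k}$ and $(\mathrm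 B)_{\mu,\theta,C}$ hold for all sufficiently large $N$. They hold at fixed large density: for all $k,C>0$ there is $\epsilon_0>0$ such that for every $\phi>0$ there is $\rho_0>0$ such that $(\mathrm A)_{1/3,k}$ and $(\mathrm B)_{2/3,1,C}$ hold whenever $d\ge3$, $\rho\ge\rho_0$, $L>1$, $N=\rho L^d$ and $\epsilon\le\epsilon_0$. (3) (Mean field regime.) There is $\epsilon_0>0$ such that for all $d\ge1$, $L,\phi,\bold j_*$ with $\epsilon\le\epsilon_0$: for all sufficiently large even $N$ there is a ground state energy $z_*$ given by the flow, the gap above it is at least $\frac{\Delta_0}{2}$, and $z_*\to E^{Bog}$ as $N\to\infty$. (4) (Fixed density.) There is $\epsilon_0>0$ such that for every $\phi>0$ there is $\rho_0>0$ such that, whenever $d\ge3$, $\rho\ge\rho_0$, $L>1$, $N=\rho L^d$ is an even integer and $\epsilon\le\epsilon_0$, there is a ground state energy $z_*$ given by the flow and the gap above it is at least $g_0$. Moreover, at fixed $\bold j_*$, $\phi$ and $\rho$, as $L\to\infty$ with $N=\rho L^d$ an even integer, the ground state energy $z_*$ given by the flow exists for $L$ large and $z_*-E^{Bog}\to0$: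 for every $\rho>0$ if $d\ge4$, and for every $\rho\ge\rho_0(\phi)$ if $d=3$. -/

import Mathlib

open scoped ENNReal
open Filter Topology

noncomputable section

namespace ThreeMode

/-! ### Fock space of a gas in the periodic box of side `L` in occupation-number representation

The one-particle space `L²(Λ)` has the orthonormal basis of plane waves `e^{i k_p · x} / |Λ|^{1/2}`,
`k_p = (2π/L) p`, `p ∈ ℤ^d`; a product state of the bosonic Fock space is given by finitely many
occupation numbers, and these states form an orthonormal basis. -/

/-- Field modes, labelled by `ℤ^d`. -/
abbrev Mode (d : ℕ) := Fin d → ℤ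

/-- Occupation numbers of a product state. -/
abbrev Occ (d : ℕ) := Mode d →₀ ℕ

/-- The space of vectors of the Fock space with a bounded number of particles: square-summable
coefficients `ψ n` in the product-state basis, vanishing for large particle number. -/
def FinFock (d : ℕ) : Submodule ℂ (Occ d → ℂ) where
  carrier := {ψ | Memℓp ψ 2 ∧ ∃ M : ℕ, ∀ n, M < n.degree → ψ n = 0}
  add_mem' := by
    rintro ψ χ ⟨h1, M1, h2⟩ ⟨h3, M2, h4⟩
    refine ⟨h1.add h3, max M1 M2, fun n hn => ?_⟩
    simp [h2 n (lt_of_le_of_lt (le_max_left _ _) hn), h4 n (lt_of_le_of_lt (le_max_right _ _) hn)]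
  zero_mem' := ⟨zero_memℓp, 0, fun _ _ => rfl⟩
  smul_mem' := by
    rintro c ψ ⟨h1, M, h2⟩
    exact ⟨h1.const_smul c, M, fun n hn => by simp [h2 n hn]⟩

theorem memℓp_two_iff {ι : Type*} (ψ : ι → ℂ) : Memℓp ψ 2 ↔ Summable fun n => ‖ψ n‖ ^ 2 := by
  rw [memℓp_gen_iff (by norm_num)]
  norm_num

theorem occ_le_degree {d : ℕ} (n : Occ d) (p : Mode d) : n p ≤ n.degree := by
  by_cases h : p ∈ n.support
  · exact Finset.single_le_sum (f := fun q => n q) (fun _ _ => Nat.zero_le _) h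
  · simp [Finsupp.notMem_support_iff.mp h]

/-- The annihilation operator `a_p`: `(a_p ψ)(n) = √(n_p + 1) ψ(n + δ_p)`. -/
def annih {d : ℕ} (p : Mode d) : FinFock d →ₗ[ℂ] FinFock d where
  toFun ψ := ⟨fun n => (Real.sqrt (n p + 1) : ℂ) * ψ.1 (n + Finsupp.single p 1), by
    obtain ⟨ψ, h1, M, h2⟩ := ψ
    have hz : ∀ n : Occ d, M ≤ n.degree → ψ (n + Finsupp.single p 1) = 0 := fun n hn =>
      h2 _ (by simp [map_add]; omega)
    refine ⟨?_, M, fun n hn => by simp [hz n hn.le]⟩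
    rw [memℓp_two_iff] at h1 ⊢
    have hs : Summable fun n : Occ d => (M + 1 : ℝ) * ‖ψ (n + Finsupp.single p 1)‖ ^ 2 :=
      (h1.comp_injective (add_left_injective (Finsupp.single p 1 : Occ d))).mul_left _
    refine Summable.of_nonneg_of_le (fun n => by positivity) (fun n => ?_) hs
    by_cases hn : M ≤ n.degree
    · simp [hz n hn]
    · have h3 : (n p : ℝ) + 1 ≤ M + 1 := by
        have := occ_le_degree n p
        exact_mod_cast (by omega : n p + 1 ≤ M + 1)
      rw [norm_mul, mul_pow, Complex.norm_real, Real.norm_eq_abs, sq_abs,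
        Real.sq_sqrt (by positivity)]
      gcongr⟩
  map_add' ψ χ := by ext n; simp [mul_add]
  map_smul' c ψ := by ext n; simp [mul_left_comm]

/-- The creation operator `a*_p`: `(a*_p ψ)(n) = √(n_p) ψ(n - δ_p)`, which is `0` if `n_p = 0`. -/
def create {d : ℕ} (p : Mode d) : FinFock d →ₗ[ℂ] FinFock d where
  toFun ψ := ⟨fun n => (Real.sqrt (n p) : ℂ) * ψ.1 (n - Finsupp.single p 1), by
    obtain ⟨ψ, h1, M, h2⟩ := ψ
    have hex : ∀ n : Occ d, n p ≠ 0 → ∃ m, m + Finsupp.single p 1 = n := fun n hn =>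
      ⟨n - Finsupp.single p 1, tsub_add_cancel_of_le (by
        rw [Finsupp.single_le_iff]; omega)⟩
    refine ⟨?_, M + 1, fun n hn => ?_⟩
    · rw [memℓp_two_iff] at h1 ⊢
      rw [← (add_left_injective (Finsupp.single p 1 : Occ d)).summable_iff]
      · refine Summable.of_nonneg_of_le (fun n => sq_nonneg _) (fun n => ?_)
          (h1.mul_left (M + 1 : ℝ))
        by_cases hn : M < n.degree
        · simp [h2 n hn]
        · have h3 : (n p : ℝ) + 1 ≤ M + 1 := by
            have := occ_le_degree n p
            exact_mod_cast (by omega : n p + 1 ≤ M + 1)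
          simp only [Function.comp, Finsupp.add_apply, Finsupp.single_eq_same, Nat.cast_add,
            Nat.cast_one, add_tsub_cancel_right]
          rw [norm_mul, mul_pow, Complex.norm_real, Real.norm_eq_abs, sq_abs,
            Real.sq_sqrt (by positivity)]
          gcongr
      · intro n hn
        have : n p = 0 := by
          by_contra h
          exact hn (hex n h)
        simp [this]
    · by_cases h : n p = 0
      · simp [h]
      · obtain ⟨m, rfl⟩ := hex n h
        have : M < m.degree := by simp [map_add] at hn; omega
        simp [h2 m this]⟩
  map_add' ψ χ := by ext n; simp [mul_add]
  map_smul' c ψ := by ext n; simp [mul_left_comm]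

/-- Product states with exactly `N` particles. -/
abbrev Conf (d N : ℕ) := {n : Occ d // n.degree = N}

/-- The `N`-particle Hilbert space `F^N`. -/
abbrev Fock (d N : ℕ) := lp (fun _ : Conf d N => ℂ) 2

/-- The inclusion of `F^N` into the Fock space. -/
def incl (d N : ℕ) : Fock d N →ₗ[ℂ] FinFock d where
  toFun ψ := ⟨fun n => if h : n.degree = N then ψ ⟨n, h⟩ else 0, by
    refine ⟨?_, N, fun n hn => dif_neg hn.ne'⟩
    have h1 := (memℓp_two_iff _).1 (lp.memℓp ψ)
    rw [memℓp_two_iff, ← (Subtype.val_injective (p := fun n : Occ d => n.degree = N)).summable_iff]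
    · refine h1.congr fun n => ?_
      simp [n.2]
    · intro n hn
      have : ¬ n.degree = N := fun h => hn ⟨⟨n, h⟩, rfl⟩
      simp [this]⟩
  map_add' ψ χ := by
    ext n
    by_cases h : n.degree = N <;> simp [h]
  map_smul' c ψ := by
    ext n
    by_cases h : n.degree = N <;> simp [h]

/-- The orthogonal projection of the Fock space onto `F^N`. -/
def proj (d N : ℕ) : FinFock d →ₗ[ℂ] Fock d N where
  toFun ψ := ⟨fun n => ψ.1 n.1, by
    change Memℓp _ 2
    have h1 := (memℓp_two_iff _).1 ψ.2.1
    rw [memℓp_two_iff]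
    exact h1.comp_injective Subtype.val_injective⟩
  map_add' _ _ := rfl
  map_smul' _ _ := rfl

/-- The restriction to `F^N` of an operator which conserves the number of particles. -/
def onFock {d : ℕ} (N : ℕ) (A : FinFock d →ₗ[ℂ] FinFock d) : Fock d N →ₗ[ℂ] Fock d N :=
  proj d N ∘ₗ A ∘ₗ incl d N

/-- The projection onto the span of the product states in `S`. -/
def maskOp {d N : ℕ} (S : Set (Conf d N)) : Fock d N →ₗ[ℂ] Fock d N where
  toFun ψ := ⟨S.indicator ψ, by
    change Memℓp _ 2
    have h1 := (memℓp_two_iff _).1 (lp.memℓp ψ)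
    rw [memℓp_two_iff]
    refine Summable.of_nonneg_of_le (fun n => by positivity) (fun n => ?_) h1
    gcongr
    exact norm_indicator_le_norm_self _ _⟩
  map_add' ψ χ := by
    ext n
    exact congrFun (Set.indicator_add S (ψ : Conf d N → ℂ) χ) n
  map_smul' c ψ := by
    ext n
    exact congrFun (Set.indicator_const_smul S c (ψ : Conf d N → ℂ)) n

/-! ### The Hamiltonian -/

/-- The kinetic energy `k_p²` of the mode `p`, where `k_p = (2π/L) p`. -/
def kSq {d : ℕ} (L : ℝ) (p : Mode d) : ℝ := ∑ i, (2 * Real.pi / L * (p i : ℝ)) ^ 2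

/-- `Δ₀`, the minimum of `k_p²` over `p ≠ 0`. -/
def gap0 (d : ℕ) (L : ℝ) : ℝ := ⨅ p : {p : Mode d // p ≠ 0}, kSq L p.1

/-- The kinetic energy `∑_p k_p² n_p` of a product state. -/
def kinEnergy {d : ℕ} (L : ℝ) (n : Occ d) : ℝ := n.sum fun p m => (m : ℝ) * kSq L p

/-- The domain in `F^N` of the kinetic energy `∑_p k_p² a*_p a_p`, which is also the domain of the
Bogoliubov Hamiltonian (the interaction is bounded on `F^N`). -/
def dom (d N : ℕ) (L : ℝ) : Submodule ℂ (Fock d N) where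
  carrier := {ψ | Memℓp (fun n : Conf d N => (kinEnergy L n.1 : ℂ) * ψ n) 2}
  add_mem' := by
    intro ψ χ h1 h2
    have := h1.add h2
    change Memℓp _ 2
    convert this using 2 with n
    simp [mul_add]
  zero_mem' := by
    change Memℓp _ 2
    convert zero_memℓp (E := fun _ : Conf d N => ℂ) (p := 2) using 2
    simp
  smul_mem' := by
    intro c ψ h1
    have := h1.const_smul c
    change Memℓp _ 2
    convert this using 2 with n
    simp [mul_left_comm]

/-- The projection onto the span of the product states in `S`, on the domain. -/
def maskDom {d N : ℕ} (L : ℝ) (S : Set (Conf d N)) : dom d N L →ₗ[ℂ] dom d N L :=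
  (maskOp S).restrict (p := dom d N L) (q := dom d N L) (by
    intro ψ hψ
    change Memℓp _ 2 at hψ
    change Memℓp _ 2
    rw [memℓp_two_iff] at hψ ⊢
    refine Summable.of_nonneg_of_le (fun n => by positivity) (fun n => ?_) hψ
    rw [norm_mul, norm_mul]
    gcongr
    exact norm_indicator_le_norm_self _ _)

/-- The kinetic energy operator `∑_p k_p² a*_p a_p`. -/
def kinetic (d N : ℕ) (L : ℝ) : dom d N L →ₗ[ℂ] Fock d N where
  toFun ψ := ⟨fun n => (kinEnergy L n.1 : ℂ) * ψ.1 n, ψ.2⟩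
  map_add' ψ χ := by
    ext n
    exact mul_add _ _ _
  map_smul' c ψ := by
    ext n
    exact mul_left_comm _ _ _

/-- `W_j = φ_j a*_0 a*_0 a_j a_{-j} / N`. -/
def W {d : ℕ} (N : ℕ) (φ : ℝ) (j : Mode d) : Fock d N →ₗ[ℂ] Fock d N :=
  ((φ / N : ℝ) : ℂ) • onFock N (create 0 ∘ₗ create 0 ∘ₗ annih j ∘ₗ annih (-j))

/-- `W*_j = φ_j a_0 a_0 a*_j a*_{-j} / N`. -/
def Wstar {d : ℕ} (N : ℕ) (φ : ℝ) (j : Mode d) : Fock d N →ₗ[ℂ] Fock d N :=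
  ((φ / N : ℝ) : ℂ) • onFock N (annih 0 ∘ₗ annih 0 ∘ₗ create j ∘ₗ create (-j))

/-- `φ_j (a*_0 a_0 / N) (a*_j a_j + a*_{-j} a_{-j})`. -/
def diagInt {d : ℕ} (N : ℕ) (φ : ℝ) (j : Mode d) : Fock d N →ₗ[ℂ] Fock d N :=
  ((φ / N : ℝ) : ℂ) • onFock N
    (create 0 ∘ₗ annih 0 ∘ₗ (create j ∘ₗ annih j + create (-j) ∘ₗ annih (-j)))

/-- The three-modes Bogoliubov Hamiltonian on `F^N`,
`H = ∑_{p ≠ ±j} k_p² a*_p a_p + (k_j² + φ_j a*_0 a_0 / N)(a*_j a_j + a*_{-j} a_{-j}) + W_j + W*_j`. -/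
def hBog {d : ℕ} (N : ℕ) (L φ : ℝ) (j : Mode d) : dom d N L →ₗ[ℂ] Fock d N :=
  kinetic d N L + (diagInt N φ j + W N φ j + Wstar N φ j) ∘ₗ (dom d N L).subtype

/-! ### Inverses, resolvent set and spectrum -/

/-- `R` is a bounded inverse of `Q A Q` on `Q F^N` (extended by `0` to the complement), where `Q` is
the projection onto the span of the product states in `S`. -/
structure IsInverseOn {d N : ℕ} {L : ℝ} (S : Set (Conf d N)) (A : dom d N L →ₗ[ℂ] Fock d N)
    (R : Fock d N →ₗ[ℂ] dom d N L) : Prop where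
  bounded : ∃ C : ℝ, ∀ y, ‖(R y : Fock d N)‖ ≤ C * ‖y‖
  range : ∀ y, maskDom L S (R y) = R y
  right : ∀ y, maskOp S (A (R y)) = maskOp S y
  left : ∀ x, maskDom L S x = x → R (maskOp S (A x)) = x

/-- `Q A Q` is bounded invertible on `Q F^N`. -/
def InvertibleOn {d N : ℕ} {L : ℝ} (S : Set (Conf d N)) (A : dom d N L →ₗ[ℂ] Fock d N) : Prop :=
  ∃ R, IsInverseOn S A R

open Classical in
/-- The operator `1 / (Q A Q)` on `Q F^N`; it is unique if it exists, and `0` is the value where it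
does not exist. -/
def invOn {d N : ℕ} {L : ℝ} (S : Set (Conf d N)) (A : dom d N L →ₗ[ℂ] Fock d N) :
    Fock d N →ₗ[ℂ] dom d N L :=
  if h : InvertibleOn S A then h.choose else 0

/-- The operator `A - w`. -/
def shiftBy {d N : ℕ} {L : ℝ} (A : dom d N L →ₗ[ℂ] Fock d N) (w : ℂ) :
    dom d N L →ₗ[ℂ] Fock d N :=
  A - w • (dom d N L).subtype

/-- The spectrum of an unbounded operator: all `w` for which `A - w` has no bounded inverse
(for `S = univ` the projection is the identity). -/
def spec {d N : ℕ} {L : ℝ} (A : dom d N L →ₗ[ℂ] Fock d N) : Set ℂ :=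
  {w | ¬ InvertibleOn Set.univ (shiftBy A w)}

/-! ### The Feshbach-Schur flow -/

/-- The number of particles in the modes `±j`. -/
def pairNum {d N : ℕ} (j : Mode d) (n : Conf d N) : ℕ := n.1 j + n.1 (-j)

/-- Product states with `N - i` or `N - i - 1` particles in the modes `±j`; they span the range of
`Q^{(i,i+1)}`. -/
def shell {d N : ℕ} (j : Mode d) (i : ℕ) : Set (Conf d N) :=
  {n | pairNum j n + i = N ∨ pairNum j n + i + 1 = N}

/-- Product states with fewer than `N - i - 1` particles in the modes `±j`; they span the range of
`Q^{(>i+1)}`. -/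
def below {d N : ℕ} (j : Mode d) (i : ℕ) : Set (Conf d N) :=
  {n | pairNum j n + i + 1 < N}

/-- The Feshbach-Schur map `P K P - P K P̄ (P̄ K P̄)⁻¹ P̄ K P` for the projections `P`, `P̄` onto the
spans of the product states in `S`, `T`. -/
def feshbach {d N : ℕ} {L : ℝ} (S T : Set (Conf d N)) (K : dom d N L →ₗ[ℂ] Fock d N) :
    dom d N L →ₗ[ℂ] Fock d N :=
  maskOp S ∘ₗ K ∘ₗ maskDom L S
    - maskOp S ∘ₗ K ∘ₗ maskDom L T ∘ₗ invOn T K ∘ₗ maskOp T ∘ₗ K ∘ₗ maskDom L S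

/-- The Feshbach-Schur Hamiltonians: `kBog z t` is `K^{(2t-2)}(z)`, so that `kBog z 0` is
`K^{(-2)}(z) = H - z` and `K^{(2t)}(z)` arises from `K^{(2t-2)}(z)` by the map for
`P = Q^{(>2t+1)}` and `P̄ = Q^{(2t,2t+1)}`. -/
def kBog {d : ℕ} (N : ℕ) (L φ : ℝ) (j : Mode d) (z : ℝ) : ℕ → (dom d N L →ₗ[ℂ] Fock d N)
  | 0 => shiftBy (hBog N L φ j) z
  | t + 1 => feshbach (below j (2 * t)) (shell j (2 * t)) (kBog N L φ j z t)

/-- `Q^{(2t,2t+1)} K^{(2t-2)}(z) Q^{(2t,2t+1)}` is bounded invertible on `Q^{(2t,2t+1)} F^N`, that is,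
the Feshbach-Schur map can be applied at the step `2t`. -/
def StepInvertible {d : ℕ} (N : ℕ) (L φ : ℝ) (j : Mode d) (z : ℝ) (t : ℕ) : Prop :=
  InvertibleOn (shell j (2 * t)) (kBog N L φ j z t)

/-- `1 / (Q^{(2t,2t+1)} K^{(2t-2)}(z) Q^{(2t,2t+1)})`. -/
def stepInv {d : ℕ} (N : ℕ) (L φ : ℝ) (j : Mode d) (z : ℝ) (t : ℕ) : Fock d N →ₗ[ℂ] dom d N L :=
  invOn (shell j (2 * t)) (kBog N L φ j z t)

theorem kinEnergy_single_zero {d : ℕ} (L : ℝ) (N : ℕ) :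
    kinEnergy L (Finsupp.single (0 : Mode d) N) = 0 := by
  simp [kinEnergy, kSq]

/-- The product state `η` with all `N` particles in the zero mode. -/
def eta (d N : ℕ) (L : ℝ) : dom d N L :=
  ⟨lp.single 2 (⟨Finsupp.single 0 N, by simp⟩ : Conf d N) (1 : ℂ), by
    change Memℓp _ 2
    convert zero_memℓp (E := fun _ : Conf d N => ℂ) (p := 2) using 2 with n
    by_cases h : n = ⟨Finsupp.single 0 N, by simp⟩
    · subst h
      simp [kinEnergy_single_zero]
    · simp [lp.single_apply, h]⟩

/-- The function
`f(z) = -z - ⟨η, W_j (Q^{(N-2,N-1)} K^{(N-4)}(z) Q^{(N-2,N-1)})⁻¹ W*_j η⟩`. -/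
def fixFun {d : ℕ} (N : ℕ) (L φ : ℝ) (j : Mode d) (z : ℝ) : ℂ :=
  -(z : ℂ) - inner ℂ (eta d N L : Fock d N)
    (W N φ j (stepInv N L φ j z (N / 2 - 1) (Wstar N φ j (eta d N L : Fock d N))))

/-- The terms of the expansion of the ground state vector. With
`R_r = 1 / (Q^{(N-2r,N-2r+1)} K^{(N-2r-2)}(z) Q^{(N-2r,N-2r+1)})` and
`W*_{i,i'} = Q^{(i,i+1)} W*_j Q^{(i',i'+1)}`, the term with index `0` is
`R_1 Q^{(N-2,N-1)} W*_j η` and the term with index `m` is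
`[-R_{m+1} W*_{N-2m-2,N-2m}] ⋯ [-R_2 W*_{N-4,N-2}] R_1 Q^{(N-2,N-1)} W*_j η`. -/
def gsTerm {d : ℕ} (N : ℕ) (L φ : ℝ) (j : Mode d) (z : ℝ) : ℕ → dom d N L
  | 0 => stepInv N L φ j z (N / 2 - 1)
      (maskOp (shell j (N - 2)) (Wstar N φ j (eta d N L : Fock d N)))
  | m + 1 => -stepInv N L φ j z (N / 2 - (m + 2))
      (maskOp (shell j (N - 2 * (m + 2))) (Wstar N φ j
        (maskOp (shell j (N - 2 * (m + 2) + 2)) (gsTerm N L φ j z m : Fock d N))))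

/-- The vector `ψ = η - R_1 Q^{(N-2,N-1)} W*_j η
- ∑_{l=2}^{N/2} {∏_{r=l}^{2} [-R_r W*_{N-2r,N-2r+2}]} R_1 Q^{(N-2,N-1)} W*_j η`. -/
def gsVector {d : ℕ} (N : ℕ) (L φ : ℝ) (j : Mode d) (z : ℝ) : dom d N L :=
  eta d N L - gsTerm N L φ j z 0 - ∑ l ∈ Finset.Icc 2 (N / 2), gsTerm N L φ j z (l - 1)

/-! ### Parameters and conditions -/

/-- `ε_j = k_j² / φ_j`. -/
def eps {d : ℕ} (L φ : ℝ) (j : Mode d) : ℝ := kSq L j / φ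

/-- `E^Bog_j = -[k_j² + φ_j - √((k_j²)² + 2 φ_j k_j²)]`. -/
def eBog {d : ℕ} (L φ : ℝ) (j : Mode d) : ℝ :=
  -(kSq L j + φ - √(kSq L j ^ 2 + 2 * φ * kSq L j))

/-- The width `√ε_j φ_j √(ε_j² + 2 ε_j)`. -/
def width {d : ℕ} (L φ : ℝ) (j : Mode d) : ℝ :=
  √(eps L φ j) * φ * √(eps L φ j ^ 2 + 2 * eps L φ j)

/-- The condition `ε² + ε / N^γ + 1 / N ≤ k ε √ε` and `1 / N^{1-γ} ≤ k ε`. -/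
def GammaCond (k γ : ℝ) (N : ℕ) (ε : ℝ) : Prop :=
  ε ^ 2 + ε / (N : ℝ) ^ γ + 1 / (N : ℝ) ≤ k * ε * √ε ∧ 1 / (N : ℝ) ^ (1 - γ) ≤ k * ε

/-- The condition `(φ/Δ₀) N^μ / (N (N - N^μ)) < 1/2` and `1 / N^μ ≤ C (√ε)^{1+θ}`. -/
def MuCond {d : ℕ} (μ θ C : ℝ) (N : ℕ) (L φ : ℝ) (j : Mode d) : Prop :=
  φ / gap0 d L * ((N : ℝ) ^ μ / ((N : ℝ) * ((N : ℝ) - (N : ℝ) ^ μ))) < 1 / 2 ∧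
    1 / (N : ℝ) ^ μ ≤ C * √(eps L φ j) ^ (1 + θ)

/-! ### The properties of the ground state -/

/-- `z` is the unique zero of `f` in `(-∞, E^Bog_j + √ε_j φ_j √(ε_j² + 2 ε_j)]`, the Feshbach-Schur
flow being well defined there up to the step `N - 2`. -/
structure IsFixedPoint {d : ℕ} (N : ℕ) (L φ : ℝ) (j : Mode d) (z : ℝ) : Prop where
  flow : ∀ w ≤ eBog L φ j + width L φ j, ∀ t < N / 2, StepInvertible N L φ j w t
  le : z ≤ eBog L φ j + width L φ j
  zero : fixFun N L φ j z = 0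
  unique : ∀ w ≤ eBog L φ j + width L φ j, fixFun N L φ j w = 0 → w = z

/-- `z` is the nondegenerate ground state energy of `H`, with eigenvector `gsVector`. -/
structure IsGroundState {d : ℕ} (N : ℕ) (L φ : ℝ) (j : Mode d) (z : ℝ) : Prop where
  bottom : ∀ w ∈ spec (hBog N L φ j), w.im = 0 ∧ z ≤ w.re
  ne_zero : gsVector N L φ j z ≠ 0
  eigen : hBog N L φ j (gsVector N L φ j z) = (z : ℂ) • (gsVector N L φ j z : Fock d N)
  nondegenerate : ∀ x : dom d N L, hBog N L φ j x = (z : ℂ) • (x : Fock d N) →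
    ∃ c : ℂ, x = c • gsVector N L φ j z

/-- The spectral gap above `z` is at least `g`: the spectrum except `z` lies in `[z + g, ∞)`. -/
def GapAbove {d : ℕ} (N : ℕ) (L φ : ℝ) (j : Mode d) (z g : ℝ) : Prop :=
  ∀ w ∈ spec (hBog N L φ j), w ≠ (z : ℂ) → w.im = 0 ∧ z + g ≤ w.re

/-- `min {Δ₀ / 2, ((3 - 2√2) / 6) √ε_j φ_j √(ε_j² + 2 ε_j)}`. -/
def gapBound {d : ℕ} (L φ : ℝ) (j : Mode d) : ℝ :=
  min (gap0 d L / 2) ((-2 * √2 + 3) / 6 * width L φ j)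

end ThreeMode

end

open ThreeMode

noncomputable section

namespace ThreeMode

/-! In the product-state basis the Hamiltonian only exchanges two zero-mode particles for a pair in
the modes ±j. It preserves the occupation of all other modes and the difference of the occupations
of j and -j, so F^N splits into finite chains, and on each of them H is a Jacobi matrix
(`hBog_apply`). One step of the Feshbach-Schur flow is Gaussian elimination of the states with the
most pairs, on all chains at once. What remains is the same Jacobi matrix cut off at the top, except
that its last diagonal entry has become a continued fraction (`isTruncated`, `flowDiag_eq`).
Existence of the inverses thus means a positive lower bound on continued fractions, and f is the
continued fraction at η (`fixFun_eq`).

The lower bounds come from supersolutions. If positive ratios x satisfy B_up x_next + B_down / x ≤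
diagonal - z along a chain, with B_up, B_down upper bounds on the bonds, then induction from the top
gives G ≥ B_down / x for the continued fraction G. Put e = √(ε² + 2ε) and c = 1 + ε - e, so that 1/c
= 1 + ε + e. The constant ratio c is a supersolution at E^Bog (`chainFrac_eBog_ge`). The ratio c(1 +
2e/p), with p particles in the modes ±j, works up to E^Bog + φe√ε, the top of the energy window
(`chainFrac_ge`). In the other direction, testing with ratio c shows f ≤ 0 at E^Bog + 5φ/(eN)
(`chainFrac_le`). Continuity and strict monotonicity give exactly one zero z. Back substitution then
gives the eigenvector (`hBog_gsVector`), whose coefficients are bounded by products of the ratios, a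
summable sequence depending on ε only.

For the gap, a weight u with u(n) + b(n)²/u(up n) ≤ diagonal - r yields H ≥ r by completing squares
(`le_inner_hBog`). On most chains u is the continued fraction at the top of the window. On chains
with equal occupation of ±j and other modes occupied, u is the continued fraction of the chain of η
at energy z, rescaled: giving the pairs fewer particles does not lower the energy
(`supersolution_of_lt`), and the other modes add at least Δ₀. This gives H ≥ z + Δ₀/2 on vectors
without η component, a subspace of codimension one. Together with the eigenvector at z, it leaves
only z in the spectrum below z + Δ₀/2 (`spec_subset`).

The construction runs for small ε and 1/N ≤ ε√ε/10 (`exists_groundState`). Since √ε ≥ b/L with b =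
2π/√φ, the second condition holds once N/L³ is large: in the mean field limit, at large density for
d ≥ 3, and in large boxes at any density for d ≥ 4. -/

/-! ### The continued fraction of a chain -/

/-- The diagonal entry, relative to the energy `z`, which the Feshbach-Schur flow produces at a
product state with `n₀` particles in the zero mode, `a` and `b` particles in the modes `±j` and
kinetic energy `T` in all other modes. -/
def chainFrac (N φ κ T z : ℝ) : ℕ → ℕ → ℕ → ℝ
  | 0, a, b => T + ((a : ℝ) + b) * κ - z
  | 1, a, b => T + ((a : ℝ) + b) * (κ + φ / N) - z
  | n + 2, a, b => T + ((a : ℝ) + b) * (κ + φ / N * ((n : ℝ) + 2)) - z -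
      (φ / N) ^ 2 * (((n : ℝ) + 2) * ((n : ℝ) + 1)) * (((a : ℝ) + 1) * ((b : ℝ) + 1)) /
        chainFrac N φ κ T z n (a + 1) (b + 1)

/-! ### Constants at small coupling and the supersolution inequalities. -/

/-- The relations between `ε`, `e = √(ε² + 2ε)` and `s = √ε` in the regime of small `ε`. -/
structure SmallCoupling (ε e s : ℝ) : Prop where
  e_pos : 0 < e
  s_pos : 0 < s
  e_sq : e ^ 2 = ε ^ 2 + 2 * ε
  s_sq : s ^ 2 = ε
  e_le : e ≤ 1 / 20

namespace SmallCoupling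

variable {ε e s : ℝ}

theorem eps_pos (h : SmallCoupling ε e s) : 0 < ε := by
  have := h.s_pos; rw [← h.s_sq]; positivity

theorem eps_le (h : SmallCoupling ε e s) : ε ≤ 1 / 800 := by
  nlinarith [h.e_sq, h.e_le, h.e_pos, h.eps_pos]

theorem s_le (h : SmallCoupling ε e s) : s ≤ 3 / 4 * e := by
  have := h.e_pos
  refine abs_le_of_sq_le_sq' ?_ (by positivity) |>.2
  nlinarith [h.e_sq, h.s_sq, h.eps_pos]

theorem c_ge (h : SmallCoupling ε e s) : 19 / 20 ≤ 1 + ε - e := by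
  linarith [h.e_le, h.eps_pos]

theorem c_le (h : SmallCoupling ε e s) : 1 + ε - e ≤ 1 := by
  nlinarith [h.e_sq, h.eps_pos, h.e_pos, h.e_le]

/-- The factors are the roots of x² - 2(1 + ε)x + 1, the decaying and the growing ratio of the chain
recursion with constant coefficients. -/
theorem c_mul (h : SmallCoupling ε e s) : (1 + ε - e) * (1 + ε + e) = 1 := by
  linear_combination -h.e_sq

theorem es_le (h : SmallCoupling ε e s) : e * s ≤ 3 / 1600 := by
  nlinarith [h.s_le, h.e_le, h.e_pos, h.s_pos]

end SmallCoupling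

/-- The ratio bound `(1 + ε - e)(1 + 2 e / p)` for consecutive coefficients of the ground state. -/
def ratioBound (ε e : ℝ) (p : ℝ) : ℝ := (1 + ε - e) * (1 + 2 * e / p)

theorem ratioBound_pos {ε e s : ℝ} (h : SmallCoupling ε e s) {p : ℝ} (hp : 0 < p) :
    0 < ratioBound ε e p := by
  have := h.c_ge
  have := h.e_pos
  have : 0 < 1 + ε - e := by linarith
  unfold ratioBound
  positivity

/-- The term of the supersolution inequality which couples to the state with one pair more. -/
theorem mul_ratioBound_add_two (ε e x p : ℝ) (hp : 0 ≤ p) :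
    x * ((p + 2) / 2) * ratioBound ε e (p + 2) = x * ((1 + ε - e) * (p / 2 + 1 + e)) := by
  unfold ratioBound
  have : p + 2 ≠ 0 := by positivity
  field_simp

/-- The term of the supersolution inequality which couples to the state with one pair less. -/
theorem div_ratioBound_le {ε e s : ℝ} (h : SmallCoupling ε e s) {x p : ℝ} (hx : 0 ≤ x)
    (hp : 2 ≤ p) : x * (p / 2) / ratioBound ε e p ≤ x * ((1 + ε + e) * (p / 2 - e / (1 + e))) := by
  have hr := ratioBound_pos h (show 0 < p by linarith)
  have he := h.e_pos
  have hc := h.c_ge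
  have hcc := h.c_mul
  rw [div_le_iff₀ hr, mul_assoc, mul_assoc]
  refine mul_le_mul_of_nonneg_left ?_ hx
  -- The shift e/(1+e) gives equality at p = 2; the remainder carries the factor p - 2, which is why
  -- p ≥ 2 is needed.
  have : (p / 2 - e / (1 + e)) * (1 + 2 * e / p) ≥ p / 2 := by
    have h1 : (p / 2 - e / (1 + e)) * (1 + 2 * e / p) - p / 2 =
      e ^ 2 * (p - 2) / (p * (1 + e)) := by
      have : p ≠ 0 := by positivity
      field_simp
      ring
    have : 0 ≤ e ^ 2 * (p - 2) / (p * (1 + e)) := by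
      have : 0 ≤ p - 2 := by linarith
      positivity
    linarith
  unfold ratioBound
  calc p / 2 ≤ (p / 2 - e / (1 + e)) * (1 + 2 * e / p) := this
    _ = ((1 + ε - e) * (1 + ε + e)) * ((p / 2 - e / (1 + e)) * (1 + 2 * e / p)) := by
      rw [hcc, one_mul]
    _ = _ := by ring

/-- The supersolution inequality at a state with `n₀` particles in the zero mode and `p ≥ 2`
particles in the modes `±j`. -/
theorem supersolution {ε e s : ℝ} (h : SmallCoupling ε e s) {n₀ p N : ℝ} (hn : 0 ≤ n₀)
    (hp : 2 ≤ p) (hN : n₀ + p ≤ N) :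
    max 0 (n₀ - 1 / 2) * ((p + 2) / 2) * ratioBound ε e (p + 2) +
      (n₀ + 3 / 2) * (p / 2) / ratioBound ε e p ≤
    p * (N * ε + n₀) + N * ((1 + ε - e) - e * s) := by
  -- The right side is N/φ times (diagonal - z) at the top of the window. The numbers n₀ - 1/2 and
  -- n₀ + 3/2 bound √(n₀(n₀-1)) and √((n₀+2)(n₀+1)); the maximum covers n₀ = 0.
  rw [mul_ratioBound_add_two _ _ _ _ (by linarith)]
  have h2 := div_ratioBound_le h (x := n₀ + 3 / 2) (by linarith) hp
  have he := h.e_pos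
  have hc := h.c_ge
  have hcc := h.c_mul
  have hes := h.es_le
  have hel := h.e_le
  have hε := h.eps_pos
  have hεl := h.eps_le
  have hsl := h.s_le
  have hq : 0 < e / (1 + e) := by positivity
  have hq1 : e / (1 + e) * (1 + e) = e := by field_simp
  have hq2 : e / (1 + e) ≤ e := div_le_self he.le (by linarith)
  set q := e / (1 + e) with hqdef
  clear_value q
  have hεN : 0 ≤ p * ε * (N - n₀) := by
    have : 0 ≤ N - n₀ := by linarith
    positivity
  rcases le_total (n₀ - 1 / 2) 0 with hm | hm
  · rw [max_eq_left hm]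
    have h3 : (n₀ + 3 / 2) * ((1 + ε + e) * (p / 2 - q)) ≤
        (n₀ + 3 / 2) * ((11 / 10) * (p / 2)) := by
      gcongr
      · linarith
      · linarith
      · linarith
    have h4 : N * (9 / 10) ≤ N * ((1 + ε - e) - e * s) := by
      have : 0 ≤ N := by linarith
      gcongr
      linarith
    have h5 : 0 ≤ p * n₀ := by positivity
    have h6 : 0 ≤ p * (N * ε) := by
      have : 0 ≤ N := by linarith
      positivity
    linarith
  · rw [max_eq_right hm]
    -- Here the factor 1 + 2e/p pays for the width: the terms proportional to n₀ leave the surplus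
    -- e² - eε + εq, which exceeds es because s ≤ 3e/4.
    have hτ : (1 + ε + e) * q - e * (1 + ε - e) ≥ e * s := by
      have : (1 + ε + e) * q = e + ε * q := by linear_combination hq1
      rw [this]
      nlinarith [mul_pos hε hq]
    -- The terms coming from -1/2 and 3/2 are of order p, and are absorbed by the coefficient of N -
    -- n₀ ≥ p.
    have h3 : (1 + ε - e) * (p / 2 + 1 + e) * (-(1 / 2)) + 3 / 2 * ((1 + ε + e) * (p / 2 - q)) ≤
        p * (9 / 10) := by
      nlinarith [mul_pos hε hq, mul_pos he hq]
    have h5 : p * (9 / 10) ≤ (N - n₀) * ((1 + ε - e) - e * s) := by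
      have h6 : p ≤ N - n₀ := by linarith
      have h7 : 9 / 10 ≤ (1 + ε - e) - e * s := by linarith
      nlinarith
    have h8 : n₀ * (e * s) ≤ n₀ * ((1 + ε + e) * q - e * (1 + ε - e)) :=
      mul_le_mul_of_nonneg_left hτ hn
    nlinarith

/-- The supersolution inequality at a state with one particle in the modes `±j`. -/
theorem supersolution_one {ε e s : ℝ} (h : SmallCoupling ε e s) {n₀ N : ℝ} (hn : 0 ≤ n₀)
    (hN : n₀ + 1 ≤ N) :
    max 0 (n₀ - 1 / 2) * ((1 + 2) / 2) * ratioBound ε e (1 + 2) + N / 4 ≤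
    1 * (N * ε + n₀) + N * ((1 + ε - e) - e * s) := by
  -- A single particle in ±j has no pair to give back, so there is no downward term and N/4 is left
  -- over.
  rw [mul_ratioBound_add_two _ _ _ _ (by norm_num)]
  have he := h.e_pos
  have hc := h.c_ge
  have hes := h.es_le
  have hel := h.e_le
  have hε := h.eps_pos
  have hεl := h.eps_le
  have h1 : max 0 (n₀ - 1 / 2) * ((1 + ε - e) * (1 / 2 + 1 + e)) ≤ n₀ * (155 / 100) := by
    have h2 : max 0 (n₀ - 1 / 2) ≤ n₀ := max_le hn (by linarith)
    have h3 : (1 + ε - e) * (1 / 2 + 1 + e) ≤ 155 / 100 := by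
      have := h.c_le
      nlinarith
    exact mul_le_mul h2 h3 (by have : 0 < 1 + ε - e := by linarith
                               positivity) hn
  have h4 : N * (9 / 10) ≤ N * ((1 + ε - e) - e * s) := by
    have : 0 ≤ N := by linarith
    gcongr
    linarith
  nlinarith

/-- One step of the comparison with a supersolution: a lower bound `B / x` on the tail caps the
eliminated term at `B * x`. -/
theorem div_le_of_sq_le {b₂ B x G : ℝ} (hB : 0 < B) (hx : 0 < x) (hb : b₂ ≤ B ^ 2)
    (hG : B / x ≤ G) : b₂ / G ≤ B * x := by
  have h0 : 0 < B / x := by positivity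
  rw [div_le_iff₀ (h0.trans_le hG)]
  calc b₂ ≤ B ^ 2 := hb
    _ = B * x * (B / x) := by field_simp
    _ ≤ B * x * G := by gcongr

/-- Arithmetic-geometric mean in both pairs of factors. The bound sees a and b only through their
sum, so unbalanced chains need no separate treatment. -/
theorem pair_weight_le (u : ℝ) (n a b : ℕ) :
    u ^ 2 * (((n : ℝ) + 2) * ((n : ℝ) + 1)) * (((a : ℝ) + 1) * ((b : ℝ) + 1)) ≤
      (u * (((n : ℝ) + 3 / 2) * (((a : ℝ) + b + 2) / 2))) ^ 2 := by
  have h1 : ((n : ℝ) + 2) * ((n : ℝ) + 1) ≤ ((n : ℝ) + 3 / 2) ^ 2 := by nlinarith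
  have h2 : ((a : ℝ) + 1) * ((b : ℝ) + 1) ≤ (((a : ℝ) + b + 2) / 2) ^ 2 := by
    nlinarith [sq_nonneg ((a : ℝ) - b)]
  rw [mul_pow, mul_pow, mul_assoc]
  gcongr

/-! ### Bounds, monotonicity and continuity of the continued fraction in the energy window. -/

section Bounds

variable {ε e s N φ κ T z : ℝ}

/-- The lower bound on the continued fraction at states with at least two particles in the modes
`±j`, for all energies up to `E^Bog` plus the width. -/
theorem chainFrac_ge (h : SmallCoupling ε e s) (hN : 0 < N) (hφ : 0 < φ) (hκ : κ = φ * ε)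
    (hT : 0 ≤ T) (hz : z ≤ -(φ * (1 + ε - e)) + φ * (e * s)) : ∀ n a b : ℕ, 2 ≤ a + b →
    ((n : ℝ) + a + b ≤ N) →
    T + φ / N * (((n : ℝ) + 3 / 2) * (((a : ℝ) + b) / 2) / ratioBound ε e (a + b)) ≤
      chainFrac N φ κ T z n a b := by
  have key : ∀ n a b : ℕ, 2 ≤ a + b → ((n : ℝ) + a + b ≤ N) →
      φ / N * (max 0 ((n : ℝ) - 1 / 2) * (((a : ℝ) + b + 2) / 2) * ratioBound ε e (a + b + 2)) +
        φ / N * (((n : ℝ) + 3 / 2) * (((a : ℝ) + b) / 2) / ratioBound ε e (a + b)) ≤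
      ((a : ℝ) + b) * (κ + φ / N * n) - z := by
    intro n a b hab hn
    have hp : (2 : ℝ) ≤ (a : ℝ) + b := by exact_mod_cast hab
    have := supersolution h (n₀ := n) (p := (a : ℝ) + b) (N := N) (by positivity) hp (by linarith)
    have h2 := mul_le_mul_of_nonneg_left this (show 0 ≤ φ / N by positivity)
    rw [mul_add] at h2
    refine h2.trans ?_
    have h3 : φ / N * (((a : ℝ) + b) * (N * ε + n) + N * (1 + ε - e - e * s)) =
        ((a : ℝ) + b) * (κ + φ / N * n) + φ * (1 + ε - e - e * s) := by
      rw [hκ]; field_simp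
    rw [h3]
    linarith
  have hpos : ∀ n a b : ℕ, 0 ≤ φ / N * (max 0 ((n : ℝ) - 1 / 2) * (((a : ℝ) + b + 2) / 2) *
      ratioBound ε e (a + b + 2)) := fun n a b => by
    have := ratioBound_pos h (p := (a : ℝ) + b + 2) (by positivity)
    positivity
  intro n
  induction n using Nat.twoStepInduction with
  | zero =>
    intro a b hab hn
    -- At n = 0 and n = 1 no bond leads upward, and the nonnegative upward term of `key` is
    -- discarded.
    have h1 := key 0 a b hab hn
    have h2 := hpos 0 a b
    simp only [chainFrac]
    simp only [Nat.cast_zero, mul_zero, add_zero] at h1 h2 ⊢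
    linarith
  | one =>
    intro a b hab hn
    have h1 := key 1 a b hab hn
    have h2 := hpos 1 a b
    simp only [chainFrac]
    simp only [Nat.cast_one, mul_one] at h1 h2 ⊢
    linarith
  | more n ih _ =>
    intro a b hab hn
    have h1 := key (n + 2) a b hab hn
    have h3 := ih (a + 1) (b + 1) (by omega) (by push_cast at hn ⊢; linarith)
    have hx := ratioBound_pos h (p := (a : ℝ) + b + 2) (by positivity)
    have e1 : ((a + 1 : ℕ) : ℝ) + ((b + 1 : ℕ) : ℝ) = (a : ℝ) + b + 2 := by push_cast; ring
    have h4 := div_le_of_sq_le (B := φ / N * (((n : ℝ) + 3 / 2) * (((a : ℝ) + b + 2) / 2)))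
      (by positivity) hx (pair_weight_le (φ / N) n a b)
      (G := chainFrac N φ κ T z n (a + 1) (b + 1))
      (by rw [e1] at h3; rw [mul_div_assoc]; linarith)
    simp only [chainFrac]
    -- The upward bound at `n + 2` equals the downward bound at `n`: both belong to the same bond.
    have e2 : max 0 (((n + 2 : ℕ) : ℝ) - 1 / 2) = (n : ℝ) + 3 / 2 := by
      rw [max_eq_right] <;> push_cast <;> linarith [(Nat.cast_nonneg n : (0 : ℝ) ≤ n)]
    rw [e2] at h1
    push_cast at h1 ⊢
    linarith

/-- The lower bound on the continued fraction at states with one particle in the modes `±j`. -/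
theorem chainFrac_ge_of_add_eq_one (h : SmallCoupling ε e s) (hN : 0 < N) (hφ : 0 < φ)
    (hκ : κ = φ * ε) (hT : 0 ≤ T) (hz : z ≤ -(φ * (1 + ε - e)) + φ * (e * s)) (n a b : ℕ)
    (hab : a + b = 1) (hn : (n : ℝ) + a + b ≤ N) :
    T + φ / 4 ≤ chainFrac N φ κ T z n a b := by
  have hp : (a : ℝ) + b = 1 := by exact_mod_cast hab
  have key : φ / N * (max 0 ((n : ℝ) - 1 / 2) * (((a : ℝ) + b + 2) / 2) *
      ratioBound ε e (a + b + 2)) + φ / 4 ≤ ((a : ℝ) + b) * (κ + φ / N * n) - z := by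
    have := supersolution_one h (n₀ := n) (N := N) (by positivity) (by linarith)
    have h2 := mul_le_mul_of_nonneg_left this (show 0 ≤ φ / N by positivity)
    rw [hp]
    have h3 : φ / N * (1 * (N * ε + n) + N * (1 + ε - e - e * s)) =
        1 * (κ + φ / N * n) + φ * (1 + ε - e - e * s) := by
      rw [hκ]; field_simp
    have h4 : φ / N * (N / 4) = φ / 4 := by field_simp
    rw [h3, mul_add, h4] at h2
    linarith
  have hx := ratioBound_pos h (p := (a : ℝ) + b + 2) (by positivity)
  have hpos : 0 ≤ φ / N * (max 0 ((n : ℝ) - 1 / 2) * (((a : ℝ) + b + 2) / 2) *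
      ratioBound ε e (a + b + 2)) := by positivity
  match n, hn, key, hpos with
  | 0, hn, h1, h2 =>
    simp only [chainFrac]
    simp only [Nat.cast_zero, mul_zero, add_zero] at h1 h2 ⊢
    linarith
  | 1, hn, h1, h2 =>
    simp only [chainFrac]
    simp only [Nat.cast_one, mul_one] at h1 h2 ⊢
    linarith
  | n + 2, hn, h1, h2 =>
    have h3 := chainFrac_ge h hN hφ hκ hT hz n (a + 1) (b + 1) (by omega)
      (by push_cast at hn ⊢; linarith)
    have e1 : ((a + 1 : ℕ) : ℝ) + ((b + 1 : ℕ) : ℝ) = (a : ℝ) + b + 2 := by push_cast; ring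
    have h4 := div_le_of_sq_le (B := φ / N * (((n : ℝ) + 3 / 2) * (((a : ℝ) + b + 2) / 2)))
      (by positivity) hx (pair_weight_le (φ / N) n a b)
      (G := chainFrac N φ κ T z n (a + 1) (b + 1))
      (by rw [e1] at h3; rw [mul_div_assoc]; linarith)
    simp only [chainFrac]
    have e2 : max 0 (((n + 2 : ℕ) : ℝ) - 1 / 2) = (n : ℝ) + 3 / 2 := by
      rw [max_eq_right] <;> push_cast <;> linarith [(Nat.cast_nonneg n : (0 : ℝ) ≤ n)]
    rw [e2] at h1
    push_cast at h1 ⊢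
    linarith

/-- On states with particles in the modes `±j` the continued fraction controls the kinetic energy,
uniformly in the occupation of the other modes. -/
theorem chainFrac_ge_const (h : SmallCoupling ε e s) (hN : 0 < N) (hφ : 0 < φ) (hκ : κ = φ * ε)
    (hT : 0 ≤ T) (hz : z ≤ -(φ * (1 + ε - e)) + φ * (e * s)) (n a b : ℕ) (hab : 1 ≤ a + b)
    (hn : (n : ℝ) + a + b ≤ N) : T + φ / (4 * N) ≤ chainFrac N φ κ T z n a b := by
  rcases (by omega : a + b = 1 ∨ 2 ≤ a + b) with h1 | h1
  · have hp : (a : ℝ) + b = 1 := by exact_mod_cast h1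
    have hN1 : 1 ≤ N := by linarith [(Nat.cast_nonneg n : (0 : ℝ) ≤ n)]
    have := chainFrac_ge_of_add_eq_one h hN hφ hκ hT hz n a b h1 hn
    have h2 : φ / (4 * N) ≤ φ / 4 := by
      apply div_le_div_of_nonneg_left hφ.le (by norm_num) (by linarith)
    linarith
  · have hp : (2 : ℝ) ≤ (a : ℝ) + b := by exact_mod_cast h1
    have := chainFrac_ge h hN hφ hκ hT hz n a b h1 hn
    have hx := ratioBound_pos h (p := (a : ℝ) + b) (by linarith)
    have hx2 : ratioBound ε e (a + b) ≤ 2 := by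
      unfold ratioBound
      have h3 : 2 * e / ((a : ℝ) + b) ≤ e := by
        rw [div_le_iff₀ (by linarith)]
        nlinarith [h.e_pos]
      have := h.c_le
      have := h.c_ge
      have := h.e_le
      have := h.e_pos
      have h5 : 0 ≤ 2 * e / ((a : ℝ) + b) := by positivity
      nlinarith
    -- The factor is at least (3/2)·1/2, so 1/4 is enough; the case of one particle in ±j yields the
    -- same constant.
    have h4 : φ / (4 * N) ≤
        φ / N * (((n : ℝ) + 3 / 2) * (((a : ℝ) + b) / 2) / ratioBound ε e (a + b)) := by
      have : φ / (4 * N) = φ / N * (1 / 4) := by field_simp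
      rw [this]
      refine mul_le_mul_of_nonneg_left ?_ (by positivity)
      rw [le_div_iff₀ hx]
      nlinarith [(Nat.cast_nonneg n : (0 : ℝ) ≤ n)]
    linarith

theorem chainFrac_pos (h : SmallCoupling ε e s) (hN : 0 < N) (hφ : 0 < φ) (hκ : κ = φ * ε)
    (hT : 0 ≤ T) (hz : z ≤ -(φ * (1 + ε - e)) + φ * (e * s)) (n a b : ℕ) (hab : 1 ≤ a + b)
    (hn : (n : ℝ) + a + b ≤ N) : 0 < chainFrac N φ κ T z n a b := by
  have := chainFrac_ge_const h hN hφ hκ hT hz n a b hab hn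
  have : 0 < φ / (4 * N) := by positivity
  linarith

/-- The continued fraction is strictly decreasing in the energy. -/
theorem chainFrac_strictAnti (h : SmallCoupling ε e s) (hN : 0 < N) (hφ : 0 < φ) (hκ : κ = φ * ε)
    (hT : 0 ≤ T) {z₁ z₂ : ℝ} (hlt : z₁ < z₂) (hz : z₂ ≤ -(φ * (1 + ε - e)) + φ * (e * s)) :
    ∀ n a b : ℕ, (n : ℝ) + a + b ≤ N →
      chainFrac N φ κ T z₂ n a b < chainFrac N φ κ T z₁ n a b := by
  intro n
  induction n using Nat.twoStepInduction with
  | zero => intro a b _; simp only [chainFrac]; linarith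
  | one => intro a b _; simp only [chainFrac]; linarith
  | more n ih _ =>
    intro a b hn
    have hn' : (n : ℝ) + ((a + 1 : ℕ) : ℝ) + ((b + 1 : ℕ) : ℝ) ≤ N := by
      push_cast at hn ⊢; linarith
    have h1 := ih (a + 1) (b + 1) hn'
    have h2 := chainFrac_pos h hN hφ hκ hT hz n (a + 1) (b + 1) (by omega) hn'
    simp only [chainFrac]
    -- Raising the energy lowers the tail, which stays positive, so the subtracted quotient grows:
    -- this adds to the decrease of `-z`.
    have h3 : (φ / N) ^ 2 * (((n : ℝ) + 2) * ((n : ℝ) + 1)) * (((a : ℝ) + 1) * ((b : ℝ) + 1)) /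
          chainFrac N φ κ T z₁ n (a + 1) (b + 1) ≤
        (φ / N) ^ 2 * (((n : ℝ) + 2) * ((n : ℝ) + 1)) * (((a : ℝ) + 1) * ((b : ℝ) + 1)) /
          chainFrac N φ κ T z₂ n (a + 1) (b + 1) := by
      gcongr
    linarith

theorem chainFrac_continuousOn (h : SmallCoupling ε e s) (hN : 0 < N) (hφ : 0 < φ)
    (hκ : κ = φ * ε) (hT : 0 ≤ T) : ∀ n a b : ℕ, (n : ℝ) + a + b ≤ N →
      ContinuousOn (fun z => chainFrac N φ κ T z n a b)
        (Set.Iic (-(φ * (1 + ε - e)) + φ * (e * s))) := by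
  intro n
  induction n using Nat.twoStepInduction with
  | zero => intro a b _; simp only [chainFrac]; fun_prop
  | one => intro a b _; simp only [chainFrac]; fun_prop
  | more n ih _ =>
    intro a b hn
    have hn' : (n : ℝ) + ((a + 1 : ℕ) : ℝ) + ((b + 1 : ℕ) : ℝ) ≤ N := by
      push_cast at hn ⊢; linarith
    simp only [chainFrac]
    refine ContinuousOn.sub (by fun_prop) (ContinuousOn.div continuousOn_const
      (ih (a + 1) (b + 1) hn') fun z hz => ?_)
    exact (chainFrac_pos h hN hφ hκ hT hz n (a + 1) (b + 1) (by omega) hn').ne'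

/-- At `z = E^Bog` the constant ratio `1 + ε - e` gives a supersolution of the chain of `η`. -/
theorem chainFrac_eBog_ge (h : SmallCoupling ε e s) (hN : 0 < N) (hφ : 0 < φ) (hκ : κ = φ * ε) :
    ∀ n a : ℕ, (n : ℝ) + a + a ≤ N →
    φ / N * (((n : ℝ) + 3 / 2) * a / (1 + ε - e)) ≤
      chainFrac N φ κ 0 (-(φ * (1 + ε - e))) n a a := by
  have hc := h.c_ge
  have hc0 : 0 < 1 + ε - e := by linarith
  have hcc := h.c_mul
  have hinv : ∀ x : ℝ, x / (1 + ε - e) = x * (1 + ε + e) := fun x => by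
    rw [div_eq_iff hc0.ne', mul_assoc, mul_comm (1 + ε + e), hcc, mul_one]
  have hel := h.e_le
  have hε := h.eps_pos
  have he := h.e_pos
  have hεl := h.eps_le
  have key : ∀ n a : ℕ, (n : ℝ) + a + a ≤ N →
      φ / N * (max 0 ((n : ℝ) - 1 / 2) * ((a : ℝ) + 1) * (1 + ε - e)) +
        φ / N * (((n : ℝ) + 3 / 2) * a / (1 + ε - e)) ≤
      ((a : ℝ) + a) * (κ + φ / N * n) + φ * (1 + ε - e) := by
    intro n a hn
    have hn0 : (0 : ℝ) ≤ n := by positivity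
    have ha0 : (0 : ℝ) ≤ a := by positivity
    have : max 0 ((n : ℝ) - 1 / 2) * ((a : ℝ) + 1) * (1 + ε - e) +
        ((n : ℝ) + 3 / 2) * a / (1 + ε - e) ≤
        ((a : ℝ) + a) * (N * ε + n) + N * (1 + ε - e) := by
      rw [hinv]
      have hεN : 0 ≤ (a : ℝ) * ε * (N - n) := by
        have : 0 ≤ N - n := by linarith
        positivity
      -- The surplus is proportional to N - n ≥ 2a and pays for the terms of order a produced by
      -- -1/2 and 3/2.
      have h5 : ((a : ℝ) + a) * (1 + ε - e) ≤ (N - n) * (1 + ε - e) := by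
        gcongr
        linarith
      rcases le_total ((n : ℝ) - 1 / 2) 0 with hm | hm
      · rw [max_eq_left hm]
        have h6 : ((n : ℝ) + 3 / 2) * a * (1 + ε + e) ≤ ((n : ℝ) + 3 / 2) * a * (11 / 10) := by
          gcongr
          linarith
        have h7 : (a : ℝ) * (19 / 20) ≤ a * (1 + ε - e) := by gcongr
        have h8 : 0 ≤ (a : ℝ) * n := by positivity
        have h9 : 0 ≤ (n : ℝ) * (1 + ε - e) := by positivity
        have h10 : 0 ≤ (a : ℝ) * (N * ε) := by positivity
        nlinarith
      · rw [max_eq_right hm]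
        have h6 : (a : ℝ) * (1 + ε + e) ≤ a * (11 / 10) := by
          gcongr
          linarith
        have h7 : (a : ℝ) * (19 / 20) ≤ a * (1 + ε - e) := by gcongr
        nlinarith
    have h2 := mul_le_mul_of_nonneg_left this (show 0 ≤ φ / N by positivity)
    rw [mul_add] at h2
    refine h2.trans (le_of_eq ?_)
    rw [hκ]; field_simp
  have hpos : ∀ n a : ℕ, 0 ≤ φ / N * (max 0 ((n : ℝ) - 1 / 2) * ((a : ℝ) + 1) * (1 + ε - e)) :=
    fun n a => by positivity
  intro n
  induction n using Nat.twoStepInduction with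
  | zero =>
    intro a hn
    have h1 := key 0 a hn
    have h2 := hpos 0 a
    simp only [chainFrac]
    simp only [Nat.cast_zero, mul_zero, add_zero] at h1 h2 ⊢
    linarith
  | one =>
    intro a hn
    have h1 := key 1 a hn
    have h2 := hpos 1 a
    simp only [chainFrac]
    simp only [Nat.cast_one, mul_one] at h1 h2 ⊢
    linarith
  | more n ih _ =>
    intro a hn
    have h1 := key (n + 2) a hn
    have h3 := ih (a + 1) (by push_cast at hn ⊢; linarith)
    have e1 : ((a : ℝ) + a + 2) / 2 = a + 1 := by ring
    have h5 := pair_weight_le (φ / N) n a a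
    rw [e1] at h5
    have h4 := div_le_of_sq_le (B := φ / N * (((n : ℝ) + 3 / 2) * ((a : ℝ) + 1)))
      (by positivity) hc0 h5
      (G := chainFrac N φ κ 0 (-(φ * (1 + ε - e))) n (a + 1) (a + 1))
      (by push_cast at h3; rw [mul_div_assoc]; linarith)
    simp only [chainFrac]
    have e2 : max 0 (((n + 2 : ℕ) : ℝ) - 1 / 2) = (n : ℝ) + 3 / 2 := by
      rw [max_eq_right] <;> push_cast <;> linarith [(Nat.cast_nonneg n : (0 : ℝ) ≤ n)]
    rw [e2] at h1
    push_cast at h1 ⊢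
    linarith

/-- An upper bound on the continued fraction along the chain of `η`, from the trial state with
constant ratio `1 + ε - e`. -/
theorem chainFrac_le (h : SmallCoupling ε e s) (hN : 0 < N) (hφ : 0 < φ) (hκ : κ = φ * ε)
    (hz : z ≤ -(φ * (1 + ε - e)) + φ * (e * s)) (hz' : -(φ * (1 + ε - e)) + φ * (5 / (e * N)) ≤ z) :
    ∀ k a : ℕ, 1 ≤ a + k → (2 * (k : ℝ) + a + a = N) →
      chainFrac N φ κ 0 z (2 * k) a a ≤ φ * (a * (1 + ε + e + 3 * (1 + ε + e) / (e * N))) := by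
  have hc := h.c_ge
  have hc0 : 0 < 1 + ε - e := by linarith
  have hcc := h.c_mul
  have hel := h.e_le
  have hε := h.eps_pos
  have he := h.e_pos
  intro k
  induction k with
  | zero =>
    intro a ha hn
    have ha1 : (1 : ℝ) ≤ a := by exact_mod_cast ha
    simp only [chainFrac]
    have h1 : 0 ≤ φ * (5 / (e * N)) := by positivity
    have h2 : 0 ≤ φ * (a * (3 * (1 + ε + e) / (e * N))) := by positivity
    have h3 : φ * (1 * (1 + ε - e)) ≤ φ * (a * (1 + ε - e)) := by gcongr
    have h4 : ε ≤ e := by nlinarith [h.e_sq]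
    have h5 : φ * (a * ε) ≤ φ * (a * e) := by gcongr
    rw [hκ]
    nlinarith
  | succ k ih =>
    intro a _ hn
    have hn' : 2 * (k : ℝ) + ((a + 1 : ℕ) : ℝ) + ((a + 1 : ℕ) : ℝ) = N := by
      push_cast at hn ⊢; linarith
    have h1 := ih (a + 1) (by omega) hn'
    have h2 := chainFrac_pos h hN hφ hκ le_rfl hz (2 * k) (a + 1) (a + 1) (by omega)
      (by push_cast at hn' ⊢; linarith)
    rw [show 2 * (k + 1) = 2 * k + 2 by ring]
    simp only [chainFrac]
    set G := chainFrac N φ κ 0 z (2 * k) (a + 1) (a + 1) with hG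
    clear_value G
    push_cast at h1 hn ⊢
    have ha0 : (0 : ℝ) ≤ a := by positivity
    have hk0 : (0 : ℝ) ≤ k := by positivity
    -- The inequality (β - cG)² ≥ 0, read as β²/G ≥ 2cβ - c²G with β below the bond: it turns an
    -- upper bound on the tail G into an upper bound one state lower.
    have hb : 2 * (φ / N * ((a + 1) * (2 * k + 1))) * (1 + ε - e) - (1 + ε - e) ^ 2 * G ≤
        (φ / N) ^ 2 * ((2 * (k : ℝ) + 2) * (2 * (k : ℝ) + 1)) * (((a : ℝ) + 1) * ((a : ℝ) + 1)) /
          G := by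
      rw [le_div_iff₀ h2]
      have : (φ / N * ((a + 1) * (2 * k + 1))) ^ 2 ≤
        (φ / N) ^ 2 * ((2 * (k : ℝ) + 2) * (2 * (k : ℝ) + 1)) *
          (((a : ℝ) + 1) * ((a : ℝ) + 1)) := by
        have h5 : (2 * (k : ℝ) + 1) ^ 2 ≤ (2 * (k : ℝ) + 2) * (2 * (k : ℝ) + 1) := by nlinarith
        calc _ = (φ / N) ^ 2 * (2 * (k : ℝ) + 1) ^ 2 * (((a : ℝ) + 1) * ((a : ℝ) + 1)) := by ring
          _ ≤ _ := by gcongr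
      nlinarith [sq_nonneg (φ / N * ((a + 1) * (2 * k + 1)) - (1 + ε - e) * G)]
    have hG2 : (1 + ε - e) ^ 2 * G ≤ (1 + ε - e) ^ 2 *
        (φ * ((a + 1) * (1 + ε + e + 3 * (1 + ε + e) / (e * N)))) := by gcongr
    have hG3 : (1 + ε - e) ^ 2 *
        (φ * ((a + 1) * (1 + ε + e + 3 * (1 + ε + e) / (e * N)))) =
        φ * ((a + 1) * (1 + ε - e)) + φ / N * ((a + 1) * (3 * (1 + ε - e) / e)) := by
      calc _ = ((1 + ε - e) * (1 + ε + e)) *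
            (φ * ((a + 1) * (1 + ε - e)) + φ / N * ((a + 1) * (3 * (1 + ε - e) / e))) := by
            field_simp
        _ = _ := by rw [hcc, one_mul]
    -- Since 1/c - c = 2e, the coefficient 3/(eN) of the ansatz gains 6a, which cancels the linear
    -- term of 2(a+1)(2a+1).
    have hid : 3 * (1 + ε + e) / e = 3 * (1 + ε - e) / e + 6 := by field_simp; ring
    have hid2 : φ * (a * (1 + ε + e + 3 * (1 + ε + e) / (e * N))) =
        φ * (a * (1 + ε + e)) + φ / N * (a * (3 * (1 + ε - e) / e + 6)) := by
      rw [← hid]; field_simp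
    have hδ : φ * (5 / (e * N)) = φ / N * (5 / e) := by field_simp
    -- What is left at order φ/N is 2 + 3c/e, covered by the distance 5/(eN) from E^Bog.
    have hδ2 : 3 * (1 + ε - e) / e + 2 ≤ 5 / e := by
      rw [div_add' _ _ _ he.ne', div_le_div_iff_of_pos_right he]
      have := h.c_le
      linarith
    have hδ3 := mul_le_mul_of_nonneg_left hδ2 (show 0 ≤ φ / N by positivity)
    have hc1 := h.c_le
    have hu : φ = φ / N * N := by field_simp
    rw [hG3] at hG2
    rw [hid2, hκ]
    set u := φ / N
    set v := 3 * (1 + ε - e) / e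
    have h9 : u * ((1 + ε - e) * ((a + 1) * (2 * a + 1))) ≤ u * (1 * ((a + 1) * (2 * a + 1))) := by
      have : 0 ≤ u := by positivity
      gcongr
    rw [hδ] at hz'
    clear hδ hG3 hid2 hid h1 hG hz hκ ih
    clear_value u v
    subst hu
    subst hn
    linarith

end Bounds

/-- The continued fraction of the chain of `η` has a zero just above `E^Bog`. -/
theorem exists_chainFrac_eq_zero {ε e s φ κ : ℝ} (h : SmallCoupling ε e s) {N : ℕ} (hN : 0 < N)
    (hE : Even N) (hφ : 0 < φ) (hκ : κ = φ * ε) (hδ : 5 / (e * N) ≤ e * s) :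
    ∃ z, -(φ * (1 + ε - e)) ≤ z ∧ z ≤ -(φ * (1 + ε - e)) + φ * (5 / (e * N)) ∧
      chainFrac N φ κ 0 z N 0 0 = 0 := by
  have hN' : (0 : ℝ) < N := by exact_mod_cast hN
  have he := h.e_pos
  have hle : φ * (5 / (e * N)) ≤ φ * (e * s) := by gcongr
  have h0 : 0 ≤ φ * (5 / (e * N)) := by positivity
  -- At a = 0 the lower and the upper bound are both 0, so they give the signs at the two ends.
  have h1 := chainFrac_eBog_ge h hN' hφ hκ N 0 (by simp)
  obtain ⟨k, hk⟩ := hE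
  have h2 := chainFrac_le h hN' hφ hκ (z := -(φ * (1 + ε - e)) + φ * (5 / (e * N)))
    (by linarith) le_rfl k 0 (by omega) (by rw [hk]; push_cast; ring)
  rw [show 2 * k = N by omega] at h2
  simp only [CharP.cast_eq_zero, mul_zero, zero_mul, zero_div] at h1 h2
  have hc := (chainFrac_continuousOn (κ := κ) h hN' hφ hκ le_rfl N 0 0 (by simp)).mono
    (t := Set.Icc (-(φ * (1 + ε - e))) (-(φ * (1 + ε - e)) + φ * (5 / (e * N))))
    (Set.Icc_subset_Iic_self.trans (Set.Iic_subset_Iic.2 (by linarith)))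
  obtain ⟨z, hz, hz0⟩ := intermediate_value_Icc' (by linarith) hc ⟨h2, h1⟩
  exact ⟨z, hz.1, hz.2, hz0⟩

/-- Lowering the number `n` of particles available to the pairs to `n'` raises the energy: the
ground state of a chain of length `n` is a supersolution for the chain of length `n'`. -/
theorem supersolution_of_lt {u κ z G R a n n' : ℝ} (hn' : 0 ≤ n') (hnn : n' < n) (ha : 0 ≤ a)
    (hκ : 2 * u ≤ κ) (hz : z ≤ 0) (hR : 0 ≤ R)
    (hsum : R + G = 2 * a * (κ + u * n) - z) :
    G * ((n' + 2) / (n + 2)) + R * (n' / n) ≤ 2 * a * (κ + u * n') - z := by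
  have hn : 0 < n := by linarith
  have h1 : G * ((n' + 2) / (n + 2)) + R * (n' / n) =
      (n' / n) * (R + G) + (2 * G / (n + 2)) * ((n - n') / n) := by
    field_simp
    ring
  -- With G bounded through `hsum` and R ≥ 0, the claim reduces to 4au ≤ 2aκ - z.
  have h2 : 2 * G / (n + 2) ≤ 2 * a * κ - z := by
    rw [div_le_iff₀ (by linarith)]
    have : a * (2 * u) ≤ a * κ := by gcongr
    have h3 : 0 ≤ n * (2 * a * κ - z - 4 * a * u) :=
      mul_nonneg hn.le (by linarith)
    nlinarith
  have h3 := mul_le_mul_of_nonneg_right h2 (show 0 ≤ (n - n') / n by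
    have : 0 ≤ n - n' := by linarith
    positivity)
  rw [h1, hsum]
  refine (add_le_add_right h3 _).trans (le_of_eq ?_)
  field_simp
  ring

/-! ### The operators in coordinates -/

/-- Two particles of the zero mode are replaced by a pair in the modes `±j`. -/
def pairUp {d : ℕ} (j : Mode d) (n : Occ d) : Occ d :=
  n - Finsupp.single 0 1 - Finsupp.single 0 1 + Finsupp.single j 1 + Finsupp.single (-j) 1

/-- A pair in the modes `±j` is replaced by two particles of the zero mode. -/
def pairDown {d : ℕ} (j : Mode d) (n : Occ d) : Occ d :=
  n + Finsupp.single 0 1 + Finsupp.single 0 1 - Finsupp.single j 1 - Finsupp.single (-j) 1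

section Modes

variable {d : ℕ} {j : Mode d}

theorem neg_mode_ne (hj : j ≠ 0) : -j ≠ j := by
  intro h
  apply hj
  funext i
  have := congrFun h i
  simp only [Pi.neg_apply] at this
  simp only [Pi.zero_apply]
  omega

theorem pairUp_zero (hj : j ≠ 0) (n : Occ d) : pairUp j n 0 = n 0 - 2 := by
  have h1 : -j ≠ 0 := neg_ne_zero.2 hj
  simp [pairUp, hj, Nat.sub_sub]

theorem pairUp_self (hj : j ≠ 0) (n : Occ d) : pairUp j n j = n j + 1 := by
  simp [pairUp, hj.symm, neg_mode_ne hj]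

theorem pairUp_neg (hj : j ≠ 0) (n : Occ d) : pairUp j n (-j) = n (-j) + 1 := by
  have h1 : -j ≠ 0 := neg_ne_zero.2 hj
  simp [pairUp, hj, (neg_mode_ne hj).symm]

theorem pairDown_zero (hj : j ≠ 0) (n : Occ d) : pairDown j n 0 = n 0 + 2 := by
  have h1 : -j ≠ 0 := neg_ne_zero.2 hj
  simp [pairDown, hj]

theorem pairDown_self (hj : j ≠ 0) (n : Occ d) : pairDown j n j = n j - 1 := by
  simp [pairDown, hj.symm, neg_mode_ne hj]

theorem pairDown_neg (hj : j ≠ 0) (n : Occ d) : pairDown j n (-j) = n (-j) - 1 := by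
  have h1 : -j ≠ 0 := neg_ne_zero.2 hj
  simp [pairDown, hj, (neg_mode_ne hj).symm]

/-- Writing the state as m plus two zero-mode particles removes the truncated subtraction; the
identities that follow are proved in this form. -/
theorem pairUp_add (m : Occ d) :
    pairUp j (m + Finsupp.single 0 1 + Finsupp.single 0 1) =
      m + Finsupp.single j 1 + Finsupp.single (-j) 1 := by
  simp [pairUp]

theorem pairDown_add (m : Occ d) :
    pairDown j (m + Finsupp.single j 1 + Finsupp.single (-j) 1) =
      m + Finsupp.single 0 1 + Finsupp.single 0 1 := by
  ext p
  simp only [pairDown, Finsupp.coe_add, Finsupp.coe_tsub, Pi.add_apply, Pi.sub_apply]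
  omega

theorem exists_eq_add_zero_pair {n : Occ d} (h : 2 ≤ n 0) :
    ∃ m : Occ d, n = m + Finsupp.single 0 1 + Finsupp.single 0 1 := by
  refine ⟨n - Finsupp.single 0 1 - Finsupp.single 0 1, ?_⟩
  ext p
  by_cases hp : p = 0
  · subst hp
    simp only [Finsupp.coe_add, Finsupp.coe_tsub, Pi.add_apply, Pi.sub_apply,
      Finsupp.single_eq_same]
    omega
  · simp [Ne.symm hp]

theorem exists_eq_add_pair (hj : j ≠ 0) {n : Occ d} (h1 : 1 ≤ n j) (h2 : 1 ≤ n (-j)) :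
    ∃ m : Occ d, n = m + Finsupp.single j 1 + Finsupp.single (-j) 1 := by
  refine ⟨n - Finsupp.single j 1 - Finsupp.single (-j) 1, ?_⟩
  ext p
  have := neg_mode_ne hj
  by_cases hp : p = j
  · subst hp
    simp [this]
    omega
  · by_cases hp' : p = -j
    · subst hp'
      simp [this.symm]
      omega
    · simp [Ne.symm hp, Ne.symm hp']

theorem degree_pairUp {n : Occ d} (h : 2 ≤ n 0) : (pairUp j n).degree = n.degree := by
  obtain ⟨m, rfl⟩ := exists_eq_add_zero_pair h
  rw [pairUp_add]
  simp [map_add]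

theorem degree_pairDown (hj : j ≠ 0) {n : Occ d} (h1 : 1 ≤ n j) (h2 : 1 ≤ n (-j)) :
    (pairDown j n).degree = n.degree := by
  obtain ⟨m, rfl⟩ := exists_eq_add_pair hj h1 h2
  rw [pairDown_add]
  simp [map_add]

theorem pairDown_pairUp {n : Occ d} (h : 2 ≤ n 0) : pairDown j (pairUp j n) = n := by
  obtain ⟨m, rfl⟩ := exists_eq_add_zero_pair h
  rw [pairUp_add, pairDown_add]

theorem pairUp_pairDown (hj : j ≠ 0) {n : Occ d} (h1 : 1 ≤ n j) (h2 : 1 ≤ n (-j)) :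
    pairUp j (pairDown j n) = n := by
  obtain ⟨m, rfl⟩ := exists_eq_add_pair hj h1 h2
  rw [pairDown_add, pairUp_add]

/-- The total number of particles in the modes `0, ±j` is at most the number of particles. -/
theorem three_modes_le (hj : j ≠ 0) (n : Occ d) : n 0 + n j + n (-j) ≤ n.degree := by
  classical
  have h1 : -j ≠ 0 := neg_ne_zero.2 hj
  have h2 := neg_mode_ne hj
  have : n.degree = ∑ p ∈ n.support ∪ {0, j, -j}, n p :=
    Finset.sum_subset Finset.subset_union_left fun p _ hp => Finsupp.notMem_support_iff.1 hp
  rw [this]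
  calc n 0 + n j + n (-j) = ∑ p ∈ ({0, j, -j} : Finset (Mode d)), n p := by
        rw [Finset.sum_insert, Finset.sum_insert, Finset.sum_singleton, add_assoc]
        · simpa using h2.symm
        · simp [hj.symm, h1.symm]
    _ ≤ _ := Finset.sum_le_sum_of_subset Finset.subset_union_right

/-! ### The kinetic energy of the other modes -/

theorem kSq_nonneg (L : ℝ) (p : Mode d) : 0 ≤ kSq L p :=
  Finset.sum_nonneg fun _ _ => sq_nonneg _

theorem kSq_zero (L : ℝ) : kSq L (0 : Mode d) = 0 := by simp [kSq]

theorem kSq_neg (L : ℝ) (p : Mode d) : kSq L (-p) = kSq L p := by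
  simp [kSq]

theorem kinEnergy_add (L : ℝ) (n m : Occ d) :
    kinEnergy L (n + m) = kinEnergy L n + kinEnergy L m := by
  unfold kinEnergy
  exact Finsupp.sum_add_index' (by simp) (fun p a b => by push_cast; ring)

theorem kinEnergy_single (L : ℝ) (p : Mode d) (m : ℕ) :
    kinEnergy L (Finsupp.single p m) = m * kSq L p := by
  unfold kinEnergy
  exact Finsupp.sum_single_index (by simp)

theorem kinEnergy_nonneg (L : ℝ) (n : Occ d) : 0 ≤ kinEnergy L n :=
  Finset.sum_nonneg fun _ _ => mul_nonneg (Nat.cast_nonneg _) (kSq_nonneg _ _)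

/-- The kinetic energy of the modes other than `±j`. -/
def restKin (L : ℝ) (j : Mode d) (n : Occ d) : ℝ :=
  kinEnergy L n - ((n j : ℝ) + n (-j)) * kSq L j

/-- Erasing the modes ±j exhibits the difference as a kinetic energy, hence as a sum of nonnegative
terms. -/
theorem restKin_eq (hj : j ≠ 0) (L : ℝ) (n : Occ d) :
    restKin L j n = kinEnergy L ((n.erase j).erase (-j)) := by
  have h1 : n = Finsupp.single j (n j) + n.erase j := (Finsupp.single_add_erase j n).symm
  have h2 : n.erase j = Finsupp.single (-j) (n (-j)) + (n.erase j).erase (-j) := by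
    conv_lhs => rw [← Finsupp.single_add_erase (-j) (n.erase j)]
    rw [Finsupp.erase_ne (neg_mode_ne hj)]
  have h3 : kinEnergy L n = (n j : ℝ) * kSq L j + ((n (-j) : ℝ) * kSq L j +
      kinEnergy L ((n.erase j).erase (-j))) := by
    conv_lhs => rw [h1, h2, kinEnergy_add, kinEnergy_add, kinEnergy_single, kinEnergy_single,
      kSq_neg]
  rw [restKin, h3]
  ring

theorem restKin_nonneg (hj : j ≠ 0) (L : ℝ) (n : Occ d) : 0 ≤ restKin L j n := by
  rw [restKin_eq hj]
  exact kinEnergy_nonneg _ _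

theorem gap0_le (L : ℝ) {p : Mode d} (hp : p ≠ 0) : gap0 d L ≤ kSq L p :=
  ciInf_le (f := fun p : {p : Mode d // p ≠ 0} => kSq L p.1)
    ⟨0, by rintro _ ⟨p, rfl⟩; exact kSq_nonneg _ _⟩ ⟨p, hp⟩

/-- If the modes 0, ±j do not hold all particles, some other mode is occupied and alone contributes
Δ₀. -/
theorem gap0_le_restKin (hj : j ≠ 0) (L : ℝ) {n : Occ d} (h : n 0 + n j + n (-j) ≠ n.degree) :
    gap0 d L ≤ restKin L j n := by
  classical
  rw [restKin_eq hj]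
  set m := (n.erase j).erase (-j) with hm
  have hj' : -j ≠ 0 := neg_ne_zero.2 hj
  obtain ⟨p, hp0, hp⟩ : ∃ p, p ≠ 0 ∧ m p ≠ 0 := by
    by_contra! hcon
    apply h
    have h1 : ∀ q, q ≠ 0 → q ≠ j → q ≠ -j → n q = 0 := fun q h0 h1 h2 => by
      have := hcon q h0
      rwa [hm, Finsupp.erase_ne h2, Finsupp.erase_ne h1] at this
    have h2 := neg_mode_ne hj
    have : n.degree = ∑ p ∈ ({0, j, -j} : Finset (Mode d)), n p := by
      refine Finset.sum_subset (fun p hp => ?_) fun p _ hp => Finsupp.notMem_support_iff.1 hp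
      by_contra hc
      simp only [Finset.mem_insert, Finset.mem_singleton, not_or] at hc
      exact (Finsupp.mem_support_iff.1 hp) (h1 p hc.1 hc.2.1 hc.2.2)
    rw [this, Finset.sum_insert, Finset.sum_insert, Finset.sum_singleton, add_assoc]
    · simpa using h2.symm
    · simp [hj.symm, hj'.symm]
  have h1 : (m p : ℝ) * kSq L p ≤ kinEnergy L m :=
    Finset.single_le_sum (f := fun p => (m p : ℝ) * kSq L p)
      (fun _ _ => mul_nonneg (Nat.cast_nonneg _) (kSq_nonneg _ _)) (Finsupp.mem_support_iff.2 hp)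
  have h2 : (1 : ℝ) ≤ m p := by exact_mod_cast Nat.one_le_iff_ne_zero.2 hp
  have h3 := gap0_le L hp0
  have h4 := kSq_nonneg L p
  nlinarith

/-- The zero mode carries no kinetic energy, so this quantity is constant along a chain. -/
theorem restKin_pairUp (hj : j ≠ 0) (L : ℝ) {n : Occ d} (h : 2 ≤ n 0) :
    restKin L j (pairUp j n) = restKin L j n := by
  have h1 := pairUp_self hj n
  have h2 := pairUp_neg hj n
  unfold restKin
  rw [h1, h2]
  obtain ⟨m, rfl⟩ := exists_eq_add_zero_pair h
  rw [pairUp_add]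
  simp only [kinEnergy_add, kinEnergy_single, kSq_neg, kSq_zero]
  push_cast
  ring

end Modes

/-! ### Chains of product states and the matrix elements of the Hamiltonian. -/

section Coordinates

variable {d N : ℕ} (j : Mode d)

/-- The product state with one pair in the modes `±j` more; the state itself if there is none. -/
def up (n : Conf d N) : Conf d N :=
  if h : (pairUp j n.1).degree = N then ⟨pairUp j n.1, h⟩ else n

/-- The product state with one pair in the modes `±j` less; the state itself if there is none. -/
def down (n : Conf d N) : Conf d N :=
  if h : (pairDown j n.1).degree = N then ⟨pairDown j n.1, h⟩ else n

/-- The matrix element of the interaction between a product state and the one above it. -/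
def bUp (φ : ℝ) (n : Conf d N) : ℝ :=
  φ / N * √((n.1 0 : ℝ) * ((n.1 0 : ℝ) - 1)) * √(((n.1 j : ℝ) + 1) * ((n.1 (-j) : ℝ) + 1))

/-- The matrix element of the interaction between a product state and the one below it. -/
def bDown (φ : ℝ) (n : Conf d N) : ℝ :=
  φ / N * √(((n.1 0 : ℝ) + 2) * ((n.1 0 : ℝ) + 1)) * √((n.1 j : ℝ) * (n.1 (-j) : ℝ))

/-- The diagonal matrix elements of the Hamiltonian. -/
def diagH (L φ : ℝ) (n : Conf d N) : ℝ :=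
  kinEnergy L n.1 + φ / N * ((n.1 0 : ℝ) * ((n.1 j : ℝ) + n.1 (-j)))

variable {j}

theorem up_val {n : Conf d N} (h : 2 ≤ n.1 0) : (up j n).1 = pairUp j n.1 := by
  rw [up, dif_pos ((degree_pairUp h).trans n.2)]

theorem down_val (hj : j ≠ 0) {n : Conf d N} (h1 : 1 ≤ n.1 j) (h2 : 1 ≤ n.1 (-j)) :
    (down j n).1 = pairDown j n.1 := by
  rw [down, dif_pos ((degree_pairDown hj h1 h2).trans n.2)]

/-- The bond vanishes exactly where `up` would take its default value, which therefore never
matters. -/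
theorem bUp_eq_zero {φ : ℝ} {n : Conf d N} (h : ¬ 2 ≤ n.1 0) : bUp j φ n = 0 := by
  have : n.1 0 = 0 ∨ n.1 0 = 1 := by omega
  rcases this with h | h <;> simp [bUp, h]

theorem bDown_eq_zero {φ : ℝ} {n : Conf d N} (h : ¬ (1 ≤ n.1 j ∧ 1 ≤ n.1 (-j))) :
    bDown j φ n = 0 := by
  have : n.1 j = 0 ∨ n.1 (-j) = 0 := by omega
  rcases this with h | h <;> simp [bDown, h]

theorem down_up (hj : j ≠ 0) {n : Conf d N} (h : 2 ≤ n.1 0) : down j (up j n) = n := by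
  apply Subtype.ext
  have h1 := up_val (j := j) h
  rw [down_val hj (by rw [h1, pairUp_self hj]; omega) (by rw [h1, pairUp_neg hj]; omega), h1,
    pairDown_pairUp h]

theorem up_down (hj : j ≠ 0) {n : Conf d N} (h1 : 1 ≤ n.1 j) (h2 : 1 ≤ n.1 (-j)) :
    up j (down j n) = n := by
  apply Subtype.ext
  have h3 := down_val hj h1 h2
  rw [up_val (by rw [h3, pairDown_zero hj]; omega), h3, pairUp_pairDown hj h1 h2]

/-- Symmetry of the Jacobi matrix: both ends of a bond carry the same matrix element. -/
theorem bDown_up (hj : j ≠ 0) {φ : ℝ} {n : Conf d N} (h : 2 ≤ n.1 0) :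
    bDown j φ (up j n) = bUp j φ n := by
  rw [bDown, bUp, up_val h, pairUp_zero hj, pairUp_self hj, pairUp_neg hj]
  push_cast [Nat.cast_sub h]
  ring_nf

theorem bUp_down (hj : j ≠ 0) {φ : ℝ} {n : Conf d N} (h1 : 1 ≤ n.1 j) (h2 : 1 ≤ n.1 (-j)) :
    bUp j φ (down j n) = bDown j φ n := by
  rw [← bDown_up hj (by rw [down_val hj h1 h2, pairDown_zero hj]; omega), up_down hj h1 h2]

theorem bUp_nonneg {φ : ℝ} (hφ : 0 ≤ φ) (n : Conf d N) : 0 ≤ bUp j φ n := by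
  unfold bUp; positivity

theorem bUp_sq {φ : ℝ} (n : Conf d N) : bUp j φ n ^ 2 =
    (φ / N) ^ 2 * ((n.1 0 : ℝ) * ((n.1 0 : ℝ) - 1)) *
      (((n.1 j : ℝ) + 1) * ((n.1 (-j) : ℝ) + 1)) := by
  have h : (0 : ℝ) ≤ (n.1 0 : ℝ) * ((n.1 0 : ℝ) - 1) := by
    rcases Nat.eq_zero_or_pos (n.1 0) with h | h
    · simp [h]
    · have : (1 : ℝ) ≤ n.1 0 := by exact_mod_cast h
      exact mul_nonneg (by positivity) (by linarith)
  rw [bUp, mul_pow, mul_pow, Real.sq_sqrt h, Real.sq_sqrt (by positivity)]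

/-- `W` removes a pair, so in coordinates it reads the coefficient one step up the chain. -/
theorem W_apply (hj : j ≠ 0) (φ : ℝ) (x : Fock d N) (n : Conf d N) :
    W N φ j x n = (bUp j φ n : ℂ) * x (up j n) := by
  have h1 : -j ≠ 0 := neg_ne_zero.2 hj
  have h2 := neg_mode_ne hj
  have h3 : W N φ j x n = ((φ / N : ℝ) : ℂ) * ((√(n.1 0 : ℝ) : ℂ) * ((√((n.1 0 - 1 : ℕ) : ℝ) : ℂ) *
      ((√((n.1 j : ℝ) + 1) : ℂ) * ((√((n.1 (-j) : ℝ) + 1) : ℂ) *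
        (incl d N x).1 (pairUp j n.1))))) := by
    simp [W, onFock, proj, create, annih, pairUp, hj, h1, h2]
    exact Or.inl rfl
  rw [h3]
  by_cases hn : 2 ≤ n.1 0
  · have h4 : (incl d N x).1 (pairUp j n.1) = x (up j n) := by
      have hd : (pairUp j n.1).degree = N := (degree_pairUp hn).trans n.2
      rw [up, dif_pos hd]
      simp [incl, hd]
    rw [h4, bUp, Real.sqrt_mul (by positivity), Real.sqrt_mul (by positivity),
      Nat.cast_sub (by omega)]
    push_cast
    ring
  · rw [bUp_eq_zero hn]
    have : n.1 0 = 0 ∨ n.1 0 = 1 := by omega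
    rcases this with h | h <;> simp [h]

theorem Wstar_apply (hj : j ≠ 0) (φ : ℝ) (x : Fock d N) (n : Conf d N) :
    Wstar N φ j x n = (bDown j φ n : ℂ) * x (down j n) := by
  have h1 : -j ≠ 0 := neg_ne_zero.2 hj
  have h2 := neg_mode_ne hj
  have h3 : Wstar N φ j x n = ((φ / N : ℝ) : ℂ) * ((√((n.1 0 : ℝ) + 1) : ℂ) *
      ((√((n.1 0 : ℝ) + 1 + 1) : ℂ) * ((√(n.1 j : ℝ) : ℂ) * ((√(n.1 (-j) : ℝ) : ℂ) *
        (incl d N x).1 (pairDown j n.1))))) := by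
    simp [Wstar, onFock, proj, create, annih, pairDown, hj, h1, h2]
    exact Or.inl rfl
  rw [h3]
  by_cases hn : 1 ≤ n.1 j ∧ 1 ≤ n.1 (-j)
  · have h4 : (incl d N x).1 (pairDown j n.1) = x (down j n) := by
      have hd : (pairDown j n.1).degree = N := (degree_pairDown hj hn.1 hn.2).trans n.2
      rw [down, dif_pos hd]
      simp [incl, hd]
    rw [h4, bDown, Real.sqrt_mul (by positivity), Real.sqrt_mul (by positivity), add_assoc,
      one_add_one_eq_two]
    push_cast
    ring
  · rw [bDown_eq_zero hn]
    have : n.1 j = 0 ∨ n.1 (-j) = 0 := by omega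
    rcases this with h | h <;> simp [h]

theorem create_annih_apply (p : Mode d) (x : FinFock d) (n : Occ d) :
    (create p (annih p x)).1 n = (n p : ℂ) * x.1 n := by
  by_cases h : n p = 0
  · simp [create, h]
  · have h1 : n - Finsupp.single p 1 + Finsupp.single p 1 = n :=
      tsub_add_cancel_of_le (by rw [Finsupp.single_le_iff]; omega)
    have h2 : (((n p - 1 : ℕ) : ℝ) + 1) = n p := by
      rw [Nat.cast_sub (by omega)]; simp
    simp only [create, annih, LinearMap.coe_mk, AddHom.coe_mk, h1, Finsupp.coe_tsub, Pi.sub_apply,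
      Finsupp.single_eq_same]
    rw [h2, ← mul_assoc, ← Complex.ofReal_mul, Real.mul_self_sqrt (by positivity)]
    simp

theorem diagInt_apply (φ : ℝ) (x : Fock d N) (n : Conf d N) :
    diagInt N φ j x n =
      ((φ / N * ((n.1 0 : ℝ) * ((n.1 j : ℝ) + n.1 (-j))) : ℝ) : ℂ) * x n := by
  have h1 : (incl d N x).1 n.1 = x n := by simp [incl, n.2]
  have h2 : diagInt N φ j x n = ((φ / N : ℝ) : ℂ) * (create 0 (annih 0 (create j (annih j
      (incl d N x)) + create (-j) (annih (-j) (incl d N x))))).1 n.1 := rfl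
  have h3 : ((create j (annih j (incl d N x)) + create (-j) (annih (-j) (incl d N x)) :
      FinFock d)).1 n.1 = ((n.1 j : ℂ) + n.1 (-j)) * x n := by
    have : ((create j (annih j (incl d N x)) + create (-j) (annih (-j) (incl d N x)) :
      FinFock d)).1 n.1 = (create j (annih j (incl d N x))).1 n.1 +
        (create (-j) (annih (-j) (incl d N x))).1 n.1 := rfl
    rw [this, create_annih_apply, create_annih_apply, h1]
    ring
  rw [h2, create_annih_apply, h3]
  push_cast
  ring

/-- The Hamiltonian acts on each chain of product states as a Jacobi matrix. -/
theorem hBog_apply (hj : j ≠ 0) (L φ : ℝ) (x : dom d N L) (n : Conf d N) :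
    hBog N L φ j x n = (diagH j L φ n : ℂ) * x.1 n + (bDown j φ n : ℂ) * x.1 (down j n) +
      (bUp j φ n : ℂ) * x.1 (up j n) := by
  have : hBog N L φ j x n = (kinEnergy L n.1 : ℂ) * x.1 n + (diagInt N φ j x.1 n +
    W N φ j x.1 n + Wstar N φ j x.1 n) := rfl
  rw [this, diagInt_apply, W_apply hj, Wstar_apply hj, diagH]
  push_cast
  ring

end Coordinates

/-! ### The flow in coordinates -/

theorem maskOp_apply {d N : ℕ} (S : Set (Conf d N)) (x : Fock d N) (n : Conf d N) :
    maskOp S x n = S.indicator (fun n => x n) n := rfl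

theorem maskDom_apply {d N : ℕ} {L : ℝ} (S : Set (Conf d N)) (x : dom d N L) (n : Conf d N) :
    (maskDom L S x).1 n = S.indicator (fun n => x.1 n) n := rfl

theorem IsInverseOn.unique {d N : ℕ} {L : ℝ} {S : Set (Conf d N)}
    {A : dom d N L →ₗ[ℂ] Fock d N} {R R' : Fock d N →ₗ[ℂ] dom d N L}
    (h : IsInverseOn S A R) (h' : IsInverseOn S A R') : R = R' := by
  ext1 y
  rw [← h'.left (R y) (h.range y), h.right, ← h'.right, h'.left _ (h'.range y)]

/-- The flow is defined through a chosen inverse; by uniqueness any explicit one may replace it. -/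
theorem IsInverseOn.invOn_eq {d N : ℕ} {L : ℝ} {S : Set (Conf d N)}
    {A : dom d N L →ₗ[ℂ] Fock d N} {R : Fock d N →ₗ[ℂ] dom d N L}
    (h : IsInverseOn S A R) : invOn S A = R := by
  have hi : InvertibleOn S A := ⟨R, h⟩
  rw [invOn, dif_pos hi]
  exact hi.choose_spec.unique h

/-- A diagonal operator on the span of the product states in `S` which dominates the kinetic energy
and a positive constant has a bounded inverse. -/
theorem exists_isInverseOn_of_diagonal {d N : ℕ} {L : ℝ} {S : Set (Conf d N)}
    {A : dom d N L →ₗ[ℂ] Fock d N} {g : Conf d N → ℝ} {δ C : ℝ} (hδ : 0 < δ)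
    (hg : ∀ n ∈ S, δ ≤ g n) (hk : ∀ n ∈ S, kinEnergy L n.1 ≤ C * g n)
    (hA : ∀ x, maskDom L S x = x → ∀ n ∈ S, A x n = (g n : ℂ) * x.1 n) :
    ∃ R, IsInverseOn S A R ∧ ∀ y n, (R y).1 n = S.indicator (fun n => y n / (g n : ℂ)) n := by
  have hn1 : ∀ (y : Conf d N → ℂ) n, ‖S.indicator (fun n => y n / (g n : ℂ)) n‖ ≤ δ⁻¹ * ‖y n‖ := by
    intro y n
    by_cases hn : n ∈ S
    · rw [Set.indicator_of_mem hn, norm_div, Complex.norm_real, Real.norm_eq_abs,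
        abs_of_pos (hδ.trans_le (hg n hn)), div_eq_inv_mul]
      gcongr
      exact hg n hn
    · rw [Set.indicator_of_notMem hn, norm_zero]; positivity
  -- Dominating the kinetic energy is what puts the image of the inverse into the domain.
  have hn2 : ∀ (y : Conf d N → ℂ) n,
      ‖(kinEnergy L n.1 : ℂ) * S.indicator (fun n => y n / (g n : ℂ)) n‖ ≤ |C| * ‖y n‖ := by
    intro y n
    by_cases hn : n ∈ S
    · have hg0 := hδ.trans_le (hg n hn)
      rw [Set.indicator_of_mem hn, norm_mul, norm_div, Complex.norm_real, Complex.norm_real,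
        Real.norm_eq_abs, Real.norm_eq_abs, abs_of_pos hg0, abs_of_nonneg (kinEnergy_nonneg _ _),
        ← mul_div_assoc, div_le_iff₀ hg0]
      calc kinEnergy L n.1 * ‖y n‖ ≤ (|C| * g n) * ‖y n‖ := by
            gcongr
            exact (hk n hn).trans (mul_le_mul_of_nonneg_right (le_abs_self C) hg0.le)
        _ = _ := by ring
    · rw [Set.indicator_of_notMem hn, mul_zero, norm_zero]; positivity
  have hmem : ∀ {f y : Conf d N → ℂ} {K : ℝ}, (∀ n, ‖f n‖ ≤ K * ‖y n‖) → Memℓp y 2 → Memℓp f 2 := by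
    intro f y K hf hy
    rw [memℓp_two_iff] at hy ⊢
    refine Summable.of_nonneg_of_le (fun n => by positivity) (fun n => ?_) (hy.mul_left (K ^ 2))
    rw [← mul_pow]
    exact pow_le_pow_left₀ (norm_nonneg _) (hf n) 2
  let R : Fock d N →ₗ[ℂ] dom d N L :=
    { toFun := fun y => ⟨⟨fun n => S.indicator (fun n => y n / (g n : ℂ)) n,
        hmem (hn1 y) (lp.memℓp y)⟩, hmem (hn2 y) (lp.memℓp y)⟩
      map_add' := fun x y => by
        ext n
        change S.indicator (fun n => (x n + y n) / (g n : ℂ)) n =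
          S.indicator (fun n => x n / (g n : ℂ)) n + S.indicator (fun n => y n / (g n : ℂ)) n
        by_cases hn : n ∈ S <;> simp [hn, add_div]
      map_smul' := fun c y => by
        ext n
        by_cases hn : n ∈ S <;> simp [hn, mul_div_assoc] }
  have hR : ∀ y n, (R y).1 n = S.indicator (fun n => y n / (g n : ℂ)) n := fun _ _ => rfl
  have hg0 : ∀ n ∈ S, (g n : ℂ) ≠ 0 := fun n hn =>
    Complex.ofReal_ne_zero.2 (hδ.trans_le (hg n hn)).ne'
  have hrange : ∀ y, maskDom L S (R y) = R y := fun y => by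
    ext n
    rw [maskDom_apply]
    by_cases hn : n ∈ S <;> simp [hn, hR]
  refine ⟨R, ⟨⟨δ⁻¹, fun y => ?_⟩, hrange, fun y => ?_, fun x hx => ?_⟩, hR⟩
  · calc ‖(R y).1‖ ≤ ‖(δ⁻¹ : ℂ) • y‖ := by
          refine lp.norm_mono (by norm_num) fun n => ?_
          rw [hR]
          refine (hn1 y n).trans (le_of_eq ?_)
          simp [abs_of_pos hδ]
      _ = δ⁻¹ * ‖y‖ := by
          rw [norm_smul]
          simp [abs_of_pos hδ]
  · ext n
    rw [maskOp_apply, maskOp_apply]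
    by_cases hn : n ∈ S
    · rw [Set.indicator_of_mem hn, Set.indicator_of_mem hn, hA _ (hrange y) n hn, hR,
        Set.indicator_of_mem hn, mul_div_cancel₀ _ (hg0 n hn)]
    · rw [Set.indicator_of_notMem hn, Set.indicator_of_notMem hn]
  · ext n
    rw [hR]
    by_cases hn : n ∈ S
    · rw [Set.indicator_of_mem hn, maskOp_apply, Set.indicator_of_mem hn, hA x hx n hn,
        mul_div_cancel_left₀ _ (hg0 n hn)]
    · rw [Set.indicator_of_notMem hn, ← hx, maskDom_apply, Set.indicator_of_notMem hn]

section Flow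

variable {d N : ℕ} {j : Mode d} {L φ z : ℝ}

/-- The diagonal matrix element which the flow produces at a product state. -/
def flowDiag (L φ : ℝ) (j : Mode d) (z : ℝ) (n : Conf d N) : ℝ :=
  chainFrac N φ (kSq L j) (restKin L j n.1) z (n.1 0) (n.1 j) (n.1 (-j))

theorem diagH_eq (n : Conf d N) : diagH j L φ n =
    restKin L j n.1 + ((n.1 j : ℝ) + n.1 (-j)) * (kSq L j + φ / N * n.1 0) := by
  unfold diagH restKin
  ring

/-- The recursion of `chainFrac` read along the chain: eliminating the state above subtracts b²/G.
Where there is no state above, b = 0 and the quotient drops out. -/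
theorem flowDiag_eq (hj : j ≠ 0) (n : Conf d N) : flowDiag L φ j z n =
    diagH j L φ n - z - bUp j φ n ^ 2 / flowDiag L φ j z (up j n) := by
  by_cases h : 2 ≤ n.1 0
  · obtain ⟨m, hm⟩ : ∃ m, n.1 0 = m + 2 := ⟨n.1 0 - 2, by omega⟩
    have h2 : flowDiag L φ j z (up j n) =
        chainFrac N φ (kSq L j) (restKin L j n.1) z m (n.1 j + 1) (n.1 (-j) + 1) := by
      rw [flowDiag, up_val h, restKin_pairUp hj L h, pairUp_zero hj, pairUp_self hj,
        pairUp_neg hj, hm]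
      rfl
    rw [h2, bUp_sq, diagH_eq, flowDiag, hm, chainFrac]
    push_cast
    ring_nf
  · rw [bUp_eq_zero h, diagH_eq, flowDiag]
    have : n.1 0 = 0 ∨ n.1 0 = 1 := by omega
    rcases this with h | h <;> simp [h, chainFrac]

theorem pairNum_up (hj : j ≠ 0) {n : Conf d N} (h : 2 ≤ n.1 0) :
    pairNum j (up j n) = pairNum j n + 2 := by
  rw [pairNum, pairNum, up_val h, pairUp_self hj, pairUp_neg hj]
  omega

theorem pairNum_down (hj : j ≠ 0) {n : Conf d N} (h1 : 1 ≤ n.1 j) (h2 : 1 ≤ n.1 (-j)) :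
    pairNum j (down j n) + 2 = pairNum j n := by
  rw [pairNum, pairNum, down_val hj h1 h2, pairDown_self hj, pairDown_neg hj]
  omega

theorem zero_add_pairNum_le (hj : j ≠ 0) (n : Conf d N) : n.1 0 + pairNum j n ≤ N := by
  have := three_modes_le hj n.1
  rw [n.2] at this
  rw [pairNum]
  omega

/-- The flow at the energy `z` is well defined if its diagonal matrix elements dominate the kinetic
energy of the modes other than `±j` and a positive constant. -/
def FlowPos (N : ℕ) (L φ : ℝ) (j : Mode d) (z : ℝ) : Prop :=
  ∃ δ : ℝ, 0 < δ ∧ ∀ n : Conf d N, 1 ≤ pairNum j n → restKin L j n.1 + δ ≤ flowDiag L φ j z n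

theorem FlowPos.pos (h : FlowPos N L φ j z) (hj : j ≠ 0) {n : Conf d N} (hn : 1 ≤ pairNum j n) :
    0 < flowDiag L φ j z n := by
  obtain ⟨δ, hδ, h⟩ := h
  have := h n hn
  have := restKin_nonneg hj L n.1
  linarith

/-- The operator `K^{(2t-2)}` is a truncated Jacobi matrix on each chain. -/
def IsTruncated (N : ℕ) (L φ : ℝ) (j : Mode d) (z : ℝ) (t : ℕ) : Prop :=
  ∀ (x : dom d N L) (n : Conf d N), kBog N L φ j z t x n =
    if pairNum j n + 2 * t ≤ N then
      ((if pairNum j n + 2 * t + 2 ≤ N then diagH j L φ n - z else flowDiag L φ j z n : ℝ) : ℂ) *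
        x.1 n + (bDown j φ n : ℂ) * x.1 (down j n) +
        (if pairNum j n + 2 * t + 2 ≤ N then (bUp j φ n : ℂ) * x.1 (up j n) else 0)
    else 0

theorem isTruncated_zero (hj : j ≠ 0) : IsTruncated N L φ j z 0 := by
  intro x n
  have h0 := zero_add_pairNum_le hj n
  have h1 : kBog N L φ j z 0 x n = hBog N L φ j x n - (z : ℂ) * x.1 n := rfl
  rw [h1, hBog_apply hj, if_pos (by omega)]
  by_cases h2 : pairNum j n + 2 * 0 + 2 ≤ N
  · rw [if_pos h2, if_pos h2]
    push_cast
    ring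
  · rw [if_neg h2, if_neg h2, flowDiag_eq hj, bUp_eq_zero (by omega)]
    push_cast
    ring

/-- A bond changes the pair number by 2, while a shell contains two consecutive values. Hence no
bond joins two states of a shell and the block is diagonal. -/
theorem exists_isInverseOn_of_isTruncated (hj : j ≠ 0) (hz : FlowPos N L φ j z) {t : ℕ}
    (ht : 2 * t + 2 ≤ N) (hK : IsTruncated N L φ j z t) :
    ∃ R, IsInverseOn (shell j (2 * t)) (kBog N L φ j z t) R ∧
      ∀ y n, (R y).1 n =
        (shell j (2 * t)).indicator (fun n => y n / (flowDiag L φ j z n : ℂ)) n := by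
  obtain ⟨δ, hδ, hz⟩ := hz
  have hp : ∀ n ∈ (shell j (2 * t) : Set (Conf d N)), 1 ≤ pairNum j n := by
    intro n hn
    rcases hn with hn | hn <;> omega
  -- The modes ±j contribute at most N k_j² to the kinetic energy, which is at most N k_j²/δ times
  -- the diagonal entry, since that entry is at least δ.
  refine exists_isInverseOn_of_diagonal (δ := δ) (C := 1 + N * kSq L j / δ) hδ
    (fun n hn => ?_) (fun n hn => ?_) fun x hx n hn => ?_
  · have := hz n (hp n hn)
    have := restKin_nonneg hj L n.1
    linarith
  · have h1 := hz n (hp n hn)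
    have h2 := restKin_nonneg hj L n.1
    have h3 : kinEnergy L n.1 = restKin L j n.1 + pairNum j n * kSq L j := by
      rw [restKin, pairNum]; push_cast; ring
    have h4 : (pairNum j n : ℝ) * kSq L j ≤ N * kSq L j := by
      have := zero_add_pairNum_le hj n
      have := kSq_nonneg L j
      gcongr
      omega
    have h5 : N * kSq L j ≤ N * kSq L j / δ * flowDiag L φ j z n := by
      rw [div_mul_eq_mul_div, le_div_iff₀ hδ]
      have := kSq_nonneg L j
      gcongr
      linarith
    linarith
  · have h1 : pairNum j n + 2 * t ≤ N := by rcases hn with hn | hn <;> omega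
    have h2 : ¬ pairNum j n + 2 * t + 2 ≤ N := by rcases hn with hn | hn <;> omega
    rw [hK, if_pos h1, if_neg h2, if_neg h2, add_zero]
    by_cases hb : 1 ≤ n.1 j ∧ 1 ≤ n.1 (-j)
    · have h3 : down j n ∉ (shell j (2 * t) : Set (Conf d N)) := by
        have := pairNum_down hj hb.1 hb.2
        simp only [shell, Set.mem_ofPred_eq]
        rcases hn with hn | hn <;> omega
      rw [← hx, maskDom_apply _ _ (down j n), Set.indicator_of_notMem h3, mul_zero, add_zero]
    · rw [bDown_eq_zero hb]
      simp

/-- Gaussian elimination of a shell. The correction acts only on states whose upper neighbour lies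
in the shell: it subtracts b²/G from their diagonal entry, and the projection cuts the bond. -/
theorem IsTruncated.succ (hj : j ≠ 0) (hz : FlowPos N L φ j z) {t : ℕ}
    (ht : 2 * t + 2 ≤ N) (hK : IsTruncated N L φ j z t) : IsTruncated N L φ j z (t + 1) := by
  obtain ⟨R, hR, hRa⟩ := exists_isInverseOn_of_isTruncated hj hz ht hK
  intro x n
  set S : Set (Conf d N) := below j (2 * t) with hS
  set T : Set (Conf d N) := shell j (2 * t) with hT
  have hmS : ∀ m : Conf d N, m ∈ S ↔ pairNum j m + 2 * t + 2 ≤ N := fun m => by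
    simp only [hS, below, Set.mem_ofPred_eq]; omega
  have hmT : ∀ m : Conf d N, m ∈ T ↔ (pairNum j m + 2 * t ≤ N ∧ ¬ pairNum j m + 2 * t + 2 ≤ N) :=
    fun m => by
    simp only [hT, shell, Set.mem_ofPred_eq]; omega
  set y : dom d N L := maskDom L S x with hy
  set v : dom d N L := maskDom L T (R (maskOp T (kBog N L φ j z t y))) with hv
  have h0 : kBog N L φ j z (t + 1) x n =
      S.indicator (fun n => kBog N L φ j z t y n) n -
        S.indicator (fun n => kBog N L φ j z t v n) n := by
    have : kBog N L φ j z (t + 1) x = maskOp S (kBog N L φ j z t y) - maskOp S (kBog N L φ j z t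
        (maskDom L T (invOn T (kBog N L φ j z t) (maskOp T (kBog N L φ j z t y))))) := rfl
    rw [this, hR.invOn_eq]
    rfl
  rw [h0]
  by_cases hn : n ∈ S
  swap
  · rw [Set.indicator_of_notMem hn, Set.indicator_of_notMem hn, sub_zero, if_neg]
    rw [hmS] at hn
    omega
  have hn' := (hmS n).1 hn
  have hyS : ∀ m ∈ S, y.1 m = x.1 m := fun m hm => by
    rw [hy, maskDom_apply, Set.indicator_of_mem hm]
  have hyN : ∀ m, m ∉ S → y.1 m = 0 := fun m hm => by
    rw [hy, maskDom_apply, Set.indicator_of_notMem hm]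
  have hvN : ∀ m, m ∉ T → v.1 m = 0 := fun m hm => by
    rw [hv, maskDom_apply, Set.indicator_of_notMem hm]
  have hdS : 1 ≤ n.1 j ∧ 1 ≤ n.1 (-j) → down j n ∈ S := fun hb => by
    have := pairNum_down hj hb.1 hb.2
    rw [hmS]
    omega
  -- `y` vanishes on the shell, so only the bond from below feeds the inverse.
  have hvT : ∀ m ∈ T, v.1 m = (bDown j φ m : ℂ) * x.1 (down j m) / (flowDiag L φ j z m : ℂ) := by
    intro m hm
    have hm' := (hmT m).1 hm
    rw [hv, maskDom_apply, Set.indicator_of_mem hm, hRa, Set.indicator_of_mem hm, maskOp_apply,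
      Set.indicator_of_mem hm, hK, if_pos hm'.1, if_neg hm'.2, if_neg hm'.2,
      hyN m (fun h => hm'.2 ((hmS m).1 h))]
    by_cases hb : 1 ≤ m.1 j ∧ 1 ≤ m.1 (-j)
    · have := pairNum_down hj hb.1 hb.2
      rw [hyS (down j m) ((hmS _).2 (by omega))]
      simp
    · rw [bDown_eq_zero hb]
      simp
  have hnT : n ∉ T := fun h => ((hmT n).1 h).2 hn'
  have e1 : (bDown j φ n : ℂ) * y.1 (down j n) = (bDown j φ n : ℂ) * x.1 (down j n) := by
    by_cases hb : 1 ≤ n.1 j ∧ 1 ≤ n.1 (-j)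
    · rw [hyS _ (hdS hb)]
    · rw [bDown_eq_zero hb]; simp
  have e2 : (bDown j φ n : ℂ) * v.1 (down j n) = 0 := by
    by_cases hb : 1 ≤ n.1 j ∧ 1 ≤ n.1 (-j)
    · rw [hvN _ (fun h => ((hmT _).1 h).2 ((hmS _).1 (hdS hb))), mul_zero]
    · rw [bDown_eq_zero hb]; simp
  rw [Set.indicator_of_mem hn, Set.indicator_of_mem hn, hK, hK, if_pos (by omega), if_pos hn',
    if_pos hn', if_pos (by omega), if_pos hn', hyS n hn, hvN n hnT, e1, e2,
    if_pos (by omega : pairNum j n + 2 * (t + 1) ≤ N)]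
  by_cases hu : 2 ≤ n.1 0
  · have hpu := pairNum_up hj hu
    by_cases h3 : pairNum j n + 2 * (t + 1) + 2 ≤ N
    · have h4 : up j n ∈ S := (hmS _).2 (by omega)
      rw [if_pos h3, if_pos h3, hyS _ h4, hvN _ (fun h => ((hmT _).1 h).2 ((hmS _).1 h4))]
      simp
    · have h4 : up j n ∈ T := (hmT _).2 (by omega)
      rw [if_neg h3, if_neg h3, hyN _ (fun h => ((hmT _).1 h4).2 ((hmS _).1 h)), hvT _ h4,
        down_up hj hu, bDown_up hj hu, flowDiag_eq hj n]
      push_cast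
      ring
  · have := zero_add_pairNum_le hj n
    rw [bUp_eq_zero hu]
    by_cases h3 : pairNum j n + 2 * (t + 1) + 2 ≤ N
    · rw [if_pos h3, if_pos h3]
      simp
    · rw [if_neg h3, if_neg h3, flowDiag_eq hj n, bUp_eq_zero hu]
      simp

theorem isTruncated (hj : j ≠ 0) (hz : FlowPos N L φ j z) {t : ℕ} (ht : 2 * t ≤ N) :
    IsTruncated N L φ j z t := by
  induction t with
  | zero => exact isTruncated_zero hj
  | succ t ih => exact (ih (by omega)).succ hj hz (by omega)

theorem stepInvertible (hj : j ≠ 0) (hz : FlowPos N L φ j z) {t : ℕ} (ht : 2 * t + 2 ≤ N) :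
    StepInvertible N L φ j z t :=
  let ⟨R, hR, _⟩ := exists_isInverseOn_of_isTruncated hj hz ht (isTruncated hj hz (by omega))
  ⟨R, hR⟩

theorem stepInv_apply (hj : j ≠ 0) (hz : FlowPos N L φ j z) {t : ℕ} (ht : 2 * t + 2 ≤ N)
    (y : Fock d N) (n : Conf d N) : (stepInv N L φ j z t y).1 n =
      (shell j (2 * t)).indicator (fun n => y n / (flowDiag L φ j z n : ℂ)) n := by
  obtain ⟨R, hR, hRa⟩ :=
    exists_isInverseOn_of_isTruncated hj hz ht (isTruncated hj hz (by omega))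
  rw [stepInv, hR.invOn_eq, hRa]

theorem flowPos {ε e s : ℝ} (h : SmallCoupling ε e s) (hN : 0 < N) (hφ : 0 < φ)
    (hκ : kSq L j = φ * ε) (hj : j ≠ 0) (hz : z ≤ -(φ * (1 + ε - e)) + φ * (e * s)) :
    FlowPos N L φ j z := by
  have hN' : (0 : ℝ) < N := by exact_mod_cast hN
  refine ⟨φ / (4 * N), by positivity, fun n hn => ?_⟩
  refine chainFrac_ge_const h hN' hφ hκ (restKin_nonneg hj L n.1) hz _ _ _ hn ?_
  have := three_modes_le hj n.1
  rw [n.2] at this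
  exact_mod_cast this

end Flow

/-! ### Symmetry, quadratic form bounds and the spectrum -/

section Spectrum

variable {d N : ℕ} {j : Mode d} {L φ : ℝ}

/-- Sums over the bonds of the chains may be indexed by the lower or by the upper end. -/
theorem hasSum_up_iff {E : Type*} [AddCommMonoid E] [TopologicalSpace E] (hj : j ≠ 0)
    {f g : Conf d N → E} (hf : ∀ n, ¬ 2 ≤ n.1 0 → f n = 0)
    (hg : ∀ n, ¬ (1 ≤ n.1 j ∧ 1 ≤ n.1 (-j)) → g n = 0)
    (hfg : ∀ n : Conf d N, 2 ≤ n.1 0 → g (up j n) = f n) (a : E) : HasSum g a ↔ HasSum f a := by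
  have h2 : ∀ x : Function.support f, 2 ≤ x.1.1 0 := fun x => by
    by_contra h
    exact x.2 (hf _ h)
  refine hasSum_iff_hasSum_of_ne_zero_bij (fun x : Function.support f => up j x.1) ?_ ?_ ?_
  · intro x y hxy
    apply Subtype.ext
    rw [← down_up hj (h2 x), ← down_up hj (h2 y)]
    exact congrArg _ hxy
  · intro n hn
    have h3 : 1 ≤ n.1 j ∧ 1 ≤ n.1 (-j) := by
      by_contra h
      exact hn (hg _ h)
    have h4 : 2 ≤ (down j n).1 0 := by
      rw [down_val hj h3.1 h3.2, pairDown_zero hj]; omega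
    have h5 := hfg _ h4
    rw [up_down hj h3.1 h3.2] at h5
    exact ⟨⟨down j n, by rw [Function.mem_support, ← h5]; exact hn⟩, up_down hj h3.1 h3.2⟩
  · exact fun x => hfg _ (h2 x)

/-- The interaction. -/
def interaction (N : ℕ) (φ : ℝ) (j : Mode d) : Fock d N →ₗ[ℂ] Fock d N :=
  diagInt N φ j + W N φ j + Wstar N φ j

theorem hBog_eq (x : dom d N L) :
    hBog N L φ j x = kinetic d N L x + interaction N φ j x.1 := rfl

/-- Both sides are the same sum over bonds, indexed once by the lower and once by the upper end. -/
theorem inner_W_right (hj : j ≠ 0) (x y : Fock d N) :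
    inner ℂ x (W N φ j y) = inner ℂ (Wstar N φ j x) y := by
  have h1 := lp.hasSum_inner (𝕜 := ℂ) x (W N φ j y)
  have h2 := lp.hasSum_inner (𝕜 := ℂ) (Wstar N φ j x) y
  refine HasSum.unique h1 (((hasSum_up_iff hj ?_ ?_ ?_) _).1 h2)
  · intro n hn
    rw [W_apply hj, bUp_eq_zero hn]; simp
  · intro n hn
    rw [Wstar_apply hj, bDown_eq_zero hn]; simp
  · intro n hn
    rw [W_apply hj, Wstar_apply hj, down_up hj hn, bDown_up hj hn]
    simp only [RCLike.inner_apply, map_mul, Complex.conj_ofReal]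
    ring

theorem inner_interaction (hj : j ≠ 0) (x y : Fock d N) :
    inner ℂ x (interaction N φ j y) = inner ℂ (interaction N φ j x) y := by
  have h1 : inner ℂ x (diagInt N φ j y) = inner ℂ (diagInt N φ j x) y := by
    rw [lp.inner_eq_tsum, lp.inner_eq_tsum]
    refine tsum_congr fun n => ?_
    rw [diagInt_apply, diagInt_apply]
    simp only [RCLike.inner_apply, map_mul, Complex.conj_ofReal]
    ring
  have h2 := inner_W_right (φ := φ) hj x y
  have h3 := inner_W_right (φ := φ) hj y x
  have h4 : inner ℂ x (Wstar N φ j y) = inner ℂ (W N φ j x) y := by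
    rw [← inner_conj_symm, ← h3, inner_conj_symm]
  simp only [interaction, LinearMap.add_apply, inner_add_left, inner_add_right, h1, h2, h4]
  ring

theorem inner_kinetic (x y : dom d N L) :
    inner ℂ x.1 (kinetic d N L y) = inner ℂ (kinetic d N L x) y.1 := by
  rw [lp.inner_eq_tsum, lp.inner_eq_tsum]
  refine tsum_congr fun n => ?_
  change inner ℂ (x.1 n) ((kinEnergy L n.1 : ℂ) * y.1 n) =
    inner ℂ ((kinEnergy L n.1 : ℂ) * x.1 n) (y.1 n)
  simp only [RCLike.inner_apply, map_mul, Complex.conj_ofReal]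
  ring

theorem inner_hBog (hj : j ≠ 0) (x y : dom d N L) :
    inner ℂ x.1 (hBog N L φ j y) = inner ℂ (hBog N L φ j x) y.1 := by
  rw [hBog_eq, hBog_eq, inner_add_right, inner_add_left, inner_kinetic, inner_interaction hj]

theorem inner_hBog_self_im (hj : j ≠ 0) (x : dom d N L) :
    (inner ℂ x.1 (hBog N L φ j x)).im = 0 := by
  have h1 := inner_hBog (φ := φ) hj x x
  rw [← inner_conj_symm (hBog N L φ j x) x.1] at h1
  have := congrArg Complex.im h1
  simp only [Complex.conj_im] at this
  linarith

/-- The product states, as vectors in the domain. -/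
def basisVec (L : ℝ) (m : Conf d N) : dom d N L :=
  ⟨lp.single 2 m (1 : ℂ), by
    change Memℓp _ 2
    convert lp.memℓp (lp.single (E := fun _ : Conf d N => ℂ) 2 m (kinEnergy L m.1 : ℂ)) using 2
      with n
    by_cases h : n = m
    · subst h; simp
    · simp [h]⟩

theorem mem_dom_of_eq {x v : Fock d N} (h : ∀ n, (kinEnergy L n.1 : ℂ) * x n = v n) :
    x ∈ dom d N L := by
  change Memℓp _ 2
  convert lp.memℓp v using 2 with n
  exact h n

theorem tendsto_apply {u : ℕ → Fock d N} {x : Fock d N} (h : Tendsto u atTop (𝓝 x))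
    (n : Conf d N) : Tendsto (fun k => u k n) atTop (𝓝 (x n)) :=
  ((lp.evalCLM (𝕜 := ℂ) (fun _ : Conf d N => ℂ) 2 n).continuous.tendsto x).comp h

theorem interaction_apply (hj : j ≠ 0) (x : Fock d N) (n : Conf d N) : interaction N φ j x n =
    ((φ / N * ((n.1 0 : ℝ) * ((n.1 j : ℝ) + n.1 (-j))) : ℝ) : ℂ) * x n +
      (bUp j φ n : ℂ) * x (up j n) + (bDown j φ n : ℂ) * x (down j n) := by
  rw [← diagInt_apply, ← W_apply hj, ← Wstar_apply hj]
  rfl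

/-- `H - w` is invertible if it is bounded below and its adjoint is injective. -/
theorem invertibleOn_univ_of_bounded_below (hj : j ≠ 0) {w : ℂ} {c : ℝ} (hc : 0 < c)
    (hb : ∀ x : dom d N L, c * ‖x.1‖ ≤ ‖shiftBy (hBog N L φ j) w x‖)
    (hinj : ∀ x : dom d N L, hBog N L φ j x = (starRingEnd ℂ w) • x.1 → x = 0) :
    InvertibleOn Set.univ (shiftBy (hBog N L φ j) w) := by
  set B := shiftBy (hBog N L φ j) w with hB
  have hBx : ∀ x : dom d N L, B x = kinetic d N L x + interaction N φ j x.1 - w • x.1 :=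
    fun x => rfl
  have hinjB : Function.Injective B := by
    rw [← LinearMap.ker_eq_bot, LinearMap.ker_eq_bot']
    intro x hx
    have := hb x
    rw [hx, norm_zero] at this
    have h2 : ‖x.1‖ = 0 := by nlinarith [norm_nonneg x.1]
    exact Subtype.ext (norm_eq_zero.1 h2)
  -- The lower bound makes preimages of a convergent sequence Cauchy. The limit equation is checked
  -- coordinatewise, where the interaction involves three coefficients only, so its continuity is
  -- not needed.
  have hclosed : IsClosed (LinearMap.range B : Set (Fock d N)) := by
    refine IsSeqClosed.isClosed fun y y₀ hy hy₀ => ?_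
    choose x hx using hy
    have hcau : CauchySeq fun k => (x k).1 := by
      rw [Metric.cauchySeq_iff]
      intro δ hδ
      obtain ⟨K, hK⟩ := Metric.cauchySeq_iff.1 hy₀.cauchySeq (c * δ) (by positivity)
      refine ⟨K, fun k hk l hl => ?_⟩
      have h1 := hK k hk l hl
      have h2 := hb (x k - x l)
      rw [map_sub, hx, hx] at h2
      rw [dist_eq_norm] at h1 ⊢
      have h3 : c * ‖(x k).1 - (x l).1‖ < c * δ := lt_of_le_of_lt h2 h1
      exact lt_of_mul_lt_mul_left h3 hc.le
    obtain ⟨x₀, hx₀⟩ := cauchySeq_tendsto_of_complete hcau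
    have hkin : ∀ n, (kinEnergy L n.1 : ℂ) * x₀ n =
        (y₀ + w • x₀ - interaction N φ j x₀ : Fock d N) n := by
      intro n
      have h1 : Tendsto (fun k => (kinEnergy L n.1 : ℂ) * (x k).1 n) atTop
          (𝓝 ((kinEnergy L n.1 : ℂ) * x₀ n)) := (tendsto_apply hx₀ n).const_mul _
      have h2 : Tendsto (fun k => y k n + w * (x k).1 n - interaction N φ j (x k).1 n) atTop
          (𝓝 (y₀ n + w * x₀ n - interaction N φ j x₀ n)) := by
        simp only [interaction_apply hj]
        exact ((tendsto_apply hy₀ n).add ((tendsto_apply hx₀ n).const_mul _)).sub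
          ((((tendsto_apply hx₀ n).const_mul _).add ((tendsto_apply hx₀ _).const_mul _)).add
            ((tendsto_apply hx₀ _).const_mul _))
      refine tendsto_nhds_unique h1 (h2.congr fun k => ?_)
      rw [← hx k, hBx]
      change (kinEnergy L n.1 : ℂ) * (x k).1 n + interaction N φ j (x k).1 n - w * (x k).1 n +
        w * (x k).1 n - interaction N φ j (x k).1 n = _
      ring
    refine ⟨⟨x₀, mem_dom_of_eq hkin⟩, ?_⟩
    rw [hBx]
    ext n
    change (kinEnergy L n.1 : ℂ) * x₀ n + interaction N φ j x₀ n - w * x₀ n = y₀ n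
    rw [hkin]
    change y₀ n + w * x₀ n - interaction N φ j x₀ n + interaction N φ j x₀ n - w * x₀ n = y₀ n
    ring
  -- Pairing y with the images of product states gives the adjoint eigenvalue equation coordinate by
  -- coordinate. It also places y in the domain, so `hinj` applies.
  have horth : (LinearMap.range B)ᗮ = ⊥ := by
    rw [Submodule.eq_bot_iff]
    intro y hy
    rw [Submodule.mem_orthogonal] at hy
    have hkin : ∀ n, (kinEnergy L n.1 : ℂ) * y n =
        ((starRingEnd ℂ w) • y - interaction N φ j y : Fock d N) n := by
      intro n
      have h1 := hy (B (basisVec L n)) ⟨_, rfl⟩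
      have h2 : kinetic d N L (basisVec L n) =
          lp.single 2 n (kinEnergy L n.1 : ℂ) := by
        ext m
        change (kinEnergy L m.1 : ℂ) * lp.single (E := fun _ : Conf d N => ℂ) 2 n (1 : ℂ) m = _
        by_cases h : m = n
        · subst h; simp
        · simp [h]
      rw [hBx, inner_sub_left, inner_add_left, ← inner_interaction hj, h2, inner_smul_left] at h1
      simp only [basisVec, lp.inner_single_left, RCLike.inner_apply, Complex.conj_ofReal,
        map_one, mul_one] at h1
      change _ = (starRingEnd ℂ w) * y n - interaction N φ j y n
      linear_combination h1
    have h3 := hinj ⟨y, mem_dom_of_eq hkin⟩ (by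
      rw [hBog_eq]
      ext n
      change (kinEnergy L n.1 : ℂ) * y n + interaction N φ j y n = (starRingEnd ℂ w) * y n
      rw [hkin]
      change (starRingEnd ℂ w) * y n - interaction N φ j y n + interaction N φ j y n = _
      ring)
    exact congrArg Subtype.val h3
  have hsurj : Function.Surjective B := by
    rw [← LinearMap.range_eq_top]
    have : CompleteSpace (LinearMap.range B) := hclosed.completeSpace_coe
    exact (Submodule.orthogonal_eq_bot_iff).1 horth
  let Q := LinearEquiv.ofBijective B ⟨hinjB, hsurj⟩
  have hBQ : ∀ y, B (Q.symm y) = y := fun y => Q.apply_symm_apply y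
  have hmask : ∀ y : Fock d N, maskOp Set.univ y = y := fun y => by
    ext n; rw [maskOp_apply]; simp
  have hmaskD : ∀ y : dom d N L, maskDom L Set.univ y = y := fun y => Subtype.ext (hmask y.1)
  refine ⟨Q.symm.toLinearMap, ⟨c⁻¹, fun y => ?_⟩, fun y => hmaskD _, fun y => ?_, fun x _ => ?_⟩
  · have := hb (Q.symm y)
    rw [hBQ] at this
    rw [← div_eq_inv_mul, le_div_iff₀ hc, mul_comm]
    exact this
  · rw [hmask, hmask]
    exact hBQ y
  · rw [hmask]
    exact Q.symm_apply_apply x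

/-- A quadratic form bound from a positive weight `u` on the product states. -/
theorem le_inner_hBog (hj : j ≠ 0) {r : ℝ} {u : Conf d N → ℝ} (hu : ∀ n, 0 ≤ u n)
    (hu' : ∀ n, bDown j φ n ≠ 0 → 0 < u n) (x : dom d N L)
    (hx : ∀ n, x.1 n ≠ 0 → u n + bUp j φ n ^ 2 / u (up j n) ≤ diagH j L φ n - r) :
    r * ‖x.1‖ ^ 2 ≤ (inner ℂ x.1 (hBog N L φ j x)).re := by
  have hre : ∀ {f : Conf d N → ℂ} {a : ℂ}, HasSum f a → HasSum (fun n => (f n).re) a.re :=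
    fun h => Complex.hasSum_re h
  have hnorm : HasSum (fun n => ‖x.1 n‖ ^ 2) (‖x.1‖ ^ 2) := by
    have h1 := hre (lp.hasSum_inner (𝕜 := ℂ) x.1 x.1)
    rw [inner_self_eq_norm_sq_to_K] at h1
    convert h1 using 1
    · funext n
      rw [inner_self_eq_norm_sq_to_K]
      simp [← Complex.ofReal_pow]
    · simp [← Complex.ofReal_pow]
  have hdn := hre (lp.hasSum_inner (𝕜 := ℂ) x.1 (Wstar N φ j x.1))
  have hupw := hre (lp.hasSum_inner (𝕜 := ℂ) x.1 (W N φ j x.1))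
  have hsame : (inner ℂ x.1 (W N φ j x.1)).re = (inner ℂ x.1 (Wstar N φ j x.1)).re := by
    rw [inner_W_right hj, ← inner_conj_symm, Complex.conj_re]
  have hdiag : HasSum (fun n => diagH j L φ n * ‖x.1 n‖ ^ 2)
      ((inner ℂ x.1 (hBog N L φ j x)).re - 2 * (inner ℂ x.1 (Wstar N φ j x.1)).re) := by
    have h1 := ((hre (lp.hasSum_inner (𝕜 := ℂ) x.1 (hBog N L φ j x))).sub hdn).sub hupw
    rw [hsame] at h1
    have h2 : (fun n => diagH j L φ n * ‖x.1 n‖ ^ 2) = fun n =>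
        (inner ℂ (x.1 n) (hBog N L φ j x n)).re - (inner ℂ (x.1 n) (Wstar N φ j x.1 n)).re -
          (inner ℂ (x.1 n) (W N φ j x.1 n)).re := by
      funext n
      rw [hBog_apply hj, W_apply hj, Wstar_apply hj]
      simp only [RCLike.inner_apply, ← Complex.sub_re]
      have : ‖x.1 n‖ ^ 2 = (x.1 n * (starRingEnd ℂ) (x.1 n)).re := by
        rw [Complex.mul_conj, Complex.normSq_eq_norm_sq, Complex.ofReal_re]
      rw [this, ← Complex.re_ofReal_mul]
      congr 1
      ring
    rw [h2, two_mul, ← sub_sub]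
    exact h1
  have hf := hdiag.sub (hnorm.mul_left r)
  have hp0 : ∀ n, 0 ≤ u n * ‖x.1 n‖ ^ 2 := fun n => mul_nonneg (hu n) (by positivity)
  have hq0 : ∀ n, 0 ≤ bUp j φ n ^ 2 / u (up j n) * ‖x.1 n‖ ^ 2 := fun n =>
    mul_nonneg (div_nonneg (sq_nonneg _) (hu _)) (by positivity)
  -- Nothing is asked of the weight where x vanishes, so the supersolution inequality may fail at η.
  have hpq : ∀ n, u n * ‖x.1 n‖ ^ 2 + bUp j φ n ^ 2 / u (up j n) * ‖x.1 n‖ ^ 2 ≤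
      diagH j L φ n * ‖x.1 n‖ ^ 2 - r * ‖x.1 n‖ ^ 2 := by
    intro n
    by_cases hn : x.1 n = 0
    · simp [hn]
    · rw [← add_mul, ← sub_mul]
      exact mul_le_mul_of_nonneg_right (hx n hn) (by positivity)
  have hp : Summable fun n => u n * ‖x.1 n‖ ^ 2 :=
    Summable.of_nonneg_of_le hp0 (fun n => by linarith [hpq n, hq0 n]) hf.summable
  have hq : Summable fun n => bUp j φ n ^ 2 / u (up j n) * ‖x.1 n‖ ^ 2 :=
    Summable.of_nonneg_of_le hq0 (fun n => by linarith [hpq n, hp0 n]) hf.summable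
  have hle1 := hasSum_le hpq (hp.hasSum.add hq.hasSum) hf
  -- The upper half of each bond is moved to its upper end, where the square is completed.
  have hq' : HasSum (fun n => bDown j φ n ^ 2 / u n * ‖x.1 (down j n)‖ ^ 2)
      (∑' n, bUp j φ n ^ 2 / u (up j n) * ‖x.1 n‖ ^ 2) := by
    refine ((hasSum_up_iff hj ?_ ?_ ?_) _).2 hq.hasSum
    · intro n hn; rw [bUp_eq_zero hn]; simp
    · intro n hn; rw [bDown_eq_zero hn]; simp
    · intro n hn; rw [bDown_up hj hn, down_up hj hn]
  -- Bond by bond, 2|b x(n) x(down n)| ≤ u|x(n)|² + (b²/u)|x(down n)|².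
  have hle2 := hasSum_le (f := fun n => -2 * (inner ℂ (x.1 n) (Wstar N φ j x.1 n)).re)
    (g := fun n => u n * ‖x.1 n‖ ^ 2 + bDown j φ n ^ 2 / u n * ‖x.1 (down j n)‖ ^ 2)
    (fun n => ?_) (hdn.mul_left (-2)) (hp.hasSum.add hq')
  · linarith
  · rw [Wstar_apply hj]
    by_cases hb : bDown j φ n = 0
    · simp only [hb, Complex.ofReal_zero, zero_mul, inner_zero_right, Complex.zero_re, mul_zero]
      have := hp0 n
      simpa using this
    · have hun := hu' n hb
      have h1 : |(inner ℂ (x.1 n) ((bDown j φ n : ℂ) * x.1 (down j n))).re| ≤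
          |bDown j φ n| * (‖x.1 n‖ * ‖x.1 (down j n)‖) := by
        refine (Complex.abs_re_le_norm _).trans ((norm_inner_le_norm _ _).trans (le_of_eq ?_))
        rw [norm_mul, Complex.norm_real, Real.norm_eq_abs]
        ring
      have h2 : 2 * (|bDown j φ n| * (‖x.1 n‖ * ‖x.1 (down j n)‖)) ≤
          u n * ‖x.1 n‖ ^ 2 + bDown j φ n ^ 2 / u n * ‖x.1 (down j n)‖ ^ 2 := by
        have h3 : u n * ‖x.1 n‖ ^ 2 + bDown j φ n ^ 2 / u n * ‖x.1 (down j n)‖ ^ 2 -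
            2 * (|bDown j φ n| * (‖x.1 n‖ * ‖x.1 (down j n)‖)) =
            (u n * ‖x.1 n‖ - |bDown j φ n| * ‖x.1 (down j n)‖) ^ 2 / u n := by
          rw [← sq_abs (bDown j φ n)]
          field_simp
          ring
        have h4 : 0 ≤ (u n * ‖x.1 n‖ - |bDown j φ n| * ‖x.1 (down j n)‖) ^ 2 / u n := by
          positivity
        linarith
      have h5 := neg_abs_le ((inner ℂ (x.1 n) ((bDown j φ n : ℂ) * x.1 (down j n))).re)
      linarith

end Spectrum

/-! ### The ground state vector -/

section GroundState

variable {d N : ℕ} {j : Mode d} {L φ z : ℝ}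

theorem basisVec_apply (m n : Conf d N) [Decidable (n = m)] :
    (basisVec L m).1 n = if n = m then 1 else 0 := by
  change lp.single (E := fun _ : Conf d N => ℂ) 2 m (1 : ℂ) n = _
  split_ifs with h
  · subst h; simp
  · simp [h]

theorem norm_basisVec (m : Conf d N) : ‖(basisVec L m).1‖ = 1 := by
  change ‖lp.single (E := fun _ : Conf d N => ℂ) 2 m (1 : ℂ)‖ = 1
  rw [lp.norm_single (by norm_num)]
  simp

theorem Wstar_basisVec (hj : j ≠ 0) (m : Conf d N) :
    Wstar N φ j (basisVec L m).1 = (bUp j φ m : ℂ) • (basisVec L (up j m)).1 := by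
  classical
  ext n
  rw [Wstar_apply hj, basisVec_apply]
  change _ = (bUp j φ m : ℂ) * (basisVec L (up j m)).1 n
  rw [basisVec_apply]
  by_cases hn : 1 ≤ n.1 j ∧ 1 ≤ n.1 (-j)
  · by_cases h : down j n = m
    · subst h
      rw [up_down hj hn.1 hn.2, bUp_down hj hn.1 hn.2]
      simp
    · rw [if_neg h]
      by_cases h2 : n = up j m
      · subst h2
        have : ¬ 2 ≤ m.1 0 := fun h3 => h (down_up hj h3)
        simp [bUp_eq_zero this]
      · simp [h2]
  · rw [bDown_eq_zero hn]
    by_cases h2 : n = up j m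
    · subst h2
      have : ¬ 2 ≤ m.1 0 := fun h3 => hn (by
        rw [up_val h3, pairUp_self hj, pairUp_neg hj]; omega)
      simp [bUp_eq_zero this]
    · simp [h2]

theorem W_basisVec (hj : j ≠ 0) (m : Conf d N) :
    W N φ j (basisVec L m).1 = (bDown j φ m : ℂ) • (basisVec L (down j m)).1 := by
  classical
  ext n
  rw [W_apply hj, basisVec_apply]
  change _ = (bDown j φ m : ℂ) * (basisVec L (down j m)).1 n
  rw [basisVec_apply]
  by_cases hn : 2 ≤ n.1 0
  · by_cases h : up j n = m
    · subst h
      rw [down_up hj hn, bDown_up hj hn]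
      simp
    · rw [if_neg h]
      by_cases h2 : n = down j m
      · subst h2
        have : ¬ (1 ≤ m.1 j ∧ 1 ≤ m.1 (-j)) := fun h3 => h (up_down hj h3.1 h3.2)
        simp [bDown_eq_zero this]
      · simp [h2]
  · rw [bUp_eq_zero hn]
    by_cases h2 : n = down j m
    · subst h2
      have : ¬ (1 ≤ m.1 j ∧ 1 ≤ m.1 (-j)) := fun h3 => hn (by
        rw [down_val hj h3.1 h3.2, pairDown_zero hj]; omega)
      simp [bDown_eq_zero this]
    · simp [h2]

theorem hBog_basisVec (hj : j ≠ 0) (m : Conf d N) : hBog N L φ j (basisVec L m) =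
    (diagH j L φ m : ℂ) • (basisVec L m).1 + (bUp j φ m : ℂ) • (basisVec L (up j m)).1 +
      (bDown j φ m : ℂ) • (basisVec L (down j m)).1 := by
  classical
  rw [← Wstar_basisVec hj, ← W_basisVec hj]
  ext n
  rw [hBog_apply hj]
  change _ = (diagH j L φ m : ℂ) * (basisVec L m).1 n + Wstar N φ j (basisVec L m).1 n +
    W N φ j (basisVec L m).1 n
  rw [W_apply hj, Wstar_apply hj, basisVec_apply]
  by_cases h : n = m
  · subst h; rfl
  · simp [h]

theorem maskOp_basisVec {S : Set (Conf d N)} {m : Conf d N} (hm : m ∈ S) :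
    maskOp S (basisVec L m).1 = (basisVec L m).1 := by
  classical
  ext n
  rw [maskOp_apply]
  by_cases hn : n ∈ S
  · rw [Set.indicator_of_mem hn]
  · rw [Set.indicator_of_notMem hn, basisVec_apply, if_neg]
    rintro rfl
    exact hn hm

theorem stepInv_basisVec (hj : j ≠ 0) (hz : FlowPos N L φ j z) {t : ℕ} (ht : 2 * t + 2 ≤ N)
    {m : Conf d N} (hm : m ∈ (shell j (2 * t) : Set (Conf d N))) :
    stepInv N L φ j z t (basisVec L m).1 =
      ((flowDiag L φ j z m)⁻¹ : ℂ) • basisVec L m := by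
  classical
  ext n
  rw [stepInv_apply hj hz ht]
  change _ = ((flowDiag L φ j z m)⁻¹ : ℂ) * (basisVec L m).1 n
  by_cases h : n = m
  · subst h
    rw [Set.indicator_of_mem hm, div_eq_inv_mul]
  · rw [basisVec_apply, if_neg h, mul_zero]
    by_cases hn : n ∈ (shell j (2 * t) : Set (Conf d N))
    · rw [Set.indicator_of_mem hn, basisVec_apply, if_neg h, zero_div]
    · rw [Set.indicator_of_notMem hn]

/-- The product state with `m` pairs in the modes `±j` and all other particles in the zero mode. -/
def pairConf (N : ℕ) (j : Mode d) (m : ℕ) : Conf d N :=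
  (up j)^[m] ⟨Finsupp.single 0 N, by simp⟩

theorem pairConf_zero : pairConf N j 0 = ⟨Finsupp.single 0 N, by simp⟩ := rfl

theorem pairConf_succ (m : ℕ) : pairConf N j (m + 1) = up j (pairConf N j m) :=
  Function.iterate_succ_apply' _ _ _

theorem eta_eq : eta d N L = basisVec L (pairConf N j 0) := rfl

theorem pairConf_val (hj : j ≠ 0) {m : ℕ} (hm : 2 * m ≤ N) :
    (pairConf N j m).1 0 = N - 2 * m ∧ (pairConf N j m).1 j = m ∧ (pairConf N j m).1 (-j) = m ∧
      restKin L j (pairConf N j m).1 = 0 := by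
  induction m with
  | zero =>
    have h1 : -j ≠ 0 := neg_ne_zero.2 hj
    simp [pairConf_zero, restKin, kinEnergy_single_zero, hj]
  | succ m ih =>
    obtain ⟨h1, h2, h3, h4⟩ := ih (by omega)
    have h5 : 2 ≤ (pairConf N j m).1 0 := by omega
    rw [pairConf_succ, up_val h5, pairUp_zero hj, pairUp_self hj, pairUp_neg hj,
      restKin_pairUp hj L h5]
    refine ⟨by omega, by omega, by omega, h4⟩

theorem pairNum_pairConf (hj : j ≠ 0) {m : ℕ} (hm : 2 * m ≤ N) :
    pairNum j (pairConf N j m) = 2 * m := by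
  obtain ⟨_, h2, h3, _⟩ := pairConf_val (L := 0) hj hm
  rw [pairNum, h2, h3]; ring

theorem flowDiag_pairConf (hj : j ≠ 0) {m : ℕ} (hm : 2 * m ≤ N) :
    flowDiag L φ j z (pairConf N j m) = chainFrac N φ (kSq L j) 0 z (N - 2 * m) m m := by
  obtain ⟨h1, h2, h3, h4⟩ := pairConf_val (L := L) hj hm
  rw [flowDiag, h1, h2, h3, h4]

theorem diagH_pairConf_zero (hj : j ≠ 0) : diagH j L φ (pairConf N j 0) = 0 := by
  obtain ⟨h1, h2, h3, h4⟩ := pairConf_val (N := N) (L := L) (m := 0) hj (by simp)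
  rw [diagH_eq, h2, h3, h4]
  simp

theorem bDown_pairConf_succ (hj : j ≠ 0) {m : ℕ} (hm : 2 * (m + 1) ≤ N) :
    bDown j φ (pairConf N j (m + 1)) = bUp j φ (pairConf N j m) := by
  rw [pairConf_succ, bDown_up hj]
  have := (pairConf_val (N := N) (L := 0) (m := m) hj (by omega)).1
  omega

theorem down_pairConf_succ (hj : j ≠ 0) {m : ℕ} (hm : 2 * (m + 1) ≤ N) :
    down j (pairConf N j (m + 1)) = pairConf N j m := by
  rw [pairConf_succ, down_up hj]
  have := (pairConf_val (N := N) (L := 0) (m := m) hj (by omega)).1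
  omega

/-- The coefficients of the ground state vector. -/
def gsCoeff (N : ℕ) (L φ : ℝ) (j : Mode d) (z : ℝ) : ℕ → ℝ
  | 0 => 1
  | m + 1 => -(bUp j φ (pairConf N j m) / flowDiag L φ j z (pairConf N j (m + 1))) *
      gsCoeff N L φ j z m

/-- Starting from η the expansion never leaves its chain: each factor -R W* moves one state up and
multiplies by -b/G. -/
theorem gsTerm_eq (hj : j ≠ 0) (hE : Even N) (hz : FlowPos N L φ j z) :
    ∀ m < N / 2, gsTerm N L φ j z m =
      ((-gsCoeff N L φ j z (m + 1) : ℝ) : ℂ) • basisVec L (pairConf N j (m + 1)) := by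
  obtain ⟨K, hK⟩ := hE
  intro m hm
  induction m with
  | zero =>
    have h1 : pairConf N j (0 + 1) ∈ (shell j (N - 2) : Set (Conf d N)) := by
      left; rw [pairNum_pairConf hj (by omega)]; omega
    have h2 : pairConf N j (0 + 1) ∈ (shell j (2 * (N / 2 - 1)) : Set (Conf d N)) := by
      left; rw [pairNum_pairConf hj (by omega)]; omega
    rw [gsTerm, eta_eq (j := j), Wstar_basisVec hj, ← pairConf_succ, map_smul, maskOp_basisVec h1,
      map_smul, stepInv_basisVec hj hz (by omega) h2, smul_smul, gsCoeff, gsCoeff]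
    congr 1
    push_cast
    ring
  | succ m ih =>
    have h0 : pairConf N j (m + 1) ∈ (shell j (N - 2 * (m + 2) + 2) : Set (Conf d N)) := by
      left; rw [pairNum_pairConf hj (by omega)]; omega
    have h1 : pairConf N j (m + 1 + 1) ∈ (shell j (N - 2 * (m + 2)) : Set (Conf d N)) := by
      left; rw [pairNum_pairConf hj (by omega)]; omega
    have h2 : pairConf N j (m + 1 + 1) ∈
        (shell j (2 * (N / 2 - (m + 2))) : Set (Conf d N)) := by
      left; rw [pairNum_pairConf hj (by omega)]; omega
    have h3 : (((-gsCoeff N L φ j z (m + 1) : ℝ) : ℂ) • basisVec L (pairConf N j (m + 1)) :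
        dom d N L).1 =
        ((-gsCoeff N L φ j z (m + 1) : ℝ) : ℂ) • (basisVec L (pairConf N j (m + 1))).1 := rfl
    rw [gsTerm, ih (by omega), h3, map_smul, maskOp_basisVec h0, map_smul, Wstar_basisVec hj,
      ← pairConf_succ]
    simp only [map_smul]
    rw [maskOp_basisVec h1, stepInv_basisVec hj hz (by omega) h2, smul_smul, smul_smul,
      ← neg_smul, show gsCoeff N L φ j z (m + 1 + 1) = -(bUp j φ (pairConf N j (m + 1)) /
        flowDiag L φ j z (pairConf N j (m + 1 + 1))) * gsCoeff N L φ j z (m + 1) from rfl]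
    congr 1
    push_cast
    ring

theorem gsVector_eq (hj : j ≠ 0) (hN : 0 < N) (hE : Even N) (hz : FlowPos N L φ j z) :
    gsVector N L φ j z = ∑ l ∈ Finset.range (N / 2 + 1),
      (gsCoeff N L φ j z l : ℂ) • basisVec L (pairConf N j l) := by
  have hN2 : 1 ≤ N / 2 := by obtain ⟨K, hK⟩ := hE; omega
  have h1 : ∑ l ∈ Finset.Icc 2 (N / 2), gsTerm N L φ j z (l - 1) =
      -∑ l ∈ Finset.Icc 2 (N / 2), (gsCoeff N L φ j z l : ℂ) • basisVec L (pairConf N j l) := by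
    rw [← Finset.sum_neg_distrib]
    refine Finset.sum_congr rfl fun l hl => ?_
    rw [Finset.mem_Icc] at hl
    rw [gsTerm_eq hj hE hz _ (by omega), show l - 1 + 1 = l by omega]
    simp
  have h2 : Finset.range (N / 2 + 1) = insert 0 (insert 1 (Finset.Icc 2 (N / 2))) := by
    ext l
    simp only [Finset.mem_range, Finset.mem_insert, Finset.mem_Icc]
    omega
  rw [gsVector, gsTerm_eq hj hE hz _ (by omega), h1, h2, Finset.sum_insert (by simp),
    Finset.sum_insert (by simp), eta_eq (j := j)]
  simp [gsCoeff]
  abel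

/-- The later terms live on states with at least one pair. This coefficient shows that the vector is
nonzero and lets multiples of it cancel the η component of other vectors. -/
theorem gsVector_apply_eta (hj : j ≠ 0) (hN : 0 < N) (hE : Even N) (hz : FlowPos N L φ j z) :
    (gsVector N L φ j z).1 (pairConf N j 0) = 1 := by
  classical
  have h0 : ∀ (x : dom d N L), x.1 (pairConf N j 0) =
      lp.evalₗ (𝕜 := ℂ) (fun _ : Conf d N => ℂ) 2 (pairConf N j 0) ((dom d N L).subtype x) :=
    fun _ => rfl
  rw [gsVector_eq hj hN hE hz, h0, map_sum, map_sum, Finset.sum_range_succ']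
  rw [Finset.sum_eq_zero]
  · simp only [map_smul, smul_eq_mul, ← h0]
    rw [basisVec_apply, if_pos rfl]
    simp [gsCoeff]
  · intro l hl
    rw [Finset.mem_range] at hl
    simp only [map_smul, smul_eq_mul, ← h0]
    rw [basisVec_apply, if_neg, mul_zero]
    intro h
    have h1 := pairNum_pairConf (N := N) (m := l + 1) hj (by omega)
    rw [← h, pairNum_pairConf hj (by omega)] at h1
    omega

/-- The diagonal entry at η is 0, so f is the last level -z - b²/G of the continued fraction. -/
theorem fixFun_eq (hj : j ≠ 0) (hN : 0 < N) (hE : Even N) (hz : FlowPos N L φ j z) :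
    fixFun N L φ j z = (flowDiag L φ j z (pairConf N j 0) : ℂ) := by
  obtain ⟨K, hK⟩ := hE
  have h2 : pairConf N j (0 + 1) ∈ (shell j (2 * (N / 2 - 1)) : Set (Conf d N)) := by
    left; rw [pairNum_pairConf hj (by omega)]; omega
  have h3 : ∀ (c : ℂ) (x : dom d N L), (c • x : dom d N L).1 = c • x.1 := fun _ _ => rfl
  rw [fixFun, eta_eq (j := j), Wstar_basisVec hj, ← pairConf_succ, map_smul,
    stepInv_basisVec hj hz (by omega) h2, h3, h3, map_smul, map_smul, W_basisVec hj,
    bDown_pairConf_succ hj (by omega), down_pairConf_succ hj (by omega),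
    flowDiag_eq hj (pairConf N j 0),
    ← pairConf_succ, diagH_pairConf_zero hj, inner_smul_right, inner_smul_right, inner_smul_right,
    inner_self_eq_norm_sq_to_K, norm_basisVec]
  push_cast
  ring

theorem hBog_gsVector (hj : j ≠ 0) (hN : 0 < N) (hE : Even N) (hz : FlowPos N L φ j z)
    (h0 : flowDiag L φ j z (pairConf N j 0) = 0) :
    hBog N L φ j (gsVector N L φ j z) = (z : ℂ) • (gsVector N L φ j z).1 := by
  -- Partial sums solve the eigenvalue equation up to errors at their last state and the next one.
  -- The zero of f starts the induction, each new term moves the error one state up, and it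
  -- disappears where the top bond vanishes.
  have key : ∀ k ≤ N / 2, hBog N L φ j (∑ l ∈ Finset.range (k + 1),
      (gsCoeff N L φ j z l : ℂ) • basisVec L (pairConf N j l)) =
      (z : ℂ) • (∑ l ∈ Finset.range (k + 1),
        (gsCoeff N L φ j z l : ℂ) • basisVec L (pairConf N j l) : dom d N L).1 +
      ((-(bUp j φ (pairConf N j k) * gsCoeff N L φ j z (k + 1)) : ℝ) : ℂ) •
        (basisVec L (pairConf N j k)).1 +
      ((gsCoeff N L φ j z k * bUp j φ (pairConf N j k) : ℝ) : ℂ) •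
        (basisVec L (pairConf N j (k + 1))).1 := by
    intro k
    have hs : ∀ (c : ℂ) (x : dom d N L), (c • x : dom d N L).1 = c • x.1 := fun _ _ => rfl
    have ha : ∀ (x y : dom d N L), (x + y : dom d N L).1 = x.1 + y.1 := fun _ _ => rfl
    induction k with
    | zero =>
      intro _
      have hbd : bDown j φ (pairConf N j 0) = 0 := by
        have := (pairConf_val (N := N) (L := L) (m := 0) hj (by omega)).2.1
        exact bDown_eq_zero (by omega)
      rw [flowDiag_eq hj, diagH_pairConf_zero hj, ← pairConf_succ] at h0
      rw [Finset.sum_range_one, map_smul, hBog_basisVec hj, hbd, diagH_pairConf_zero hj,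
        ← pairConf_succ, hs]
      simp only [gsCoeff]
      have hzz : (z : ℂ) = ((-(bUp j φ (pairConf N j 0) ^ 2 /
          flowDiag L φ j z (pairConf N j (0 + 1))) : ℝ) : ℂ) := by
        congr 1; linarith
      rw [hzz]
      push_cast
      module
    | succ k ih =>
      intro hk
      have hk2 : 2 * (k + 1) ≤ N := by omega
      have hg : flowDiag L φ j z (pairConf N j (k + 1)) ≠ 0 :=
        (hz.pos hj (by rw [pairNum_pairConf hj hk2]; omega)).ne'
      have hfe := flowDiag_eq (L := L) (φ := φ) (z := z) hj (pairConf N j (k + 1))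
      rw [← pairConf_succ] at hfe
      rw [Finset.sum_range_succ, map_add, ih (by omega), map_smul, hBog_basisVec hj,
        bDown_pairConf_succ hj hk2, down_pairConf_succ hj hk2,
        ← pairConf_succ, ha, hs]
      have hd : (diagH j L φ (pairConf N j (k + 1)) : ℂ) =
          ((flowDiag L φ j z (pairConf N j (k + 1)) + z + bUp j φ (pairConf N j (k + 1)) ^ 2 /
            flowDiag L φ j z (pairConf N j (k + 1 + 1)) : ℝ) : ℂ) := by
        congr 1; linarith
      have hc : ((gsCoeff N L φ j z k * bUp j φ (pairConf N j k) : ℝ) : ℂ) =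
          ((-(flowDiag L φ j z (pairConf N j (k + 1)) * gsCoeff N L φ j z (k + 1)) : ℝ) : ℂ) := by
        congr 1
        rw [gsCoeff]
        field_simp
      rw [hd, hc, show gsCoeff N L φ j z (k + 1 + 1) = -(bUp j φ (pairConf N j (k + 1)) /
        flowDiag L φ j z (pairConf N j (k + 1 + 1))) * gsCoeff N L φ j z (k + 1) from rfl]
      push_cast
      module
  have hb : bUp j φ (pairConf N j (N / 2)) = 0 := by
    have := (pairConf_val (N := N) (L := L) (m := N / 2) hj (by omega)).1
    exact bUp_eq_zero (by omega)
  have := key (N / 2) le_rfl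
  rw [← gsVector_eq hj hN hE hz, hb] at this
  simpa using this

/-- A bound on the coefficients of the ground state vector which depends only on `ε`. -/
def coeffBound (ε e : ℝ) (m : ℕ) : ℝ :=
  ∏ i ∈ Finset.range m, ratioBound ε e (2 * ((i : ℝ) + 1))

/-- Ratio test: the factors 1 + 2e/p tend to 1, so the ratios tend to 1 + ε - e < 1. -/
theorem summable_coeffBound {ε e s : ℝ} (h : SmallCoupling ε e s) :
    Summable fun m => coeffBound ε e (m + 1) := by
  have hpos : ∀ m, 0 < coeffBound ε e m := fun m =>
    Finset.prod_pos fun i _ => ratioBound_pos h (by positivity)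
  have hc : 1 + ε - e < 1 := by
    nlinarith [h.e_sq, h.eps_pos, h.e_pos]
  refine summable_of_ratio_test_tendsto_lt_one (l := 1 + ε - e) hc
    (Eventually.of_forall fun m => (hpos _).ne') ?_
  have h1 : ∀ m : ℕ, ‖coeffBound ε e (m + 1 + 1)‖ / ‖coeffBound ε e (m + 1)‖ =
      (1 + ε - e) * (1 + e * (1 / (((m + 1 : ℕ) : ℝ) + 1))) := by
    intro m
    have h2 := hpos (m + 1)
    rw [Real.norm_of_nonneg (hpos _).le, Real.norm_of_nonneg h2.le, div_eq_iff h2.ne',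
      show coeffBound ε e (m + 1 + 1) = coeffBound ε e (m + 1) *
        ratioBound ε e (2 * (((m + 1 : ℕ) : ℝ) + 1)) from Finset.prod_range_succ _ _, ratioBound]
    have : ((m + 1 : ℕ) : ℝ) + 1 ≠ 0 := by positivity
    field_simp
  simp only [h1]
  have h2 : Tendsto (fun m : ℕ => 1 / (((m + 1 : ℕ) : ℝ) + 1)) atTop (𝓝 0) :=
    (tendsto_add_atTop_iff_nat (f := fun m : ℕ => 1 / ((m : ℝ) + 1)) 1).2
      tendsto_one_div_add_atTop_nhds_zero_nat
  have h3 := ((h2.const_mul e).const_add 1).const_mul (1 + ε - e)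
  simpa using h3

/-- Each factor b/G is at most the supersolution ratio x, because b ≤ B and `chainFrac_ge` gives G ≥
B/x. -/
theorem abs_gsCoeff_le {ε e s : ℝ} (h : SmallCoupling ε e s) (hN : 0 < N) (hφ : 0 < φ)
    (hκ : kSq L j = φ * ε) (hj : j ≠ 0) (hz : z ≤ -(φ * (1 + ε - e)) + φ * (e * s)) :
    ∀ m, 2 * m ≤ N → |gsCoeff N L φ j z m| ≤ coeffBound ε e m := by
  have hN' : (0 : ℝ) < N := by exact_mod_cast hN
  intro m
  induction m with
  | zero => intro _; simp [gsCoeff, coeffBound]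
  | succ m ih =>
    intro hm
    have hpos := (flowPos h hN hφ hκ hj hz).pos hj (n := pairConf N j (m + 1))
      (by rw [pairNum_pairConf hj hm]; omega)
    rw [gsCoeff, abs_mul, abs_neg, abs_div, abs_of_pos hpos, abs_of_nonneg (bUp_nonneg hφ.le _),
      coeffBound, Finset.prod_range_succ, mul_comm]
    have hr := ratioBound_pos h (p := 2 * ((m : ℝ) + 1)) (by positivity)
    refine mul_le_mul (ih (by omega)) ?_ (div_nonneg (bUp_nonneg hφ.le _) hpos.le)
      (Finset.prod_nonneg fun i _ => (ratioBound_pos h (by positivity)).le)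
    obtain ⟨k, hk⟩ : ∃ k, N = 2 * (m + 1) + k := ⟨N - 2 * (m + 1), by omega⟩
    have h1 := chainFrac_ge h hN' hφ hκ le_rfl hz k (m + 1) (m + 1) (by omega)
      (by rw [hk]; push_cast; linarith)
    have h2 := flowDiag_pairConf (L := L) (φ := φ) (z := z) hj hm
    rw [show N - 2 * (m + 1) = k by omega] at h2
    rw [← h2] at h1
    have e1 : (((m + 1 : ℕ) : ℝ) + ((m + 1 : ℕ) : ℝ)) = 2 * ((m : ℝ) + 1) := by push_cast; ring
    rw [e1] at h1
    have h3 : bUp j φ (pairConf N j m) ≤ φ / N * (((k : ℝ) + 3 / 2) * (2 * ((m : ℝ) + 1) / 2)) := by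
      refine abs_le_of_sq_le_sq' ?_ (by positivity) |>.2
      obtain ⟨g1, g2, g3, _⟩ := pairConf_val (N := N) (L := L) (m := m) hj (by omega)
      rw [bUp_sq, g1, g2, g3, show N - 2 * m = k + 2 by omega]
      have := pair_weight_le (φ / N) k m m
      refine le_trans (le_of_eq ?_) (this.trans (le_of_eq ?_))
      · push_cast; ring
      · ring
    rw [div_le_iff₀ hpos]
    refine h3.trans ?_
    rw [zero_add, ← mul_div_assoc, div_le_iff₀ hr] at h1
    linarith

end GroundState

/-! ### The spectrum above a nondegenerate ground state -/

section Gap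

variable {d N : ℕ} {j : Mode d} {L φ z r : ℝ}

/-- An eigenvector which does not vanish at a product state `m`, together with a quadratic form
bound on the vectors which vanish at `m`, controls the form on the complement of the eigenvector. -/
theorem le_inner_hBog_of_orthogonal (hj : j ≠ 0) {m : Conf d N} {ψ : dom d N L}
    (hψ : hBog N L φ j ψ = (z : ℂ) • ψ.1) (hψm : ψ.1 m = 1) (hzr : z ≤ r)
    (hform : ∀ x : dom d N L, x.1 m = 0 → r * ‖x.1‖ ^ 2 ≤ (inner ℂ x.1 (hBog N L φ j x)).re)
    (y : dom d N L) (hy : inner ℂ ψ.1 y.1 = 0) :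
    r * ‖y.1‖ ^ 2 ≤ (inner ℂ y.1 (hBog N L φ j y)).re := by
  set a := y.1 m with ha
  have hy' : inner ℂ y.1 ψ.1 = 0 := by rw [← inner_conj_symm, hy, map_zero]
  have hval : (y - a • ψ : dom d N L).1 = y.1 - a • ψ.1 := rfl
  have h1 := hform (y - a • ψ) (by
    rw [hval]
    change y.1 m - a * ψ.1 m = 0
    rw [hψm, ha]
    ring)
  have hψy : inner ℂ ψ.1 (hBog N L φ j y) = 0 := by
    rw [inner_hBog hj, hψ, inner_smul_left, hy, mul_zero]
  -- Mixed terms vanish since y ⟂ ψ and ψ is an eigenvector. As z ≤ r, the ψ part can then be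
  -- subtracted from the form bound.
  have h2 : inner ℂ (y - a • ψ : dom d N L).1 (hBog N L φ j (y - a • ψ)) =
      inner ℂ y.1 (hBog N L φ j y) + ((z * (‖a‖ ^ 2 * ‖ψ.1‖ ^ 2) : ℝ) : ℂ) := by
    rw [hval, map_sub, map_smul, hψ]
    simp only [inner_sub_left, inner_sub_right, inner_smul_left, inner_smul_right, hψy, hy',
      inner_self_eq_norm_sq_to_K]
    have h3 : (starRingEnd ℂ) a * a = ((‖a‖ ^ 2 : ℝ) : ℂ) := by
      rw [mul_comm, Complex.mul_conj, Complex.normSq_eq_norm_sq]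
    push_cast at h3 ⊢
    linear_combination ((z : ℂ) * (‖ψ.1‖ : ℂ) ^ 2) * h3
  have h4 : ‖(y - a • ψ : dom d N L).1‖ ^ 2 = ‖y.1‖ ^ 2 + ‖a‖ ^ 2 * ‖ψ.1‖ ^ 2 := by
    rw [hval, sub_eq_add_neg, ← neg_smul, sq, norm_add_sq_eq_norm_sq_add_norm_sq_of_inner_eq_zero
      (𝕜 := ℂ) _ _ (by rw [inner_smul_right, hy', mul_zero]), norm_smul, norm_neg]
    ring
  rw [h2, h4, Complex.add_re, Complex.ofReal_re] at h1
  have h5 : z * (‖a‖ ^ 2 * ‖ψ.1‖ ^ 2) ≤ r * (‖a‖ ^ 2 * ‖ψ.1‖ ^ 2) := by gcongr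
  linarith

/-- By symmetry ⟨x, Hx⟩ is real, so the imaginary part of ⟨x, (H - w)x⟩ comes from w alone. -/
theorem norm_shiftBy_ge_of_im_ne_zero (hj : j ≠ 0) (w : ℂ) (x : dom d N L) :
    |w.im| * ‖x.1‖ ≤ ‖shiftBy (hBog N L φ j) w x‖ := by
  by_cases hx : ‖x.1‖ = 0
  · rw [hx, mul_zero]; exact norm_nonneg _
  have hx' : 0 < ‖x.1‖ := lt_of_le_of_ne (norm_nonneg _) (Ne.symm hx)
  have h1 : inner ℂ x.1 (shiftBy (hBog N L φ j) w x) =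
      inner ℂ x.1 (hBog N L φ j x) - w * ((‖x.1‖ ^ 2 : ℝ) : ℂ) := by
    have : shiftBy (hBog N L φ j) w x = hBog N L φ j x - w • x.1 := rfl
    rw [this, inner_sub_right, inner_smul_right, inner_self_eq_norm_sq_to_K]
    push_cast
    rfl
  have h2 : (inner ℂ x.1 (shiftBy (hBog N L φ j) w x)).im = -(w.im * ‖x.1‖ ^ 2) := by
    rw [h1, Complex.sub_im, inner_hBog_self_im hj, Complex.im_mul_ofReal]
    ring
  have h3 := (Complex.abs_im_le_norm _).trans
    (norm_inner_le_norm (𝕜 := ℂ) x.1 (shiftBy (hBog N L φ j) w x))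
  rw [h2, abs_neg, abs_mul, abs_of_nonneg (sq_nonneg ‖x.1‖), sq] at h3
  have : ‖x.1‖ * (|w.im| * ‖x.1‖) ≤ ‖x.1‖ * ‖shiftBy (hBog N L φ j) w x‖ := by linarith
  exact le_of_mul_le_mul_left this hx'

theorem norm_shiftBy_ge_of_re_lt {w : ℝ} (y : dom d N L)
    (hy : r * ‖y.1‖ ^ 2 ≤ (inner ℂ y.1 (hBog N L φ j y)).re) :
    (r - w) * ‖y.1‖ ≤ ‖shiftBy (hBog N L φ j) w y‖ := by
  by_cases hx : ‖y.1‖ = 0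
  · rw [hx, mul_zero]; exact norm_nonneg _
  have hx' : 0 < ‖y.1‖ := lt_of_le_of_ne (norm_nonneg _) (Ne.symm hx)
  have h1 : (inner ℂ y.1 (shiftBy (hBog N L φ j) w y)).re =
      (inner ℂ y.1 (hBog N L φ j y)).re - w * ‖y.1‖ ^ 2 := by
    have : shiftBy (hBog N L φ j) w y = hBog N L φ j y - (w : ℂ) • y.1 := rfl
    rw [this, inner_sub_right, inner_smul_right, inner_self_eq_norm_sq_to_K, Complex.sub_re,
      Complex.re_ofReal_mul]
    simp [← Complex.ofReal_pow]
  have h3 := (Complex.re_le_norm _).trans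
    (norm_inner_le_norm (𝕜 := ℂ) y.1 (shiftBy (hBog N L φ j) w y))
  rw [h1] at h3
  have : ‖y.1‖ * ((r - w) * ‖y.1‖) ≤ ‖y.1‖ * ‖shiftBy (hBog N L φ j) w y‖ := by
    nlinarith
  exact le_of_mul_le_mul_left this hx'

/-- The spectrum consists of the eigenvalue `z` and a part above the form bound `r`. -/
theorem spec_subset (hj : j ≠ 0) {m : Conf d N} {ψ : dom d N L}
    (hψ : hBog N L φ j ψ = (z : ℂ) • ψ.1) (hψm : ψ.1 m = 1) (hzr : z ≤ r)
    (hform : ∀ x : dom d N L, x.1 m = 0 → r * ‖x.1‖ ^ 2 ≤ (inner ℂ x.1 (hBog N L φ j x)).re)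
    (w : ℂ) (hw : w ∈ spec (hBog N L φ j)) (hwz : w ≠ z) : w.im = 0 ∧ r ≤ w.re := by
  have hker : ∀ {c : ℝ} {v : ℂ}, 0 < c →
      (∀ x : dom d N L, c * ‖x.1‖ ≤ ‖shiftBy (hBog N L φ j) v x‖) →
      ∀ x : dom d N L, hBog N L φ j x = v • x.1 → x = 0 := by
    intro c v hc hb x hx
    have h1 := hb x
    have h2 : shiftBy (hBog N L φ j) v x = hBog N L φ j x - v • x.1 := rfl
    rw [h2, hx, sub_self, norm_zero] at h1
    have h3 : ‖x.1‖ = 0 := by nlinarith [norm_nonneg x.1]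
    exact Subtype.ext (norm_eq_zero.1 h3)
  by_contra hcon
  apply hw
  by_cases him : w.im = 0
  · have hre : w.re < r := by
      by_contra h
      exact hcon ⟨him, not_lt.1 h⟩
    obtain ⟨v, rfl⟩ : ∃ v : ℝ, w = v := ⟨w.re, Complex.ext rfl (by simp [him])⟩
    rw [Complex.ofReal_re] at hre
    have hvz : v ≠ z := fun h => hwz (by rw [h])
    -- H - v multiplies ψ by z - v and is bounded below by r - v on the complement. It keeps the two
    -- parts orthogonal, so the bounds combine by Pythagoras.
    set c := min |z - v| (r - v) with hcdef
    have hc : 0 < c := lt_min (abs_pos.2 (sub_ne_zero.2 (Ne.symm hvz))) (by linarith)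
    have hψ0 : ψ.1 ≠ 0 := fun h => by
      rw [h] at hψm
      exact zero_ne_one hψm
    have hb : ∀ x : dom d N L, c * ‖x.1‖ ≤ ‖shiftBy (hBog N L φ j) v x‖ := by
      intro x
      set a : ℂ := inner ℂ ψ.1 x.1 / ((‖ψ.1‖ : ℂ) ^ 2) with ha
      set y : dom d N L := x - a • ψ with hy
      have hyv : y.1 = x.1 - a • ψ.1 := rfl
      have hort : inner ℂ ψ.1 y.1 = 0 := by
        have : (‖ψ.1‖ : ℂ) ≠ 0 := by exact_mod_cast norm_ne_zero_iff.2 hψ0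
        rw [hyv, inner_sub_right, inner_smul_right, inner_self_eq_norm_sq_to_K, ha]
        change _ - inner ℂ ψ.1 x.1 / (‖ψ.1‖ : ℂ) ^ 2 * (‖ψ.1‖ : ℂ) ^ 2 = 0
        field_simp
        ring
      have hyf := le_inner_hBog_of_orthogonal hj hψ hψm hzr hform y hort
      have h1 := norm_shiftBy_ge_of_re_lt (w := v) y hyf
      have hBy : shiftBy (hBog N L φ j) v y = hBog N L φ j y - (v : ℂ) • y.1 := rfl
      have hxd : x.1 = a • ψ.1 + y.1 := by rw [hyv]; abel
      have hBx : shiftBy (hBog N L φ j) v x =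
          (a * ((z - v : ℝ) : ℂ)) • ψ.1 + shiftBy (hBog N L φ j) v y := by
        have h2 : x = a • ψ + y := by rw [hy]; abel
        have h3 : shiftBy (hBog N L φ j) v ψ = ((z - v : ℝ) : ℂ) • ψ.1 := by
          have : shiftBy (hBog N L φ j) v ψ = hBog N L φ j ψ - (v : ℂ) • ψ.1 := rfl
          rw [this, hψ, ← sub_smul]
          push_cast
          rfl
        conv_lhs => rw [h2, map_add, map_smul, h3, smul_smul]
      have horth2 : inner ℂ ((a * ((z - v : ℝ) : ℂ)) • ψ.1) (shiftBy (hBog N L φ j) v y) = 0 := by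
        rw [inner_smul_left, hBy, inner_sub_right, inner_smul_right, hort, inner_hBog hj, hψ,
          inner_smul_left, hort]
        simp
      have horth1 : inner ℂ (a • ψ.1) y.1 = 0 := by rw [inner_smul_left, hort, mul_zero]
      have n1 : ‖x.1‖ * ‖x.1‖ = ‖a • ψ.1‖ * ‖a • ψ.1‖ + ‖y.1‖ * ‖y.1‖ := by
        rw [hxd, norm_add_sq_eq_norm_sq_add_norm_sq_of_inner_eq_zero (𝕜 := ℂ) _ _ horth1]
      have n2 : ‖shiftBy (hBog N L φ j) v x‖ * ‖shiftBy (hBog N L φ j) v x‖ =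
          (|z - v| * ‖a • ψ.1‖) * (|z - v| * ‖a • ψ.1‖) +
          ‖shiftBy (hBog N L φ j) v y‖ * ‖shiftBy (hBog N L φ j) v y‖ := by
        rw [hBx, norm_add_sq_eq_norm_sq_add_norm_sq_of_inner_eq_zero (𝕜 := ℂ) _ _ horth2, norm_smul,
          norm_mul, norm_smul, Complex.norm_real, Real.norm_eq_abs]
        ring
      have h5 : c * ‖a • ψ.1‖ ≤ |z - v| * ‖a • ψ.1‖ := by
        gcongr
        exact min_le_left _ _
      have h6 : c * ‖y.1‖ ≤ ‖shiftBy (hBog N L φ j) v y‖ :=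
        (mul_le_mul_of_nonneg_right (min_le_right _ _) (norm_nonneg _)).trans h1
      have h7 := mul_self_le_mul_self (by positivity) h5
      have h8 := mul_self_le_mul_self (by positivity) h6
      refine abs_le_of_sq_le_sq' ?_ (norm_nonneg _) |>.2
      calc (c * ‖x.1‖) ^ 2 = c ^ 2 * (‖x.1‖ * ‖x.1‖) := by ring
        _ = c * ‖a • ψ.1‖ * (c * ‖a • ψ.1‖) + c * ‖y.1‖ * (c * ‖y.1‖) := by rw [n1]; ring
        _ ≤ _ := add_le_add h7 h8
        _ = _ := by rw [← n2, sq]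
    refine invertibleOn_univ_of_bounded_below hj hc hb ?_
    rw [Complex.conj_ofReal]
    exact hker hc hb
  · have hc : 0 < |w.im| := abs_pos.2 him
    refine invertibleOn_univ_of_bounded_below hj hc (norm_shiftBy_ge_of_im_ne_zero hj w) ?_
    refine hker (c := |w.im|) hc fun x => ?_
    have := norm_shiftBy_ge_of_im_ne_zero (φ := φ) hj ((starRingEnd ℂ) w) x
    rwa [Complex.conj_im, abs_neg] at this

/-- Subtracting the multiple of ψ leaves a solution of the eigenvalue equation that vanishes at m;
the form bound r > z forces it to be 0. -/
theorem eq_smul_of_hBog_eq {m : Conf d N} {ψ : dom d N L}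
    (hψ : hBog N L φ j ψ = (z : ℂ) • ψ.1) (hψm : ψ.1 m = 1) (hzr : z < r)
    (hform : ∀ x : dom d N L, x.1 m = 0 → r * ‖x.1‖ ^ 2 ≤ (inner ℂ x.1 (hBog N L φ j x)).re)
    (x : dom d N L) (hx : hBog N L φ j x = (z : ℂ) • x.1) : x = x.1 m • ψ := by
  have hval : (x - x.1 m • ψ : dom d N L).1 = x.1 - x.1 m • ψ.1 := rfl
  have h1 := hform (x - x.1 m • ψ) (by
    rw [hval]
    change x.1 m - x.1 m * ψ.1 m = 0
    rw [hψm]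
    ring)
  have h2 : hBog N L φ j (x - x.1 m • ψ) = (z : ℂ) • (x - x.1 m • ψ : dom d N L).1 := by
    rw [map_sub, map_smul, hx, hψ, hval, smul_sub, smul_comm]
  rw [h2, inner_smul_right, inner_self_eq_norm_sq_to_K, Complex.re_ofReal_mul] at h1
  have h3 : ((((‖(x - x.1 m • ψ : dom d N L).1‖ : ℝ) : ℂ) ^ 2).re) =
      ‖(x - x.1 m • ψ : dom d N L).1‖ ^ 2 := by
    rw [← Complex.ofReal_pow, Complex.ofReal_re]
  have h1' : r * ‖(x - x.1 m • ψ : dom d N L).1‖ ^ 2 ≤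
      z * ‖(x - x.1 m • ψ : dom d N L).1‖ ^ 2 := h1.trans (le_of_eq (congrArg (z * ·) h3))
  have h4 : ‖(x - x.1 m • ψ : dom d N L).1‖ = 0 := by
    by_contra hne
    have : 0 < ‖(x - x.1 m • ψ : dom d N L).1‖ ^ 2 := by positivity
    nlinarith
  exact sub_eq_zero.1 (Subtype.ext (norm_eq_zero.1 h4))

end Gap

/-! ### The ground state at small `ε` -/

section Main

variable {d N : ℕ} {j : Mode d} {L φ : ℝ}

theorem sq_le_kSq {L : ℝ} {p : Mode d} (hp : p ≠ 0) : (2 * Real.pi / L) ^ 2 ≤ kSq L p := by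
  obtain ⟨i, hi⟩ : ∃ i, p i ≠ 0 := by
    by_contra! h
    exact hp (funext h)
  have h1 : (1 : ℝ) ≤ (p i : ℝ) ^ 2 := by
    have : (1 : ℤ) ≤ p i ^ 2 := by
      have := sq_pos_of_ne_zero hi
      omega
    exact_mod_cast this
  calc (2 * Real.pi / L) ^ 2 ≤ (2 * Real.pi / L) ^ 2 * (p i : ℝ) ^ 2 :=
        le_mul_of_one_le_right (sq_nonneg _) h1
    _ = (2 * Real.pi / L * (p i : ℝ)) ^ 2 := by ring
    _ ≤ _ := Finset.single_le_sum (f := fun i => (2 * Real.pi / L * (p i : ℝ)) ^ 2)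
        (fun _ _ => sq_nonneg _) (Finset.mem_univ i)

theorem sq_le_gap0 (hj : j ≠ 0) (L : ℝ) : (2 * Real.pi / L) ^ 2 ≤ gap0 d L := by
  have : Nonempty {p : Mode d // p ≠ 0} := ⟨⟨j, hj⟩⟩
  exact le_ciInf fun p => sq_le_kSq p.2

theorem gap0_pos (hj : j ≠ 0) (hL : 0 < L) : 0 < gap0 d L :=
  lt_of_lt_of_le (by have := Real.pi_pos; positivity) (sq_le_gap0 hj L)

/-- The weight in the quadratic form bound: along chains with equal occupation of `±j` and other
modes occupied it comes from the ground state of the chain of `η` at its energy `z`, along all other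
chains from the flow at the energy `z'`. -/
def formWeight (N : ℕ) (L φ : ℝ) (j : Mode d) (z z' : ℝ) (n : Conf d N) : ℝ :=
  open Classical in
  if n = pairConf N j 0 then 0
  else if n.1 j = n.1 (-j) ∧ n.1 0 + pairNum j n ≠ N then
    flowDiag L φ j z (pairConf N j (n.1 j)) * (((n.1 0 : ℝ) + 2) / ((N : ℝ) - 2 * n.1 j + 2))
  else flowDiag L φ j z' n

theorem eq_pairConf_zero {n : Conf d N} (h0 : n.1 0 = N) : n = pairConf N j 0 := by
  apply Subtype.ext
  have h1 : Finsupp.single 0 N + n.1.erase 0 = n.1 := by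
    conv_rhs => rw [← Finsupp.single_add_erase 0 n.1, h0]
  have h2 : (n.1.erase 0).degree = 0 := by
    have := congrArg Finsupp.degree h1
    rw [map_add, Finsupp.degree_single, n.2] at this
    omega
  rw [Finsupp.degree_eq_zero_iff] at h2
  rw [← h1, h2, add_zero]
  rfl

theorem formWeight_pos {ε e s z z' : ℝ} (h : SmallCoupling ε e s) (hN : 0 < N) (hφ : 0 < φ)
    (hκ : kSq L j = φ * ε) (hj : j ≠ 0) (hz : z ≤ -(φ * (1 + ε - e)) + φ * (e * s))
    (hz' : z' ≤ -(φ * (1 + ε - e)) + φ * (e * s)) {n : Conf d N} (hn : 1 ≤ pairNum j n) :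
    0 < formWeight N L φ j z z' n := by
  have hle := zero_add_pairNum_le hj n
  have hne : n ≠ pairConf N j 0 := by
    rintro rfl
    rw [pairNum_pairConf hj (by omega)] at hn
    omega
  rw [formWeight, if_neg hne]
  split_ifs with hc
  · have hpn : pairNum j n = 2 * n.1 j := by rw [pairNum, ← hc.1]; ring
    have h1 := (flowPos h hN hφ hκ hj hz).pos hj (n := pairConf N j (n.1 j))
      (by rw [pairNum_pairConf hj (by omega)]; omega)
    have h2 : (2 : ℝ) * n.1 j ≤ N := by exact_mod_cast (by omega : 2 * n.1 j ≤ N)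
    have h3 : 0 < (N : ℝ) - 2 * n.1 j + 2 := by linarith
    positivity
  · exact (flowPos h hN hφ hκ hj hz').pos hj hn

/-- Without particles in ±j, either the state is η or the weight is a multiple of the continued
fraction at η, which is 0 at the energy z. -/
theorem formWeight_nonneg {ε e s z z' : ℝ} (h : SmallCoupling ε e s) (hN : 0 < N) (hφ : 0 < φ)
    (hκ : kSq L j = φ * ε) (hj : j ≠ 0) (hz : z ≤ -(φ * (1 + ε - e)) + φ * (e * s))
    (hz' : z' ≤ -(φ * (1 + ε - e)) + φ * (e * s))
    (h0 : flowDiag L φ j z (pairConf N j 0) = 0) (n : Conf d N) :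
    0 ≤ formWeight N L φ j z z' n := by
  by_cases hn : 1 ≤ pairNum j n
  · exact (formWeight_pos h hN hφ hκ hj hz hz' hn).le
  · have hle := zero_add_pairNum_le hj n
    have h1 : n.1 j = 0 ∧ n.1 (-j) = 0 := by rw [pairNum] at hn; omega
    rw [formWeight]
    split_ifs with h2 h3
    · exact le_rfl
    · rw [h1.1, h0, zero_mul]
    · exfalso
      apply h2
      refine eq_pairConf_zero ?_
      have : n.1 0 + pairNum j n = N := by
        by_contra hne
        exact h3 ⟨by omega, hne⟩
      omega

/-- The weight is a supersolution at the energy `r`, away from `η`. -/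
theorem formWeight_le {ε e s z z' r : ℝ} (h : SmallCoupling ε e s) (hN : 0 < N)
    (hφ : 0 < φ) (hκ : kSq L j = φ * ε) (hj : j ≠ 0) (hz : z ≤ -(φ * (1 + ε - e)) + φ * (e * s))
    (hNε : 2 ≤ N * ε) (hz0 : z ≤ 0)
    (hr : r ≤ z') (hr' : r ≤ z + gap0 d L)
    {n : Conf d N} (hn : n ≠ pairConf N j 0) :
    formWeight N L φ j z z' n + bUp j φ n ^ 2 / formWeight N L φ j z z' (up j n) ≤
      diagH j L φ n - r := by
  have hN' : (0 : ℝ) < N := by exact_mod_cast hN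
  have hle := zero_add_pairNum_le hj n
  have hupn : ∀ hu : 2 ≤ n.1 0, up j n ≠ pairConf N j 0 := fun hu heq => by
    have h1 := pairNum_up hj hu
    rw [heq, pairNum_pairConf hj (by omega)] at h1
    omega
  by_cases hc : n.1 j = n.1 (-j) ∧ n.1 0 + pairNum j n ≠ N
  · have hpn : pairNum j n = 2 * n.1 j := by rw [pairNum, ← hc.1]; ring
    have hrest : gap0 d L ≤ restKin L j n.1 := by
      refine gap0_le_restKin hj L ?_
      rw [n.2]
      have := hc.2
      rw [pairNum] at this
      omega
    obtain ⟨hlt, ha⟩ : n.1 0 < N - 2 * n.1 j ∧ 2 * n.1 j ≤ N := by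
      have := hc.2
      omega
    obtain ⟨g1, g2, g3, g4⟩ := pairConf_val (L := L) hj ha
    set a := n.1 j with hadef
    set G := flowDiag L φ j z (pairConf N j a) with hG
    set R := bUp j φ (pairConf N j a) ^ 2 / flowDiag L φ j z (pairConf N j (a + 1)) with hR
    have hsum : R + G = 2 * a * (kSq L j + φ / N * ((N : ℝ) - 2 * a)) - z := by
      rw [hG, flowDiag_eq hj, ← pairConf_succ, ← hR, diagH_eq, g1, g2, g3, g4]
      push_cast [Nat.cast_sub ha]
      ring
    have hR0 : 0 ≤ R := by
      by_cases ha2 : 2 * (a + 1) ≤ N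
      · have := (flowPos h hN hφ hκ hj hz).pos hj (n := pairConf N j (a + 1))
          (by rw [pairNum_pairConf hj ha2]; omega)
        positivity
      · rw [hR, bUp_eq_zero (by omega)]
        simp
    have hlt' : (n.1 0 : ℝ) < (N : ℝ) - 2 * a := by
      have : ((n.1 0 : ℕ) : ℝ) < ((N - 2 * a : ℕ) : ℝ) := by exact_mod_cast hlt
      push_cast [Nat.cast_sub ha] at this
      exact this
    have hκ' : 2 * (φ / N) ≤ kSq L j := by
      rw [hκ, ← mul_div_assoc, div_le_iff₀ hN']
      nlinarith
    -- The chain of η, with N - 2a zero-mode particles at this level, is compared with a chain that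
    -- has only `n.1 0` of them.
    have key := supersolution_of_lt (n' := n.1 0) (n := (N : ℝ) - 2 * a) (a := a)
      (Nat.cast_nonneg _) hlt' (Nat.cast_nonneg _) hκ' hz0 hR0 hsum
    have hw1 : formWeight N L φ j z z' n = G * (((n.1 0 : ℝ) + 2) / ((N : ℝ) - 2 * a + 2)) := by
      rw [formWeight, if_neg hn, if_pos hc]
    have hw2 : bUp j φ n ^ 2 / formWeight N L φ j z z' (up j n) ≤
        R * ((n.1 0 : ℝ) / ((N : ℝ) - 2 * a)) := by
      by_cases hu : 2 ≤ n.1 0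
      · have hv := up_val (j := j) hu
        have hu' : (2 : ℝ) ≤ n.1 0 := by exact_mod_cast hu
        have hw3 : formWeight N L φ j z z' (up j n) =
            flowDiag L φ j z (pairConf N j (a + 1)) * ((n.1 0 : ℝ) / ((N : ℝ) - 2 * a)) := by
          rw [formWeight, if_neg (hupn hu), if_pos]
          · rw [hv, pairUp_self hj, pairUp_zero hj]
            push_cast [Nat.cast_sub hu]
            congr 2 <;> ring
          · rw [pairNum_up hj hu, hv, pairUp_self hj, pairUp_neg hj, pairUp_zero hj]
            have := hc.2
            exact ⟨by omega, by omega⟩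
        have hGp := (flowPos h hN hφ hκ hj hz).pos hj (n := pairConf N j (a + 1))
          (by rw [pairNum_pairConf hj (by omega)]; omega)
        rw [hw3, hR, bUp_sq, bUp_sq, g1, g2, g3, ← hc.1]
        push_cast [Nat.cast_sub ha]
        set m : ℝ := (N : ℝ) - 2 * a
        set k : ℝ := (n.1 0 : ℝ)
        set F := flowDiag L φ j z (pairConf N j (a + 1))
        -- Since k < m, the squared bond shrinks at least by (k/m)², while the weight above shrinks
        -- by k/m only.
        have hk : k - 1 ≤ (m - 1) * (k / m) := by
          rw [← mul_div_assoc, le_div_iff₀ (by linarith)]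
          nlinarith
        have hm : 0 < m := by linarith
        calc (φ / N) ^ 2 * (k * (k - 1)) * (((a : ℝ) + 1) * ((a : ℝ) + 1)) / (F * (k / m)) =
              (φ / N) ^ 2 * (m * (k - 1)) * (((a : ℝ) + 1) * ((a : ℝ) + 1)) / F := by
              have : k ≠ 0 := by linarith
              field_simp
          _ ≤ (φ / N) ^ 2 * (m * ((m - 1) * (k / m))) * (((a : ℝ) + 1) * ((a : ℝ) + 1)) / F := by
              gcongr
          _ = _ := by ring
      · rw [bUp_eq_zero hu]
        simp only [ne_eq, OfNat.ofNat_ne_zero, not_false_eq_true, zero_pow, zero_div]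
        have : 0 < (N : ℝ) - 2 * a := lt_of_le_of_lt (Nat.cast_nonneg _) hlt'
        positivity
    rw [hw1, diagH_eq, ← hc.1]
    linarith
  -- On the other chains the continued fraction solves its recursion exactly at z', hence is a
  -- supersolution at r ≤ z'.
  · have hw1 : formWeight N L φ j z z' n = flowDiag L φ j z' n := by
      rw [formWeight, if_neg hn, if_neg hc]
    have hw2 : bUp j φ n ^ 2 / formWeight N L φ j z z' (up j n) =
        bUp j φ n ^ 2 / flowDiag L φ j z' (up j n) := by
      by_cases hu : 2 ≤ n.1 0
      · rw [formWeight, if_neg (hupn hu), if_neg]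
        have hv := up_val (j := j) hu
        rw [pairNum_up hj hu, hv, pairUp_self hj, pairUp_neg hj, pairUp_zero hj]
        intro h1
        exact hc ⟨by omega, by omega⟩
      · rw [bUp_eq_zero hu]; simp
    rw [hw1, hw2, flowDiag_eq hj]
    linarith

theorem eBog_eq {ε e s : ℝ} (h : SmallCoupling ε e s) (hφ : 0 < φ) (hκ : kSq L j = φ * ε) :
    eBog L φ j = -(φ * (1 + ε - e)) := by
  have h1 : kSq L j ^ 2 + 2 * φ * kSq L j = (φ * e) ^ 2 := by
    rw [hκ]
    linear_combination -φ ^ 2 * h.e_sq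
  rw [eBog, h1, Real.sqrt_sq (mul_nonneg hφ.le h.e_pos.le), hκ]
  ring

theorem eps_eq {ε : ℝ} (hφ : 0 < φ) (hκ : kSq L j = φ * ε) : eps L φ j = ε := by
  rw [eps, hκ]; field_simp

theorem width_eq {ε e s : ℝ} (h : SmallCoupling ε e s) (hφ : 0 < φ) (hκ : kSq L j = φ * ε) :
    width L φ j = φ * (e * s) := by
  rw [width, eps_eq hφ hκ, ← h.e_sq, Real.sqrt_sq h.e_pos.le]
  conv_lhs => rw [← h.s_sq, Real.sqrt_sq h.s_pos.le]
  ring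

/-- The ground state of the three-modes Hamiltonian for small `ε` and `1 / N ≤ ε^{3/2} / 10`. -/
theorem exists_groundState {ε e s : ℝ} (h : SmallCoupling ε e s) (hN : 0 < N) (hE : Even N)
    (hL : 0 < L) (hφ : 0 < φ) (hj : j ≠ 0) (hκ : kSq L j = φ * ε)
    (hNε : 1 / (N : ℝ) ≤ ε * s / 10) :
    ∃ z : ℝ, IsFixedPoint N L φ j z ∧ IsGroundState N L φ j z ∧
      GapAbove N L φ j z (gap0 d L / 2) ∧
      (∀ m < N / 2, ‖(gsTerm N L φ j z m : Fock d N)‖ ≤ coeffBound ε e (m + 1)) ∧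
      eBog L φ j ≤ z ∧ z ≤ eBog L φ j + φ * (5 / (e * N)) ∧ z ≤ eBog L φ j + width L φ j := by
  have hN' : (0 : ℝ) < N := by exact_mod_cast hN
  have he := h.e_pos
  have hs := h.s_pos
  have hε := h.eps_pos
  have hse : s ≤ e := by linarith [h.s_le]
  -- This puts the zero of f into the lower half of the window and keeps the upper half for the gap.
  have hδ : 5 / (e * N) ≤ e * s / 2 := by
    have h1 : 5 / (e * N) = 5 / e * (1 / N) := by field_simp
    rw [h1]
    calc 5 / e * (1 / N) ≤ 5 / e * (ε * s / 10) := by gcongr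
      _ = s ^ 2 * s / (2 * e) := by rw [h.s_sq]; field_simp; norm_num
      _ ≤ e ^ 2 * s / (2 * e) := by gcongr
      _ = e * s / 2 := by field_simp
  have hes : 0 < e * s := by positivity
  obtain ⟨z, hz1, hz2, hz0⟩ := exists_chainFrac_eq_zero h hN hE hφ hκ (by linarith)
  have hφδ : φ * (5 / (e * N)) ≤ φ * (e * s / 2) := by gcongr
  have hφes : 0 < φ * (e * s) := by positivity
  have hz : z ≤ -(φ * (1 + ε - e)) + φ * (e * s) := by linarith
  have h0 : flowDiag L φ j z (pairConf N j 0) = 0 := by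
    rw [flowDiag_pairConf hj (by omega)]
    simpa using hz0
  have hfp := flowPos h hN hφ hκ hj hz
  have hψ := hBog_gsVector hj hN hE hfp h0
  have hψm := gsVector_apply_eta hj hN hE hfp
  have hg0 := gap0_pos hj hL
  have hgκ := gap0_le L hj
  have hzneg : z ≤ 0 := by
    have := h.c_ge
    have := h.es_le
    have : φ * (19 / 20) ≤ φ * (1 + ε - e) := by gcongr
    have : φ * (e * s) ≤ φ * (3 / 1600) := by gcongr
    linarith
  have hN2 : 2 ≤ N * ε := by
    have h1 : 1 ≤ N * (ε * s / 10) := by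
      rw [div_le_iff₀ hN'] at hNε
      linarith
    have h2 : s ≤ 1 := by linarith [h.e_le]
    nlinarith [mul_pos hN' hε]
  -- Δ₀ ≤ k_j² = φs² ≤ φes, so Δ₀/2 fits into the upper half of the window.
  have hr1 : z + gap0 d L / 2 ≤ -(φ * (1 + ε - e)) + φ * (e * s) := by
    have : φ * ε ≤ φ * (e * s) := by
      rw [← h.s_sq, sq]
      gcongr
    rw [hκ] at hgκ
    linarith
  have hform : ∀ x : dom d N L, x.1 (pairConf N j 0) = 0 →
      (z + gap0 d L / 2) * ‖x.1‖ ^ 2 ≤ (inner ℂ x.1 (hBog N L φ j x)).re := by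
    intro x hx
    refine le_inner_hBog hj
      (u := formWeight N L φ j z (-(φ * (1 + ε - e)) + φ * (e * s)))
      (formWeight_nonneg h hN hφ hκ hj hz le_rfl h0) (fun n hn => ?_) x fun n hn => ?_
    · refine formWeight_pos h hN hφ hκ hj hz le_rfl ?_
      by_contra hp
      apply hn
      refine bDown_eq_zero fun hb => ?_
      rw [pairNum] at hp
      omega
    · refine formWeight_le h hN hφ hκ hj hz hN2 hzneg hr1 (by linarith) ?_
      rintro rfl
      exact hn hx
  have hEB := eBog_eq h hφ hκ
  have hWE := width_eq h hφ hκ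
  refine ⟨z, ⟨?_, by rw [hEB, hWE]; exact hz, ?_, ?_⟩, ⟨?_, ?_, hψ, ?_⟩, ?_, ?_, ?_, ?_, ?_⟩
  · intro w hw t ht
    rw [hEB, hWE] at hw
    exact stepInvertible hj (flowPos h hN hφ hκ hj hw) (by omega)
  · rw [fixFun_eq hj hN hE hfp, h0, Complex.ofReal_zero]
  · intro w hw hw0
    rw [hEB, hWE] at hw
    rw [fixFun_eq hj hN hE (flowPos h hN hφ hκ hj hw), Complex.ofReal_eq_zero,
      flowDiag_pairConf hj (by omega)] at hw0
    rw [flowDiag_pairConf hj (by omega)] at h0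
    rcases lt_trichotomy w z with hlt | heq | hlt
    · have := chainFrac_strictAnti h hN' hφ hκ le_rfl hlt hz (N - 2 * 0) 0 0 (by simp)
      linarith
    · exact heq
    · have := chainFrac_strictAnti h hN' hφ hκ le_rfl hlt hw (N - 2 * 0) 0 0 (by simp)
      linarith
  · intro w hw
    by_cases hwz : w = z
    · rw [hwz]; simp
    · obtain ⟨h1, h2⟩ := spec_subset hj hψ hψm (by linarith) hform w hw hwz
      exact ⟨h1, by linarith⟩
  · intro hc
    rw [hc] at hψm
    exact zero_ne_one hψm
  · intro x hx
    exact ⟨_, eq_smul_of_hBog_eq hψ hψm (by linarith) hform x hx⟩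
  · intro w hw hwz
    exact spec_subset hj hψ hψm (by linarith) hform w hw hwz
  · intro m hm
    rw [gsTerm_eq hj hE hfp m hm]
    have hs' : ∀ (c : ℂ) (x : dom d N L), (c • x : dom d N L).1 = c • x.1 := fun _ _ => rfl
    rw [hs', norm_smul, norm_basisVec, mul_one, Complex.norm_real, Real.norm_eq_abs, abs_neg]
    exact abs_gsCoeff_le h hN hφ hκ hj hz _ (by omega)
  · rw [hEB]; exact hz1
  · rw [hEB]; exact hz2
  · rw [hEB, hWE]; exact hz

end Main

/-! ### The regimes of parameters -/

section Regimes

variable {d N : ℕ} {j : Mode d} {L φ : ℝ}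

theorem kSq_eq_mul_eps (hφ : 0 < φ) : kSq L j = φ * eps L φ j := by
  rw [eps]; field_simp

theorem smallCoupling {ε : ℝ} (hε : 0 < ε) (hε' : ε ≤ 1 / 1000) :
    SmallCoupling ε (√(ε ^ 2 + 2 * ε)) (√ε) where
  e_pos := Real.sqrt_pos.2 (by positivity)
  s_pos := Real.sqrt_pos.2 hε
  e_sq := Real.sq_sqrt (by positivity)
  s_sq := Real.sq_sqrt hε.le
  e_le := by
    rw [Real.sqrt_le_left (by norm_num)]
    nlinarith

theorem eps_pos (hL : 0 < L) (hφ : 0 < φ) (hj : j ≠ 0) : 0 < eps L φ j :=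
  div_pos ((gap0_pos hj hL).trans_le (gap0_le L hj)) hφ

theorem GapAbove.mono {z g g' : ℝ} (h : GapAbove N L φ j z g) (hg : g' ≤ g) :
    GapAbove N L φ j z g' := fun w hw hwz =>
  ⟨(h w hw hwz).1, by linarith [(h w hw hwz).2]⟩

theorem gapBound_le : gapBound L φ j ≤ gap0 d L / 2 := min_le_left _ _

/-- The momentum scale of the box: `√ε ≥ 2π / (√φ L)`. -/
theorem div_le_sqrt_eps (hL : 0 < L) (hφ : 0 < φ) (hj : j ≠ 0) :
    2 * Real.pi / √φ / L ≤ √(eps L φ j) := by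
  have hπ := Real.pi_pos
  have hs := Real.sqrt_pos.2 hφ
  apply Real.le_sqrt_of_sq_le
  have h1 : (2 * Real.pi / √φ / L) ^ 2 = (2 * Real.pi / L) ^ 2 / φ := by
    rw [div_pow, div_pow, div_pow, Real.sq_sqrt hφ.le]
    field_simp
  rw [h1, eps]
  gcongr
  exact sq_le_kSq hj

theorem sqrt_pow_three {ε : ℝ} (hε : 0 ≤ ε) : √ε ^ 3 = ε * √ε := by
  rw [pow_succ, Real.sq_sqrt hε]

/-- Since b/L ≤ √ε by `div_le_sqrt_eps`, this yields 1/N ≤ ε√ε/10 for every mode. -/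
theorem one_div_le_of_density {ρ b : ℝ} (hb : 0 < b) (hρ : 10 / b ^ 3 ≤ ρ) (hL : 1 ≤ L)
    (hd : 3 ≤ d) (hN : (N : ℝ) = ρ * L ^ d) : 1 / (N : ℝ) ≤ (b / L) ^ 3 / 10 := by
  have hρ0 : 0 < ρ := lt_of_lt_of_le (by positivity) hρ
  have hL0 : 0 < L := by linarith
  have h1 : L ^ 3 ≤ L ^ d := pow_le_pow_right₀ hL hd
  rw [hN]
  calc 1 / (ρ * L ^ d) ≤ 1 / (10 / b ^ 3 * L ^ 3) := by gcongr
    _ = _ := by field_simp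

/-- At fixed ε every term containing N tends to 0. The limiting inequality ε² < kε√ε is strict
because √ε ≤ k/2. -/
theorem eventually_conditions {γ k μ θ C : ℝ} (hγ : 0 < γ) (hγ1 : γ < 1) (hk : 0 < k) (hμ : 0 < μ)
    (hμ1 : μ < 1) (hC : 0 < C) (hL : 0 < L) (hφ : 0 < φ) (hj : j ≠ 0)
    (hε : eps L φ j ≤ (k / 2) ^ 2) :
    ∀ᶠ N : ℕ in atTop, GammaCond k γ N (eps L φ j) ∧ MuCond μ θ C N L φ j := by
  have hε0 := eps_pos hL hφ hj
  have hs0 := Real.sqrt_pos.2 hε0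
  have hg := gap0_pos hj hL
  have hlim : ∀ a : ℝ, 0 < a → Tendsto (fun N : ℕ => 1 / (N : ℝ) ^ a) atTop (𝓝 0) := fun a ha => by
    have := (tendsto_rpow_neg_atTop ha).comp tendsto_natCast_atTop_atTop
    refine this.congr fun N => ?_
    simp only [Function.comp]
    rw [Real.rpow_neg (by positivity), one_div]
  have h1 : Tendsto (fun N : ℕ => (eps L φ j) ^ 2 + (eps L φ j) / (N : ℝ) ^ γ + 1 / (N : ℝ)) atTop
      (𝓝 ((eps L φ j) ^ 2)) := by
    have h2 := ((hlim γ hγ).const_mul (eps L φ j)).const_add ((eps L φ j) ^ 2)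
    have h3 := h2.add tendsto_one_div_atTop_nhds_zero_nat
    simpa [div_eq_mul_inv] using h3
  have hlt : (eps L φ j) ^ 2 < k * eps L φ j * √(eps L φ j) := by
    have h2 : √(eps L φ j) ≤ k / 2 := by
      rw [Real.sqrt_le_left (by positivity)]
      exact hε
    have h3 : √(eps L φ j) * √(eps L φ j) = eps L φ j := Real.mul_self_sqrt hε0.le
    have h4 : 0 < eps L φ j * √(eps L φ j) := by positivity
    calc (eps L φ j) ^ 2 = eps L φ j * √(eps L φ j) * √(eps L φ j) := by
          rw [mul_assoc, h3, sq]
      _ < eps L φ j * √(eps L φ j) * k := by gcongr; linarith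
      _ = _ := by ring
  have e1 := h1.eventually_le_const hlt
  have e2 := (hlim (1 - γ) (by linarith)).eventually_le_const
    (show 0 < k * eps L φ j by positivity)
  have e3 := (hlim μ hμ).eventually_le_const
    (show 0 < C * √(eps L φ j) ^ (1 + θ) by positivity)
  have e4 : ∀ᶠ N : ℕ in atTop, 1 / (N : ℝ) ^ (1 - μ) ≤ 1 / 2 :=
    (hlim (1 - μ) (by linarith)).eventually_le_const (by norm_num)
  have e5 : ∀ᶠ N : ℕ in atTop, φ / gap0 d L * (1 / (N : ℝ)) < 1 / 2 := by
    have := (tendsto_one_div_atTop_nhds_zero_nat (𝕜 := ℝ)).const_mul (φ / gap0 d L)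
    rw [mul_zero] at this
    exact this.eventually_lt_const (by norm_num)
  filter_upwards [e1, e2, e3, e4, e5, eventually_gt_atTop 0] with N h1 h2 h3 h4 h5 h6
  refine ⟨⟨h1, h2⟩, lt_of_le_of_lt ?_ h5, h3⟩
  have hN : (0 : ℝ) < N := by exact_mod_cast h6
  have h7 : (N : ℝ) ^ μ ≤ N / 2 := by
    have h8 : (N : ℝ) ^ μ = N * (1 / (N : ℝ) ^ (1 - μ)) := by
      rw [one_div, ← Real.rpow_neg hN.le, ← Real.rpow_one_add' hN.le (by linarith)]
      congr 1
      ring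
    rw [h8]
    calc N * (1 / (N : ℝ) ^ (1 - μ)) ≤ N * (1 / 2) := by gcongr
      _ = N / 2 := by ring
  refine mul_le_mul_of_nonneg_left ?_ (div_pos hφ hg).le
  calc (N : ℝ) ^ μ / (N * (N - (N : ℝ) ^ μ)) ≤ (N / 2) / (N * (N / 2)) := by
        gcongr
        linarith
    _ = 1 / N := by field_simp

/-- Everything is measured in M = N^(1/3) ≥ tL against b/L ≤ √ε; the exponents 1/3 and 2/3 make all
powers of N integer powers of M. Each lower bound on t beyond t ≥ 2 serves one term of the
conditions. -/
theorem conditions_of_density {k C b t ρ : ℝ} (hk : 0 < k) (hC : 0 < C) (hφ : 0 < φ)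
    (hb : b = 2 * Real.pi / √φ) (ht : 2 ≤ t) (ht1 : 3 / (k * b) ≤ t) (ht2 : 3 / (k * b ^ 3) ≤ t)
    (ht3 : 1 / (k * b ^ 2) ≤ t) (ht4 : 1 / (C * b ^ 2) ≤ t) (ht5 : 5 / b ^ 2 ≤ t)
    (hd : 3 ≤ d) (hρ : t ^ 3 ≤ ρ) (hL : 1 < L) (hj : j ≠ 0) (hN : (N : ℝ) = ρ * L ^ d)
    (hε : eps L φ j ≤ (k / 3) ^ 2) :
    GammaCond k (1 / 3) N (eps L φ j) ∧ MuCond (2 / 3) 1 C N L φ j := by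
  have hπ := Real.pi_pos
  have hsφ := Real.sqrt_pos.2 hφ
  have hb0 : 0 < b := by rw [hb]; positivity
  have hL0 : 0 < L := by linarith
  have hε0 := eps_pos hL0 hφ hj
  have hs0 := Real.sqrt_pos.2 hε0
  have hsb : b / L ≤ √(eps L φ j) := by rw [hb]; exact div_le_sqrt_eps hL0 hφ hj
  have hss : √(eps L φ j) ^ 2 = eps L φ j := Real.sq_sqrt hε0.le
  set σ := √(eps L φ j) with hσ
  have hNge : (t * L) ^ 3 ≤ N := by
    rw [hN, mul_pow]
    have h1 : L ^ 3 ≤ L ^ d := pow_le_pow_right₀ hL.le hd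
    have hρ0 : 0 ≤ ρ := le_trans (by positivity) hρ
    gcongr
  have htL : 2 ≤ t * L := by nlinarith
  have hN0 : (0 : ℝ) < N := lt_of_lt_of_le (by positivity) hNge
  obtain ⟨M, hM⟩ : ∃ M : ℝ, M = (N : ℝ) ^ (1 / 3 : ℝ) := ⟨_, rfl⟩
  have hM0 : 0 < M := by rw [hM]; positivity
  have hM3 : M ^ 3 = N := by
    rw [hM, ← Real.rpow_natCast, ← Real.rpow_mul hN0.le]; norm_num
  have hM2 : M ^ 2 = (N : ℝ) ^ (2 / 3 : ℝ) := by
    rw [hM, ← Real.rpow_natCast, ← Real.rpow_mul hN0.le]; norm_num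
  have hMt : t * L ≤ M := by
    rw [← hM3] at hNge
    exact le_of_pow_le_pow_left₀ (by norm_num) hM0.le hNge
  have hinv : 1 / M ≤ 1 / t * (1 / L) := by
    rw [one_div_mul_one_div]
    exact one_div_le_one_div_of_le (by positivity) hMt
  -- One factor 1/t is kept from every power, so each requirement on t is linear.
  have htp : ∀ i : ℕ, i ≠ 0 → (1 / t) ^ i ≤ 1 / t := fun i hi =>
    pow_le_of_le_one (by positivity) (by rw [div_le_one (by linarith)]; linarith) hi
  have hpow : ∀ i : ℕ, i ≠ 0 → 1 / M ^ i ≤ 1 / t * (1 / L) ^ i := fun i hi => by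
    calc 1 / M ^ i = (1 / M) ^ i := by rw [one_div_pow]
      _ ≤ (1 / t * (1 / L)) ^ i := by gcongr
      _ = (1 / t) ^ i * (1 / L) ^ i := by rw [mul_pow]
      _ ≤ _ := by gcongr; exact htp i hi
  have hswap : ∀ {x y : ℝ}, 0 < x → 0 < y → y / x ≤ t → 1 / t ≤ x / y := by
    intro x y hx hy h
    rw [div_le_iff₀ hx] at h
    rw [div_le_div_iff₀ (by linarith) hy]
    linarith
  have hσi : ∀ i : ℕ, b ^ i * (1 / L) ^ i ≤ σ ^ i := fun i => by
    rw [← mul_pow, ← div_eq_mul_one_div]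
    gcongr
  refine ⟨⟨?_, ?_⟩, ?_, ?_⟩
  · have h1 : eps L φ j ^ 2 ≤ k / 3 * (eps L φ j * σ) := by
      have : σ ≤ k / 3 := by
        rw [hσ, Real.sqrt_le_left (by positivity)]
        exact hε
      calc eps L φ j ^ 2 = eps L φ j * σ * σ := by rw [mul_assoc, ← sq, hss, sq]
        _ ≤ eps L φ j * σ * (k / 3) := by gcongr
        _ = _ := by ring
    have h2 : eps L φ j / (N : ℝ) ^ (1 / 3 : ℝ) ≤ k / 3 * (eps L φ j * σ) := by
      rw [← hM]
      have h3 := hswap (x := k * b) (y := 3) (by positivity) (by norm_num) ht1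
      have h4 := hσi 1
      rw [pow_one, pow_one, pow_one] at h4
      calc eps L φ j / M = eps L φ j * (1 / M) := by ring
        _ ≤ eps L φ j * (1 / t * (1 / L)) := by gcongr
        _ ≤ eps L φ j * (k * b / 3 * (1 / L)) := by gcongr
        _ = k / 3 * (eps L φ j * (b * (1 / L))) := by ring
        _ ≤ _ := by gcongr
    have h5 : 1 / (N : ℝ) ≤ k / 3 * (eps L φ j * σ) := by
      have h3 := hswap (x := k * b ^ 3) (y := 3) (by positivity) (by norm_num) ht2
      calc 1 / (N : ℝ) = 1 / M ^ 3 := by rw [hM3]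
        _ ≤ 1 / t * (1 / L) ^ 3 := hpow 3 (by norm_num)
        _ ≤ k * b ^ 3 / 3 * (1 / L) ^ 3 := by gcongr
        _ = k / 3 * (b ^ 3 * (1 / L) ^ 3) := by ring
        _ ≤ k / 3 * σ ^ 3 := by gcongr; exact hσi 3
        _ = _ := by rw [pow_succ, hss]
    linarith
  · have h3 := hswap (x := k * b ^ 2) (y := 1) (by positivity) (by norm_num) ht3
    rw [show (1 : ℝ) - 1 / 3 = 2 / 3 by norm_num, ← hM2]
    calc 1 / M ^ 2 ≤ 1 / t * (1 / L) ^ 2 := hpow 2 (by norm_num)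
      _ ≤ k * b ^ 2 / 1 * (1 / L) ^ 2 := by gcongr
      _ = k * (b ^ 2 * (1 / L) ^ 2) := by ring
      _ ≤ k * σ ^ 2 := by gcongr; exact hσi 2
      _ = _ := by rw [hss]
  · rw [← hM2, ← hM3]
    have hg := sq_le_gap0 hj L
    have h1 : φ / gap0 d L ≤ L ^ 2 / b ^ 2 := by
      have h2 : L ^ 2 / b ^ 2 = φ / (2 * Real.pi / L) ^ 2 := by
        rw [hb, div_pow, Real.sq_sqrt hφ.le]
        field_simp
      rw [h2]
      gcongr
    have hM2' : 2 ≤ M := htL.trans hMt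
    -- The quotient equals 1/(M³(M - 1)), and M ≥ 2 gives M - 1 ≥ M/2.
    have h3 : M ^ 2 / (M ^ 3 * (M ^ 3 - M ^ 2)) ≤ 2 / M ^ 4 := by
      have h4 : M ^ 3 - M ^ 2 = M ^ 2 * (M - 1) := by ring
      have h5 : 0 < M - 1 := by linarith
      rw [h4, div_le_div_iff₀ (by positivity) (by positivity)]
      have h6 : 0 < M ^ 5 := by positivity
      nlinarith
    have h4 := hswap (x := b ^ 2) (y := 5) (by positivity) (by norm_num) ht5
    have h5 : 0 ≤ M ^ 2 / (M ^ 3 * (M ^ 3 - M ^ 2)) := by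
      have : 0 ≤ M ^ 3 - M ^ 2 := by
        have : M ^ 3 - M ^ 2 = M ^ 2 * (M - 1) := by ring
        rw [this]
        exact mul_nonneg (by positivity) (by linarith)
      positivity
    calc φ / gap0 d L * (M ^ 2 / (M ^ 3 * (M ^ 3 - M ^ 2))) ≤ L ^ 2 / b ^ 2 * (2 / M ^ 4) := by
          gcongr
      _ = L ^ 2 / b ^ 2 * (2 * (1 / M ^ 4)) := by ring
      _ ≤ L ^ 2 / b ^ 2 * (2 * (1 / t * (1 / L) ^ 4)) := by
          gcongr
          exact hpow 4 (by norm_num)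
      _ ≤ L ^ 2 / b ^ 2 * (2 * (b ^ 2 / 5 * (1 / L) ^ 4)) := by gcongr
      _ = 2 / 5 * (1 / L ^ 2) := by field_simp
      _ ≤ 2 / 5 * 1 := by
          gcongr
          rw [div_le_one (by positivity)]
          nlinarith
      _ < 1 / 2 := by norm_num
  · have h3 := hswap (x := C * b ^ 2) (y := 1) (by positivity) (by norm_num) ht4
    rw [← hM2, show (1 : ℝ) + 1 = ((2 : ℕ) : ℝ) by norm_num, Real.rpow_natCast]
    calc 1 / M ^ 2 ≤ 1 / t * (1 / L) ^ 2 := hpow 2 (by norm_num)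
      _ ≤ C * b ^ 2 / 1 * (1 / L) ^ 2 := by gcongr
      _ = C * (b ^ 2 * (1 / L) ^ 2) := by ring
      _ ≤ C * σ ^ 2 := by gcongr; exact hσi 2

/-- `ε → 0` as the box grows at fixed `j`, so that the width of the energy window vanishes. -/
theorem exists_forall_eps_le (φ : ℝ) (j : Mode d) {η : ℝ} (hη : 0 < η) :
    ∃ L₁ : ℝ, 1 ≤ L₁ ∧ ∀ L, L₁ ≤ L → eps L φ j ≤ η := by
  set K := eps 1 φ j with hK
  refine ⟨1 + |K| / η, by have := abs_nonneg K; linarith [div_nonneg this hη.le], fun L hL => ?_⟩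
  have h0 : 0 ≤ |K| / η := by positivity
  have hL1 : 1 ≤ L := by linarith
  have h1 : eps L φ j = K / L ^ 2 := by
    have : kSq L j = kSq 1 j / L ^ 2 := by
      rw [kSq, kSq, Finset.sum_div]
      refine Finset.sum_congr rfl fun i _ => ?_
      have : L ≠ 0 := by linarith
      field_simp
    rw [hK, eps, eps, this, div_right_comm]
  rw [h1, div_le_iff₀ (by positivity)]
  have h2 : |K| / η ≤ L := by linarith
  rw [div_le_iff₀ hη] at h2
  have h3 : L * η ≤ η * L ^ 2 := by
    nlinarith [mul_nonneg hη.le (mul_nonneg (by linarith : 0 ≤ L) (sub_nonneg.2 hL1))]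
  linarith [le_abs_self K]

theorem width_lt {δ : ℝ} (hφ : 0 < φ) (hδ : 0 < δ) (hε : 0 < eps L φ j)
    (h1 : eps L φ j ≤ 1 / 1000) (h2 : eps L φ j ≤ (δ / (2 * φ)) ^ 2) : width L φ j < δ := by
  have h := smallCoupling hε h1
  rw [width]
  have h3 : √(eps L φ j) ≤ δ / (2 * φ) := by
    rw [Real.sqrt_le_left (by positivity)]
    exact h2
  have h4 := h.e_le
  have h5 := h.e_pos
  calc √(eps L φ j) * φ * √(eps L φ j ^ 2 + 2 * eps L φ j) ≤ δ / (2 * φ) * φ * (1 / 20) := by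
        gcongr
    _ = δ / 40 := by field_simp; norm_num
    _ < δ := by linarith

/-- The ground state at fixed density. -/
theorem exists_groundState_of_density {b : ℝ} (hφ : 0 < φ) (hb : b = 2 * Real.pi / √φ)
    (hj : j ≠ 0) (hL : 0 < L) (hN : 0 < N) (hE : Even N) (hρ : 1 / (N : ℝ) ≤ (b / L) ^ 3 / 10)
    (hε : eps L φ j ≤ 1 / 1000) :
    ∃ z : ℝ, IsFixedPoint N L φ j z ∧ IsGroundState N L φ j z ∧
      GapAbove N L φ j z (gap0 d L / 2) ∧ eBog L φ j ≤ z ∧ z ≤ eBog L φ j + width L φ j := by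
  have hε0 := eps_pos hL hφ hj
  have h := smallCoupling hε0 hε
  have hb0 : 0 < b := by
    have := Real.pi_pos
    have := Real.sqrt_pos.2 hφ
    rw [hb]; positivity
  have h1 : (b / L) ^ 3 ≤ eps L φ j * √(eps L φ j) := by
    rw [← sqrt_pow_three hε0.le, hb]
    have := div_le_sqrt_eps hL hφ hj
    rw [hb] at hb0
    gcongr
  obtain ⟨z, a1, a2, a3, _, a4, _, a5⟩ := exists_groundState h hN hE hL hφ hj
    (kSq_eq_mul_eps hφ) (by linarith)
  exact ⟨z, a1, a2, a3, a4, a5⟩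

theorem pos_of_density {ρ : ℝ} (hρ : 0 < ρ) (hL : 0 < L) (hN : (N : ℝ) = ρ * L ^ d) : 0 < N := by
  have : (0 : ℝ) < N := by rw [hN]; positivity
  exact_mod_cast this

/-- The ground state energy in the mean field limit. -/
theorem exists_tendsto_groundState (hL : 0 < L) (hφ : 0 < φ) (hj : j ≠ 0)
    (hε : eps L φ j ≤ 1 / 1000) : ∃ z : ℕ → ℝ,
      (∀ᶠ m : ℕ in atTop, IsFixedPoint (2 * m) L φ j (z m) ∧
        IsGroundState (2 * m) L φ j (z m) ∧ GapAbove (2 * m) L φ j (z m) (gap0 d L / 2)) ∧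
      Tendsto z atTop (𝓝 (eBog L φ j)) := by
  have hε0 := eps_pos hL hφ hj
  have h := smallCoupling hε0 hε
  set e := √(eps L φ j ^ 2 + 2 * eps L φ j) with he
  have hs0 := h.s_pos
  have he0 := h.e_pos
  have hP : ∀ᶠ m : ℕ in atTop, 0 < 2 * m ∧
      1 / ((2 * m : ℕ) : ℝ) ≤ eps L φ j * √(eps L φ j) / 10 := by
    have h1 : Tendsto (fun m : ℕ => 1 / ((2 * m : ℕ) : ℝ)) atTop (𝓝 0) :=
      (tendsto_one_div_atTop_nhds_zero_nat (𝕜 := ℝ)).comp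
        (tendsto_id.const_mul_atTop' (by norm_num : 0 < 2))
    filter_upwards [eventually_gt_atTop 0, h1.eventually_le_const
      (show 0 < eps L φ j * √(eps L φ j) / 10 by positivity)] with m h2 h3
    exact ⟨by omega, h3⟩
  have hex : ∀ m : ℕ, ∃ z : ℝ, (0 < 2 * m ∧
      1 / ((2 * m : ℕ) : ℝ) ≤ eps L φ j * √(eps L φ j) / 10) →
      (IsFixedPoint (2 * m) L φ j z ∧ IsGroundState (2 * m) L φ j z ∧
        GapAbove (2 * m) L φ j z (gap0 d L / 2)) ∧ eBog L φ j ≤ z ∧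
        z ≤ eBog L φ j + φ * (5 / (e * ((2 * m : ℕ) : ℝ))) := by
    intro m
    by_cases hm : 0 < 2 * m ∧ 1 / ((2 * m : ℕ) : ℝ) ≤ eps L φ j * √(eps L φ j) / 10
    · obtain ⟨z, a1, a2, a3, _, a4, a5, _⟩ := exists_groundState h hm.1 (even_two_mul m) hL hφ hj
        (kSq_eq_mul_eps hφ) hm.2
      exact ⟨z, fun _ => ⟨⟨a1, a2, a3⟩, a4, a5⟩⟩
    · exact ⟨0, fun h => absurd h hm⟩
  choose z hz using hex
  refine ⟨z, hP.mono fun m hm => (hz m hm).1, ?_⟩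
  have h1 : Tendsto (fun m : ℕ => eBog L φ j + φ * (5 / (e * ((2 * m : ℕ) : ℝ)))) atTop
      (𝓝 (eBog L φ j)) := by
    have h2 : Tendsto (fun m : ℕ => 1 / ((2 * m : ℕ) : ℝ)) atTop (𝓝 0) :=
      (tendsto_one_div_atTop_nhds_zero_nat (𝕜 := ℝ)).comp
        (tendsto_id.const_mul_atTop' (by norm_num : 0 < 2))
    have h3 := (h2.const_mul (φ * (5 / e))).const_add (eBog L φ j)
    rw [mul_zero, add_zero] at h3
    refine h3.congr fun m => ?_
    rw [← div_div 5 e, mul_assoc, ← div_eq_mul_one_div]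
  exact tendsto_of_tendsto_of_tendsto_of_le_of_le' tendsto_const_nhds h1
    (hP.mono fun m hm => (hz m hm).2.1) (hP.mono fun m hm => (hz m hm).2.2)

end Regimes

end ThreeMode

end

/-! ### Assembly of the regimes. -/

open ThreeMode
theorem mainTheorem1 :
    -- under the two conditions: fixed point, ground state, gap, convergent expansion
    (∀ γ : ℝ, 0 < γ → γ < 1 → ∃ k : ℝ, 0 < k ∧
      ∀ μ θ C : ℝ, 0 < μ → μ < 1 → 0 < θ → 0 < C → ∃ ε₀ : ℝ, 0 < ε₀ ∧
        ∀ ε : ℝ, 0 < ε → ε ≤ ε₀ → ∃ c : ℕ → ℝ, Summable c ∧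
          ∀ (d N : ℕ) (L φ : ℝ) (j : Mode d), 0 < N → Even N → 0 < L → 0 < φ → j ≠ 0 →
            eps L φ j = ε → GammaCond k γ N ε → MuCond μ θ C N L φ j →
            ∃ z : ℝ, IsFixedPoint N L φ j z ∧ IsGroundState N L φ j z ∧
              GapAbove N L φ j z (gapBound L φ j) ∧
              ∀ m < N / 2, ‖(gsTerm N L φ j z m : Fock d N)‖ ≤ c m) ∧
    -- the conditions hold in the mean field limiting regime, in every dimension
    (∀ γ k μ θ C : ℝ, 0 < γ → γ < 1 → 0 < k → 0 < μ → μ < 1 → 0 < θ → 0 < C →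
      ∃ ε₀ : ℝ, 0 < ε₀ ∧ ∀ (d : ℕ) (L φ : ℝ) (j : Mode d), 0 < L → 0 < φ → j ≠ 0 →
        eps L φ j ≤ ε₀ →
        ∀ᶠ N : ℕ in atTop, GammaCond k γ N (eps L φ j) ∧ MuCond μ θ C N L φ j) ∧
    -- the conditions hold for `d ≥ 3` at fixed large density in arbitrarily large boxes
    (∀ k C : ℝ, 0 < k → 0 < C → ∃ ε₀ : ℝ, 0 < ε₀ ∧ ∀ φ : ℝ, 0 < φ → ∃ ρ₀ : ℝ, 0 < ρ₀ ∧
      ∀ (d N : ℕ) (ρ L : ℝ) (j : Mode d), 3 ≤ d → ρ₀ ≤ ρ → 1 < L → j ≠ 0 →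
        (N : ℝ) = ρ * L ^ d → eps L φ j ≤ ε₀ →
        GammaCond k (1 / 3) N (eps L φ j) ∧ MuCond (2 / 3) 1 C N L φ j) ∧
    -- mean field limiting regime: ground state energy and its limit, gap `Δ₀ / 2`
    (∃ ε₀ : ℝ, 0 < ε₀ ∧ ∀ (d : ℕ) (L φ : ℝ) (j : Mode d), 0 < L → 0 < φ → j ≠ 0 →
      eps L φ j ≤ ε₀ → ∃ z : ℕ → ℝ,
        (∀ᶠ m : ℕ in atTop, IsFixedPoint (2 * m) L φ j (z m) ∧
          IsGroundState (2 * m) L φ j (z m) ∧ GapAbove (2 * m) L φ j (z m) (gap0 d L / 2)) ∧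
        Tendsto z atTop (𝓝 (eBog L φ j))) ∧
    -- `d ≥ 3`, fixed large density, arbitrary box: ground state energy and gap
    (∃ ε₀ : ℝ, 0 < ε₀ ∧ ∀ φ : ℝ, 0 < φ → ∃ ρ₀ : ℝ, 0 < ρ₀ ∧
      ∀ (d N : ℕ) (ρ L : ℝ) (j : Mode d), 3 ≤ d → ρ₀ ≤ ρ → 1 < L → j ≠ 0 → Even N →
        (N : ℝ) = ρ * L ^ d → eps L φ j ≤ ε₀ →
        ∃ z : ℝ, IsFixedPoint N L φ j z ∧ IsGroundState N L φ j z ∧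
          GapAbove N L φ j z (gapBound L φ j)) ∧
    -- convergence of the ground state energy as `L → ∞` for `d ≥ 4` at fixed density
    (∀ (d : ℕ) (ρ φ : ℝ) (j : Mode d), 4 ≤ d → 0 < ρ → 0 < φ → j ≠ 0 →
      ∀ δ : ℝ, 0 < δ → ∃ L₀ : ℝ, 0 < L₀ ∧ ∀ (N : ℕ) (L : ℝ), L₀ ≤ L → Even N →
        (N : ℝ) = ρ * L ^ d →
        ∃ z : ℝ, IsFixedPoint N L φ j z ∧ IsGroundState N L φ j z ∧ |z - eBog L φ j| < δ) ∧
    -- the same for `d = 3` at fixed large density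
    (∀ φ : ℝ, 0 < φ → ∃ ρ₀ : ℝ, 0 < ρ₀ ∧ ∀ (ρ : ℝ) (j : Mode 3), ρ₀ ≤ ρ → j ≠ 0 →
      ∀ δ : ℝ, 0 < δ → ∃ L₀ : ℝ, 0 < L₀ ∧ ∀ (N : ℕ) (L : ℝ), L₀ ≤ L → Even N →
        (N : ℝ) = ρ * L ^ 3 →
        ∃ z : ℝ, IsFixedPoint N L φ j z ∧ IsGroundState N L φ j z ∧ |z - eBog L φ j| < δ) := by
  have hbpos : ∀ φ : ℝ, 0 < φ → 0 < 2 * Real.pi / √φ := fun φ hφ => by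
    have := Real.pi_pos
    have := Real.sqrt_pos.2 hφ
    positivity
  -- k = 1/10 turns the first condition into 1/N ≤ ε√ε/10, and ε ≤ 1/1000 ensures e ≤ 1/20.
  refine ⟨fun γ hγ hγ1 => ⟨1 / 10, by norm_num, fun μ θ C _ _ _ _ => ⟨1 / 1000, by norm_num,
      fun ε hε hε' => ?_⟩⟩,
    fun γ k μ θ C hγ hγ1 hk hμ hμ1 _ hC => ⟨(k / 2) ^ 2, by positivity,
      fun d L φ j hL hφ hj hε => eventually_conditions hγ hγ1 hk hμ hμ1 hC hL hφ hj hε⟩,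
    fun k C hk hC => ⟨(k / 3) ^ 2, by positivity, fun φ hφ => ?_⟩,
    ⟨1 / 1000, by norm_num, fun d L φ j hL hφ hj hε => exists_tendsto_groundState hL hφ hj hε⟩,
    ⟨1 / 1000, by norm_num, fun φ hφ => ?_⟩, fun d ρ φ j hd hρ hφ hj δ hδ => ?_, fun φ hφ => ?_⟩
  · have h := smallCoupling hε hε'
    refine ⟨_, summable_coeffBound h, fun d N L φ j hN hE hL hφ hj heps hG _ => ?_⟩
    have hκ : kSq L j = φ * ε := by rw [← heps]; exact kSq_eq_mul_eps hφ
    have h1 : 1 / (N : ℝ) ≤ ε * √ε / 10 := by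
      have h2 := hG.1
      have h3 : 0 ≤ ε / (N : ℝ) ^ γ := by positivity
      have h4 : 0 ≤ ε ^ 2 := by positivity
      linarith
    obtain ⟨z, a1, a2, a3, a4, _⟩ := exists_groundState h hN hE hL hφ hj hκ h1
    exact ⟨z, a1, a2, a3.mono gapBound_le, a4⟩
  · set b := 2 * Real.pi / √φ with hb
    have hb0 := hbpos φ hφ
    rw [← hb] at hb0
    have p1 : 0 ≤ 3 / (k * b) := by positivity
    have p2 : 0 ≤ 3 / (k * b ^ 3) := by positivity
    have p3 : 0 ≤ 1 / (k * b ^ 2) := by positivity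
    have p4 : 0 ≤ 1 / (C * b ^ 2) := by positivity
    have p5 : 0 ≤ 5 / b ^ 2 := by positivity
    -- t is the sum of all thresholds, so it exceeds each of them, and ρ₀ = t³.
    refine ⟨(2 + 3 / (k * b) + 3 / (k * b ^ 3) + 1 / (k * b ^ 2) + 1 / (C * b ^ 2) +
      5 / b ^ 2) ^ 3, by positivity, fun d N ρ L j hd hρ hL hj hN hε => ?_⟩
    exact conditions_of_density hk hC hφ hb (by linarith) (by linarith) (by linarith)
      (by linarith) (by linarith) (by linarith) hd hρ hL hj hN hε
  · have hb0 := hbpos φ hφ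
    refine ⟨10 / (2 * Real.pi / √φ) ^ 3, by positivity, fun d N ρ L j hd hρ hL hj hE hN hε => ?_⟩
    have hρ0 : 0 < ρ := lt_of_lt_of_le (by positivity) hρ
    have hL0 : 0 < L := by linarith
    obtain ⟨z, a1, a2, a3, _⟩ := exists_groundState_of_density hφ rfl hj hL0
      (pos_of_density hρ0 hL0 hN) hE (one_div_le_of_density hb0 hρ hL.le hd hN) hε
    exact ⟨z, a1, a2, a3.mono gapBound_le⟩
  · have hb0 := hbpos φ hφ
    obtain ⟨L₁, hL₁, hlim⟩ := exists_forall_eps_le φ j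
      (η := min (1 / 1000) ((δ / (2 * φ)) ^ 2)) (by positivity)
    set b := 2 * Real.pi / √φ with hb
    refine ⟨max L₁ (10 / (ρ * b ^ 3)), lt_of_lt_of_le (by linarith) (le_max_left _ _),
      fun N L hL hE hN => ?_⟩
    have hL1 : 1 ≤ L := hL₁.trans ((le_max_left _ _).trans hL)
    have hL0 : 0 < L := by linarith
    have hε := hlim L ((le_max_left _ _).trans hL)
    have hε1 := hε.trans (min_le_left _ _)
    have hLb : 10 / (ρ * b ^ 3) ≤ L := (le_max_right _ _).trans hL
    have hNb : 1 / (N : ℝ) ≤ (b / L) ^ 3 / 10 := by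
      -- For d ≥ 4 a spare factor L is moved into the density: N = (ρL)L^(d-1) with d - 1 ≥ 3, and
      -- ρL is large in large boxes.
      refine one_div_le_of_density (d := d - 1) (ρ := ρ * L) hb0 ?_ hL1 (by omega) ?_
      · rw [div_le_iff₀ (by positivity)] at hLb ⊢
        linarith
      · rw [hN, mul_assoc, ← pow_succ', Nat.sub_add_cancel (by omega)]
    obtain ⟨z, a1, a2, _, a3, a4⟩ := exists_groundState_of_density hφ hb hj hL0
      (pos_of_density hρ hL0 hN) hE hNb hε1
    refine ⟨z, a1, a2, ?_⟩
    -- z lies between E^Bog and the top of the window, whose width is below δ for small ε.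
    have := width_lt hφ hδ (eps_pos hL0 hφ hj) hε1 (hε.trans (min_le_right _ _))
    rw [abs_of_nonneg (by linarith)]
    linarith
  · have hb0 := hbpos φ hφ
    refine ⟨10 / (2 * Real.pi / √φ) ^ 3, by positivity, fun ρ j hρ hj δ hδ => ?_⟩
    have hρ0 : 0 < ρ := lt_of_lt_of_le (by positivity) hρ
    obtain ⟨L₁, hL₁, hlim⟩ := exists_forall_eps_le φ j
      (η := min (1 / 1000) ((δ / (2 * φ)) ^ 2)) (by positivity)
    refine ⟨L₁, by linarith, fun N L hL hE hN => ?_⟩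
    have hL1 : 1 ≤ L := hL₁.trans hL
    have hL0 : 0 < L := by linarith
    have hε := hlim L hL
    have hε1 := hε.trans (min_le_left _ _)
    obtain ⟨z, a1, a2, _, a3, a4⟩ := exists_groundState_of_density hφ rfl hj hL0
      (pos_of_density hρ0 hL0 hN) hE (one_div_le_of_density hb0 hρ hL1 le_rfl hN) hε1
    refine ⟨z, a1, a2, ?_⟩
    have := width_lt hφ hδ (eps_pos hL0 hφ hj) hε1 (hε.trans (min_le_right _ _))
    rw [abs_of_nonneg (by linarith)]
    linarith
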